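/- Let $k$ be a finite field of characteristic $p\neq 2$, let $n\ge 1$, $d\ge 0$ and $0\le j\le d$, and let $W_n$ denote $p$-typical Witt vectors of length $n$. On $\mathbb{P}^d=\mathbb{P}^d_k$, with homogeneous coordinates $z_0,\dots,z_d$, let $W_n\mathcal{O}$ be the sheaf $U\mapsto W_n(\Gamma(U,\mathcal{O}))$ and let $\mathbb{P}^j=\{z_{j+1}=\dots=z_d=0\}\subseteq\mathbb{P}^d$. Put $$\tilde H^{d-j}_{\mathbb{P}^j}(\mathbb{P}^d,W_n\mathcal{O})=\ker\bigl(H^{d-j}_{\mathbb{P}^j}(\mathbb{P}^d,W_n\mathcal{O})\to H^{d-j}(\mathbb{P}^d,W_n\mathcal{O})\bigr),$$ where $H^i_Z(X,-)$ is the $i$-th right derived functor of the functor of global sections with support in $Z$ on abelian sheaves. Let $P_j\subseteq \mathrm{GL}_{d+1}(k)$ be the stabilizer of $\mathbb{P}^j$, that is, the subgroup of the matrices $(g_{ab})_{0\le a,b\le d}$ with $g_{ab}=0$ for $a\le j<b$; it acts on $\tilde H^{d-j}_{\mathbb{P}^j}(\mathbb{P}^d,W_n\mathcal{O})$ through its action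 $[z]\mapsto [z]g^{-1}$ on $\mathbb{P}^d$ (on functions, $(g f)(z)=f(zg)$ for row vectors $z$). The ring $\mathcal{D}_n=\Gamma(\mathbb{P}^d,\mathcal{D}_{W_n(\mathbb{P}^d)})$ of global Witt differential operators is defined as follows. For $A=k[t_1,\dots,t_m]$ let $\tilde w\colon W_n(A)\to W_n(k)[t_1,\dots,t_m]$ be the injective map $(f_0,\dots,f_{n-1})\mapsto\sum_{s} p^s \tilde f_s^{\,p^{n-1-s}}$, where $\tilde f_s$ is any lift of $f_s$. For $r\ge 0$ let $\partial_{i,n}^{[r]}$ be the unique endomorphism of $W_n(A)$ with $\tilde w\circ \partial_{i,n}^{[r]}=\partial_i^{[r]}\circ\tilde w$, where $\partial_i^{[r]}$ is the $W_n(k)$-linear map $t^e\mapsto\binom{e_i}{r}t^{e-r\varepsilon_i}$. For $a\in W(A)$ and $r\geq 1$ with $v=v_p(r)\le n-1$, the values of $\partial_{i,n}^{[r]}$ are of the form $V^{n-1-v}(y)$, and $a\bullet\partial_{i,n}^{[r]}$ is the operator with the values $V^{n-1-v}(ay)$; for $r=0$ or $v_p(r)>n-1$ put $a\bullet\partial_{i,n}^{[r]}=a\,\partial_{i,n}^{[r]}$.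 Let $\mathcal{D}_{W_n(A)}$ be the algebra of operators on $W_n(A)$ generated by the multiplications with elements of $W_n(A)$ and by all $a\bullet\partial_{i,n}^{[r]}$. Then $\mathcal{D}_n$ is the ring of the $W_n(k)$-linear endomorphisms of the sheaf $W_n\mathcal{O}$ on $\mathbb{P}^d$ which are given by Grothendieck differential operators on all affine open subsets and which belong to $\mathcal{D}_{W_n(k[z_i/z_l\,:\,i\ne l])}$ on each standard chart $\{z_l\neq 0\}$. By functoriality, $\tilde H^{d-j}_{\mathbb{P}^j}(\mathbb{P}^d,W_n\mathcal{O})$ is a $\mathcal{D}_n$-module. Then there is a $P_j$-stable $W_n(k)$-submodule $N_{n,j}\subseteq \tilde H^{d-j}_{\mathbb{P}^j}(\mathbb{P}^d,W_n\mathcal{O})$ which is finitely generated over $W_n(k)$ and such that the $W_n(k)$-linear homomorphism of $\mathcal{D}_n$-modules $$\rho_{n,j}\colon\mathcal{D}_n\otimes_{W_n(k)}N_{n,j}\to \tilde H^{d-j}_{\mathbb{P}^j}(\mathbb{P}^d,W_n\mathcal{O}),\qquad P\otimes x\mapsto P\cdot x,$$ is surjective. In other words, $\tilde H^{d-j}_{\mathbb{P}^j}(\mathbb{P}^d,W_n\mathcal{O})$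 is generated as a $\mathcal{D}_n$-module by $N_{n,j}$. -/

import Mathlib

open CategoryTheory Opposite TopologicalSpace AlgebraicGeometry Limits

open scoped TensorProduct

universe u

noncomputable section

section Witt
variable (p : ℕ) [Fact p.Prime] (n : ℕ)

/-- The map `W_n(R) → W_n(S)` induced by a ring homomorphism, `(a_0, a_1, …) ↦ (f a_0, f a_1, …)`. -/
def TruncatedWittVector.mapHom {R S : Type*} [CommRing R] [CommRing S] (f : R →+* S) :
    TruncatedWittVector p n R →+* TruncatedWittVector p n S where
  toFun x := TruncatedWittVector.mk p fun i => f (x.coeff i)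
  map_one' := by
    ext i
    rw [TruncatedWittVector.coeff_mk, ← map_one (WittVector.truncate (p := p) n),
      ← map_one (WittVector.truncate (p := p) n), WittVector.coeff_truncate,
      WittVector.coeff_truncate, ← map_one (WittVector.map f), WittVector.map_coeff]
  map_zero' := by
    ext i
    simp
  map_mul' x y := by
    obtain ⟨x, rfl⟩ := WittVector.truncate_surjective p n R x
    obtain ⟨y, rfl⟩ := WittVector.truncate_surjective p n R y
    have h (z : WittVector p R) :
        (TruncatedWittVector.mk p fun i : Fin n => f ((WittVector.truncate n z).coeff i)) =
          WittVector.truncate n (WittVector.map f z) := by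
      ext i
      simp
    rw [← map_mul, h, h, h, map_mul, map_mul]
  map_add' x y := by
    obtain ⟨x, rfl⟩ := WittVector.truncate_surjective p n R x
    obtain ⟨y, rfl⟩ := WittVector.truncate_surjective p n R y
    have h (z : WittVector p R) :
        (TruncatedWittVector.mk p fun i : Fin n => f ((WittVector.truncate n z).coeff i)) =
          WittVector.truncate n (WittVector.map f z) := by
      ext i
      simp
    rw [← map_add, h, h, h, map_add, map_add]

@[simp]
theorem TruncatedWittVector.coeff_mapHom {R S : Type*} [CommRing R] [CommRing S] (f : R →+* S)
    (x : TruncatedWittVector p n R) (i : Fin n) :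
    (TruncatedWittVector.mapHom p n f x).coeff i = f (x.coeff i) :=
  rfl

theorem TruncatedWittVector.mapHom_id {R : Type*} [CommRing R]
    (x : TruncatedWittVector p n R) :
    TruncatedWittVector.mapHom p n (RingHom.id R) x = x :=
  TruncatedWittVector.ext fun _ => rfl

theorem TruncatedWittVector.mapHom_comp {R S T : Type*} [CommRing R] [CommRing S] [CommRing T]
    (g : S →+* T) (f : R →+* S) (x : TruncatedWittVector p n R) :
    TruncatedWittVector.mapHom p n (g.comp f) x =
      TruncatedWittVector.mapHom p n g (TruncatedWittVector.mapHom p n f x) :=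
  TruncatedWittVector.ext fun _ => rfl

end Witt
/-- The presheaf `U ↦ W_n(O_X(U))` of abelian groups on a scheme `X`. -/
def wittPresheaf (p : ℕ) [Fact p.Prime] (n : ℕ) (X : Scheme.{u}) :
    TopCat.Presheaf AddCommGrpCat.{u} X where
  obj U := AddCommGrpCat.of (TruncatedWittVector p n (X.presheaf.obj U))
  map f := AddCommGrpCat.ofHom
    (TruncatedWittVector.mapHom p n (X.presheaf.map f).hom).toAddMonoidHom
  map_id U := ConcreteCategory.hom_ext _ _ fun x => by
    change TruncatedWittVector.mapHom p n (X.presheaf.map (𝟙 U)).hom x = x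
    rw [X.presheaf.map_id, CommRingCat.hom_id, TruncatedWittVector.mapHom_id]
  map_comp f g := ConcreteCategory.hom_ext _ _ fun x => by
    change TruncatedWittVector.mapHom p n (X.presheaf.map (f ≫ g)).hom x =
      TruncatedWittVector.mapHom p n (X.presheaf.map g).hom
        (TruncatedWittVector.mapHom p n (X.presheaf.map f).hom x)
    rw [X.presheaf.map_comp, CommRingCat.hom_comp, TruncatedWittVector.mapHom_comp]

/-- The sheaf `W_n O_X` on a scheme `X`, `U ↦ W_n(O_X(U))`, as a sheaf of abelian groups. -/
def wittSheaf (p : ℕ) [Fact p.Prime] (n : ℕ) (X : Scheme.{u}) :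
    TopCat.Sheaf AddCommGrpCat.{u} X where
  obj := wittPresheaf p n X
  property := by
    refine (TopCat.Presheaf.isSheaf_iff_isSheafUniqueGluing.{u} _).2 fun ι U sf hsf => ?_
    let t (a : ι) : TruncatedWittVector p n Γ(X, U a) := sf a
    have key (i : Fin n) := X.sheaf.existsUnique_gluing U (fun a => (t a).coeff i)
      (fun a b => congrArg
        (fun x : TruncatedWittVector p n Γ(X, U a ⊓ U b) => x.coeff i) (hsf a b))
    choose s hs hs' using key
    refine ⟨TruncatedWittVector.mk p s, fun a => TruncatedWittVector.ext (p := p) fun i => ?_,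
      fun t ht => TruncatedWittVector.ext (p := p) fun i => ?_⟩
    · exact hs i a
    · exact (hs' i _ fun a => congrArg
        (fun x : TruncatedWittVector p n Γ(X, U a) => x.coeff i) (ht a))
section LocCoh
variable {X : TopCat.{u}}

/-- The sheaf `ℤ_U` (extension by zero of the constant sheaf `ℤ` on the open subset `U`), as the
free abelian sheaf on the sheaf of sets represented by `U`. -/
def zSheaf (X : TopCat.{u}) : Opens X ⥤ TopCat.Sheaf AddCommGrpCat.{u} X :=
  yoneda ⋙ (Functor.whiskeringRight _ _ _).obj AddCommGrpCat.free ⋙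
    presheafToSheaf (Opens.grothendieckTopology X) AddCommGrpCat.{u}

/-- `Hom(ℤ_U, F) = F(U)`. -/
def zSheafHomEquiv (U : Opens X) (F : TopCat.Sheaf AddCommGrpCat.{u} X) :
    ((zSheaf X).obj U ⟶ F) ≃ F.obj.obj (op U) :=
  ((sheafificationAdjunction (Opens.grothendieckTopology X) AddCommGrpCat.{u}).homEquiv _ _).trans
    (((AddCommGrpCat.adj.whiskerRight _).homEquiv _ _).trans yonedaEquiv)

theorem zSheafHomEquiv_naturality {U V : Opens X} (i : U ⟶ V)
    {F : TopCat.Sheaf AddCommGrpCat.{u} X} (f : (zSheaf X).obj V ⟶ F) :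
    zSheafHomEquiv U F ((zSheaf X).map i ≫ f) = F.obj.map i.op (zSheafHomEquiv V F f) := by
  have h1 := Adjunction.homEquiv_naturality_left
    (sheafificationAdjunction (Opens.grothendieckTopology X) AddCommGrpCat.{u})
    (((Functor.whiskeringRight _ _ _).obj AddCommGrpCat.free).map (yoneda.map i)) f
  have h2 := Adjunction.homEquiv_naturality_left
    (AddCommGrpCat.adj.{u}.whiskerRight (Opens X)ᵒᵖ) (yoneda.map i)
    ((sheafificationAdjunction (Opens.grothendieckTopology X) AddCommGrpCat.{u}).homEquiv _ _ f)
  exact (congrArg (fun g => yonedaEquiv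
    ((AddCommGrpCat.adj.{u}.whiskerRight (Opens X)ᵒᵖ).homEquiv _ _ g)) h1).trans
      ((congrArg yonedaEquiv h2).trans (yonedaEquiv_naturality _ i).symm)

theorem zSheafHomEquiv_comp (U : Opens X)
    {F G : TopCat.Sheaf AddCommGrpCat.{u} X} (f : (zSheaf X).obj U ⟶ F) (g : F ⟶ G) :
    zSheafHomEquiv U G (f ≫ g) = g.hom.app (op U) (zSheafHomEquiv U F f) := by
  have h1 := Adjunction.homEquiv_naturality_right
    (sheafificationAdjunction (Opens.grothendieckTopology X) AddCommGrpCat.{u}) f g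
  have h2 := Adjunction.homEquiv_naturality_right
    (AddCommGrpCat.adj.{u}.whiskerRight (Opens X)ᵒᵖ)
    ((sheafificationAdjunction (Opens.grothendieckTopology X) AddCommGrpCat.{u}).homEquiv _ _ f)
    g.hom
  exact (congrArg (fun g => yonedaEquiv
    ((AddCommGrpCat.adj.{u}.whiskerRight (Opens X)ᵒᵖ).homEquiv _ _ g)) h1).trans
      ((congrArg yonedaEquiv h2).trans (yonedaEquiv_comp _ _))

theorem zSheafHomEquiv_add (U : Opens X) (F : TopCat.Sheaf AddCommGrpCat.{u} X)
    (f g : (zSheaf X).obj U ⟶ F) :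
    zSheafHomEquiv U F (f + g) = zSheafHomEquiv U F f + zSheafHomEquiv U F g := by
  have h (f : (zSheaf X).obj U ⟶ F) := zSheafHomEquiv_comp U (𝟙 _) f
  simp only [Category.id_comp] at h
  rw [h f, h g]
  exact h (f + g)

theorem zSheafHomEquiv_zero (U : Opens X) (F : TopCat.Sheaf AddCommGrpCat.{u} X) :
    zSheafHomEquiv U F 0 = 0 := by
  have := zSheafHomEquiv_add U F 0 0
  rw [add_zero] at this
  exact left_eq_add.1 this

/-- The sheaf `ℤ_Z` (the constant sheaf `ℤ` on the closed subset `Z`, extended by zero), as the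
quotient of `ℤ_X` by `ℤ_{X ∖ Z}`. -/
def zSheafClosed (Z : Closeds X) : TopCat.Sheaf AddCommGrpCat.{u} X :=
  cokernel ((zSheaf X).map (homOfLE (le_top : Z.compl ≤ ⊤)))

/-- The quotient map `ℤ_X → ℤ_Z`. -/
def zSheafClosedπ (Z : Closeds X) : (zSheaf X).obj ⊤ ⟶ zSheafClosed Z :=
  cokernel.π ((zSheaf X).map (homOfLE (le_top : Z.compl ≤ ⊤)))

theorem zSheafClosed_condition (Z : Closeds X) :
    (zSheaf X).map (homOfLE (le_top : Z.compl ≤ ⊤)) ≫ zSheafClosedπ Z = 0 :=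
  cokernel.condition _

instance (Z : Closeds X) : Epi (zSheafClosedπ Z) :=
  inferInstanceAs (Epi (cokernel.π ((zSheaf X).map (homOfLE (le_top : Z.compl ≤ ⊤)))))

/-- The group `Γ_Z(X, F)` of global sections of `F` with support in `Z`. -/
def sectionsWithSupport (Z : Closeds X) (F : TopCat.Sheaf AddCommGrpCat.{u} X) :
    AddSubgroup (F.obj.obj (op ⊤)) :=
  (F.obj.map (homOfLE (le_top : Z.compl ≤ ⊤)).op).hom.ker

/-- `Hom(ℤ_Z, F) = Γ_Z(X, F)`. Hence the groups `Ext^i(ℤ_Z, F)` are the right derived functors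
of `Γ_Z(X, -)`. -/
def zSheafClosedHomEquiv (Z : Closeds X) (F : TopCat.Sheaf AddCommGrpCat.{u} X) :
    (zSheafClosed Z ⟶ F) ≃+ sectionsWithSupport Z F where
  toFun f := ⟨zSheafHomEquiv ⊤ F (zSheafClosedπ Z ≫ f), by
    have h := zSheafHomEquiv_naturality (homOfLE (le_top : Z.compl ≤ ⊤)) (zSheafClosedπ Z ≫ f)
    rw [← Category.assoc, zSheafClosed_condition, zero_comp, zSheafHomEquiv_zero] at h
    exact h.symm⟩
  invFun s := cokernel.desc _ ((zSheafHomEquiv ⊤ F).symm s.1) (by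
    apply (zSheafHomEquiv _ F).injective
    rw [zSheafHomEquiv_naturality, zSheafHomEquiv_zero, Equiv.apply_symm_apply]
    exact s.2)
  left_inv f := (cancel_epi (zSheafClosedπ Z)).1
    ((cokernel.π_desc _ _ _).trans (Equiv.symm_apply_apply _ _))
  right_inv s := Subtype.ext <|
    (congrArg (zSheafHomEquiv ⊤ F) (cokernel.π_desc _ _ _)).trans (Equiv.apply_symm_apply _ _)
  map_add' f g := Subtype.ext <|
    (congrArg (zSheafHomEquiv ⊤ F) (Preadditive.comp_add _ _ _ _ f g)).trans
      (zSheafHomEquiv_add _ _ _ _)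

variable (Z : Closeds X) (F : TopCat.Sheaf AddCommGrpCat.{u} X) (i : ℕ)

/-- The local cohomology group `H^i_Z(X, F) = Ext^i(ℤ_Z, F)`. -/
def LocalCohomology : Type u :=
  Abelian.Ext (zSheafClosed Z) F i

/-- The cohomology group `H^i(X, F) = Ext^i(ℤ_X, F)`. -/
def GlobalCohomology : Type u :=
  Abelian.Ext ((zSheaf X).obj ⊤) F i

instance : AddCommGroup (LocalCohomology Z F i) :=
  inferInstanceAs (AddCommGroup (Abelian.Ext (zSheafClosed Z) F i))

instance : AddCommGroup (GlobalCohomology F i) :=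
  inferInstanceAs (AddCommGroup (Abelian.Ext ((zSheaf X).obj ⊤) F i))

/-- By functoriality, `H^i_Z(X, F)` is a module over the ring of endomorphisms of `F`. -/
instance : Module (End F) (LocalCohomology Z F i) where
  smul θ x := Abelian.Ext.comp (X := zSheafClosed Z) x (Abelian.Ext.mk₀ θ) (add_zero i)
  one_smul x := Abelian.Ext.comp_mk₀_id (X := zSheafClosed Z) x
  mul_smul θ η x :=
    (congrArg (fun y => Abelian.Ext.comp (X := zSheafClosed Z) x y (add_zero i))
      (Abelian.Ext.mk₀_comp_mk₀ η θ).symm).trans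
        (Abelian.Ext.comp_assoc_of_third_deg_zero (X := zSheafClosed Z) x _ _ _).symm
  smul_zero _ :=
    Abelian.Ext.zero_comp (zSheafClosed Z) i _ i (add_zero i)
  smul_add θ x y := Abelian.Ext.add_comp (X := zSheafClosed Z) x y _ _
  add_smul θ η x :=
    (congrArg (fun y => Abelian.Ext.comp (X := zSheafClosed Z) x y (add_zero i))
      (Abelian.Ext.mk₀_add θ η)).trans (Abelian.Ext.comp_add (X := zSheafClosed Z) x _ _ _)
  zero_smul x :=
    (congrArg (fun y => Abelian.Ext.comp (X := zSheafClosed Z) x y (add_zero i))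
      (Abelian.Ext.mk₀_zero F F)).trans (Abelian.Ext.comp_zero (X := zSheafClosed Z) x F 0 i (add_zero i))

/-- The forget supports map `H^i_Z(X, F) → H^i(X, F)`, induced by `ℤ_X → ℤ_Z`. -/
def forgetSupports : LocalCohomology Z F i →+ GlobalCohomology F i :=
  (Abelian.Ext.mk₀ (zSheafClosedπ Z)).precomp F (zero_add i)

/-- The reduced local cohomology `ker(H^i_Z(X, F) → H^i(X, F))`. -/
def reducedLocalCohomology : Submodule (End F) (LocalCohomology Z F i) where
  __ := (forgetSupports Z F i).ker
  smul_mem' θ x hx := by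
    have hx : Abelian.Ext.comp (Abelian.Ext.mk₀ (zSheafClosedπ Z)) x (zero_add i) = 0 := hx
    have h := Abelian.Ext.comp_assoc_of_third_deg_zero (Abelian.Ext.mk₀ (zSheafClosedπ Z)) x
      (Abelian.Ext.mk₀ θ) (zero_add i)
    rw [hx, Abelian.Ext.zero_comp] at h
    exact AddMonoidHom.mem_ker.2 h.symm

end LocCoh

section Transport

variable {X Y : TopCat.{u}}

instance (φ : X ⟶ Y) [IsIso φ] :
    (TopCat.Sheaf.pushforward AddCommGrpCat.{u} φ).IsEquivalence := by
  have η {X Y : TopCat.{u}} (f : X ⟶ Y) (g : Y ⟶ X) (h : f ≫ g = 𝟙 X) :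
      Nonempty (𝟭 _ ≅ TopCat.Sheaf.pushforward AddCommGrpCat.{u} f ⋙
        TopCat.Sheaf.pushforward AddCommGrpCat.{u} g) := by
    have h' (U : Opens X) : U = (Opens.map f).obj ((Opens.map g).obj U) := by
      rw [← Opens.map_comp_obj, h, Opens.map_id_obj]
    refine ⟨NatIso.ofComponents (fun F =>
      (fullyFaithfulSheafToPresheaf (Opens.grothendieckTopology X) AddCommGrpCat.{u}).preimageIso
        (NatIso.ofComponents (fun U => F.obj.mapIso (eqToIso (congrArg op (h' U.unop)))) ?_)) ?_⟩
    · intro U V i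
      exact (F.obj.map_comp _ _).symm.trans ((congrArg F.obj.map (Subsingleton.elim _ _)).trans
        (F.obj.map_comp _ _))
    · intro F G a
      exact Sheaf.hom_ext (NatTrans.ext (funext fun U => (a.hom.naturality _).symm))
  exact (CategoryTheory.Equivalence.mk _ _ (η φ (inv φ) (by simp)).some
    (η (inv φ) φ (by simp)).some.symm).isEquivalence_functor

instance (φ : X ⟶ Y) : (TopCat.Sheaf.pushforward AddCommGrpCat.{u} φ).Additive where

variable (φ : X ⟶ Y) {Z : Closeds X} {W : Closeds Y}

theorem sectionsWithSupport_pushforward (h : (Opens.map φ).obj W.compl ≤ Z.compl) {F : TopCat.Sheaf AddCommGrpCat.{u} X}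
    {s : F.obj.obj (op ⊤)} (hs : s ∈ sectionsWithSupport Z F) :
    s ∈ sectionsWithSupport W ((TopCat.Sheaf.pushforward AddCommGrpCat.{u} φ).obj F) := by
  have hs : F.obj.map (homOfLE (le_top : Z.compl ≤ ⊤)).op s = 0 := hs
  have h1 : F.obj.map (homOfLE (le_top : (Opens.map φ).obj W.compl ≤ ⊤)).op s =
      F.obj.map (homOfLE h).op (F.obj.map (homOfLE (le_top : Z.compl ≤ ⊤)).op s) := by
    rw [← ConcreteCategory.comp_apply, ← F.obj.map_comp]
    rfl
  rw [hs, map_zero] at h1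
  exact AddMonoidHom.mem_ker.2 h1

variable (h : (Opens.map φ).obj W.compl ≤ Z.compl)

/-- The map `ℤ_{W} → φ_* ℤ_Z` given by the section `1` of `φ_* ℤ_Z`, which is supported
in `W`. -/
def zSheafClosedToPushforward :
    zSheafClosed W ⟶ (TopCat.Sheaf.pushforward AddCommGrpCat.{u} φ).obj (zSheafClosed Z) :=
  (zSheafClosedHomEquiv W _).symm ⟨(zSheafClosedHomEquiv Z _ (𝟙 _)).1,
    sectionsWithSupport_pushforward φ h (zSheafClosedHomEquiv Z _ (𝟙 _)).2⟩

/-- The map `ℤ_Y → φ_* ℤ_X` given by the section `1` of `φ_* ℤ_X`. -/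
def zSheafToPushforward :
    (zSheaf Y).obj ⊤ ⟶ (TopCat.Sheaf.pushforward AddCommGrpCat.{u} φ).obj ((zSheaf X).obj ⊤) :=
  (zSheafHomEquiv ⊤ _).symm (zSheafHomEquiv (⊤ : Opens X) _ (𝟙 _))

theorem zSheafToPushforward_comp :
    zSheafToPushforward φ ≫ (TopCat.Sheaf.pushforward AddCommGrpCat.{u} φ).map (zSheafClosedπ Z) =
      zSheafClosedπ W ≫ zSheafClosedToPushforward φ h := by
  apply (zSheafHomEquiv ⊤ _).injective
  have h1 := (zSheafClosedHomEquiv W _).apply_symm_apply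
    ⟨(zSheafClosedHomEquiv Z _ (𝟙 _)).1,
      sectionsWithSupport_pushforward φ h (zSheafClosedHomEquiv Z _ (𝟙 _)).2⟩
  have h2 := (zSheafHomEquiv ⊤ ((TopCat.Sheaf.pushforward AddCommGrpCat.{u} φ).obj
    ((zSheaf X).obj ⊤))).apply_symm_apply (zSheafHomEquiv (⊤ : Opens X) _ (𝟙 _))
  have h3 : (zSheafClosedπ Z).hom.app (op ⊤) (zSheafHomEquiv (⊤ : Opens X) _ (𝟙 _)) =
      zSheafHomEquiv ⊤ _ (zSheafClosedπ Z ≫ 𝟙 _) := by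
    rw [← zSheafHomEquiv_comp, Category.id_comp, Category.comp_id]
  exact (zSheafHomEquiv_comp _ _ _).trans
    ((congrArg ((zSheafClosedπ Z).hom.app (op ⊤)) h2).trans
      (h3.trans (congrArg Subtype.val h1).symm))

variable [IsIso φ] {F : TopCat.Sheaf AddCommGrpCat.{u} X} {G : TopCat.Sheaf AddCommGrpCat.{u} Y}
  (α : (TopCat.Sheaf.pushforward AddCommGrpCat.{u} φ).obj F ⟶ G) (i : ℕ)

/-- The map `H^i_Z(X, F) ≅ H^i_{φ(Z)}(Y, φ_* F) → H^i_{W}(Y, G)` for a homeomorphism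
`φ : X → Y`, closed subsets `Z ⊆ X` and `W ⊆ Y` with `φ(Z) ⊆ W`, and `α : φ_* F → G`. -/
def localCohomologyMap : LocalCohomology Z F i →+ LocalCohomology W G i :=
  ((Abelian.Ext.mk₀ α).postcomp (zSheafClosed W) (add_zero i)).comp <|
    ((Abelian.Ext.mk₀ (zSheafClosedToPushforward φ h)).precomp _ (zero_add i)).comp <|
      (TopCat.Sheaf.pushforward AddCommGrpCat.{u} φ).mapExtAddHom (zSheafClosed Z) F i

theorem localCohomologyMap_mem {x : LocalCohomology Z F i}
    (hx : x ∈ reducedLocalCohomology Z F i) :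
    localCohomologyMap φ h α i x ∈ reducedLocalCohomology W G i := by
  have hx : Abelian.Ext.comp (Abelian.Ext.mk₀ (zSheafClosedπ Z)) x (zero_add i) = 0 := hx
  let T := TopCat.Sheaf.pushforward AddCommGrpCat.{u} φ
  let y : Abelian.Ext (T.obj (zSheafClosed Z)) (T.obj F) i := Abelian.Ext.mapExactFunctor T x
  have h1 : (Abelian.Ext.mk₀ (T.map (zSheafClosedπ Z))).comp y (zero_add i) = 0 := by
    have h0 := Abelian.Ext.mapExactFunctor_comp T (Abelian.Ext.mk₀ (zSheafClosedπ Z)) x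
      (zero_add i)
    rw [hx, Abelian.Ext.mapExactFunctor_zero, Abelian.Ext.mapExactFunctor_mk₀] at h0
    exact h0.symm
  have h2 : (Abelian.Ext.mk₀ (zSheafClosedπ W)).comp
      ((Abelian.Ext.mk₀ (zSheafClosedToPushforward φ h)).comp y (zero_add i)) (zero_add i) = 0 := by
    rw [Abelian.Ext.mk₀_comp_mk₀_assoc, ← zSheafToPushforward_comp φ h,
      ← Abelian.Ext.mk₀_comp_mk₀_assoc, h1, Abelian.Ext.comp_zero]
  have h3 := Abelian.Ext.comp_assoc_of_third_deg_zero (Abelian.Ext.mk₀ (zSheafClosedπ W))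
    ((Abelian.Ext.mk₀ (zSheafClosedToPushforward φ h)).comp y (zero_add i))
    (Abelian.Ext.mk₀ α) (zero_add i)
  rw [h2, Abelian.Ext.zero_comp] at h3
  exact AddMonoidHom.mem_ker.2 h3.symm

/-- The map that `localCohomologyMap` induces on reduced local cohomology. -/
def reducedLocalCohomologyMap :
    reducedLocalCohomology Z F i →+ reducedLocalCohomology W G i :=
  ((localCohomologyMap φ h α i).comp
    (reducedLocalCohomology Z F i).toAddSubgroup.subtype).codRestrict
      (reducedLocalCohomology W G i).toAddSubgroup
      fun x => localCohomologyMap_mem φ h α i x.2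

end Transport

section DiffOps

/-- Multiplication by `b` as an additive endomorphism of the ring `B`. -/
abbrev mulOp {B : Type*} [CommRing B] (b : B) : AddMonoid.End B :=
  AddMonoidHom.mulLeft b

/-- Grothendieck differential operators of order `≤ m` on the ring `B`. -/
def IsDiffOpOfOrder {B : Type*} [CommRing B] : ℕ → AddMonoid.End B → Prop
  | 0, P => ∀ b : B, P * mulOp b = mulOp b * P
  | m + 1, P => ∀ b : B, IsDiffOpOfOrder m (P * mulOp b - mulOp b * P)

theorem IsDiffOpOfOrder.add {B : Type*} [CommRing B] {m : ℕ} {P Q : AddMonoid.End B}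
    (hP : IsDiffOpOfOrder m P) (hQ : IsDiffOpOfOrder m Q) : IsDiffOpOfOrder m (P + Q) := by
  induction m generalizing P Q with
  | zero => exact fun b => by rw [add_mul, mul_add, hP b, hQ b]
  | succ m ih =>
    intro b
    rw [add_mul, mul_add, add_sub_add_comm]
    exact ih (hP b) (hQ b)

theorem IsDiffOpOfOrder.neg {B : Type*} [CommRing B] {m : ℕ} {P : AddMonoid.End B}
    (hP : IsDiffOpOfOrder m P) : IsDiffOpOfOrder m (-P) := by
  induction m generalizing P with
  | zero =>
    exact fun b => AddMonoidHom.ext fun x =>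
      (congrArg Neg.neg (DFunLike.congr_fun (hP b) x)).trans (mul_neg b (P x)).symm
  | succ m ih =>
    intro b
    have e : -P * mulOp b - mulOp b * -P = -(P * mulOp b - mulOp b * P) :=
      AddMonoidHom.ext fun x => by
        change -P (b * x) - b * -P x = -(P (b * x) - b * P x)
        ring
    rw [e]
    exact ih (hP b)

theorem IsDiffOpOfOrder.zero {B : Type*} [CommRing B] (m : ℕ) :
    IsDiffOpOfOrder m (0 : AddMonoid.End B) := by
  induction m with
  | zero => exact fun b => by rw [zero_mul, mul_zero]
  | succ m ih =>
    intro b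
    rw [zero_mul, mul_zero, sub_zero]
    exact ih

theorem IsDiffOpOfOrder.mono {B : Type*} [CommRing B] {m l : ℕ} (h : m ≤ l)
    {P : AddMonoid.End B} (hP : IsDiffOpOfOrder m P) : IsDiffOpOfOrder l P := by
  induction l generalizing m P with
  | zero => exact Nat.le_zero.1 h ▸ hP
  | succ l ih =>
    intro b
    cases m with
    | zero => rw [hP b, sub_self]; exact .zero l
    | succ m => exact ih (Nat.le_of_succ_le_succ h) (hP b)

theorem IsDiffOpOfOrder.mul {B : Type*} [CommRing B] {m l : ℕ} {P Q : AddMonoid.End B}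
    (hP : IsDiffOpOfOrder m P) (hQ : IsDiffOpOfOrder l Q) : IsDiffOpOfOrder (m + l) (P * Q) := by
  induction h : m + l generalizing m l P Q with
  | zero =>
    obtain ⟨rfl, rfl⟩ : m = 0 ∧ l = 0 := by omega
    exact fun b => by rw [mul_assoc, hQ b, ← mul_assoc, hP b, mul_assoc]
  | succ s ih =>
    intro b
    have e : P * Q * mulOp b - mulOp b * (P * Q) =
        P * (Q * mulOp b - mulOp b * Q) + (P * mulOp b - mulOp b * P) * Q :=
      AddMonoidHom.ext fun x => by
        change P (Q (b * x)) - b * P (Q x) = P (Q (b * x) - b * Q x) + (P (b * Q x) - b * P (Q x))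
        rw [map_sub]
        ring
    rw [e]
    refine .add ?_ ?_
    · cases l with
      | zero => rw [hQ b, sub_self, mul_zero]; exact .zero s
      | succ l => exact ih hP (hQ b) (by omega)
    · cases m with
      | zero => rw [hP b, sub_self, zero_mul]; exact .zero s
      | succ m => exact ih (hP b) hQ (by omega)

/-- The ring `D(B)` of Grothendieck differential operators on the ring `B`. -/
def groDiffOps (B : Type*) [CommRing B] : Subring (AddMonoid.End B) where
  carrier := {P | ∃ m, IsDiffOpOfOrder m P}
  mul_mem' := fun ⟨_, hP⟩ ⟨_, hQ⟩ => ⟨_, hP.mul hQ⟩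
  one_mem' := ⟨0, fun b => by rw [one_mul, mul_one]⟩
  add_mem' := fun ⟨m, hP⟩ ⟨l, hQ⟩ =>
    ⟨max m l, (hP.mono (le_max_left m l)).add (hQ.mono (le_max_right m l))⟩
  zero_mem' := ⟨0, .zero 0⟩
  neg_mem' := fun ⟨m, hP⟩ => ⟨m, hP.neg⟩

theorem mulOp_mem_groDiffOps {B : Type*} [CommRing B] (a : B) : mulOp a ∈ groDiffOps B :=
  ⟨0, fun b => AddMonoidHom.ext fun x => mul_left_comm a b x⟩

variable (p : ℕ) [Fact p.Prime] (n : ℕ)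

/-- The divided power derivation `∂_i^{[r]}` of a polynomial ring, the `S`-linear map with
`t^e ↦ (e_i choose r) t^{e - r ε_i}`. -/
def mvHasseDeriv {σ S : Type*} [CommRing S] (i : σ) (r : ℕ) :
    MvPolynomial σ S →ₗ[S] MvPolynomial σ S :=
  (MvPolynomial.basisMonomials σ S).constr S fun e =>
    MvPolynomial.monomial (e - Finsupp.single i r) ((e i).choose r : S)

variable {k : Type u} [Field k]

/-- The lift of a polynomial `f` over `k` to a polynomial over `W_n(k)` whose coefficients are the
Teichmüller representatives of those of `f`. -/
def polyLift {σ : Type*} (f : MvPolynomial σ k) :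
    MvPolynomial σ (TruncatedWittVector p n k) :=
  ∑ e ∈ f.support, MvPolynomial.monomial e
    (WittVector.truncate n (WittVector.teichmuller p (f.coeff e)))

/-- The map `W_n(k[t]) → W_n(k)[t]`, `(f_0, …, f_{n-1}) ↦ ∑_j p^j F_j^{p^{n-1-j}}`, where `F_j` is a
lift of `f_j`. It does not depend on the choice of the lifts, and it is injective if `k` is
a perfect field of characteristic `p`. -/
def wittGhost {σ : Type*} (x : TruncatedWittVector p n (MvPolynomial σ k)) :
    MvPolynomial σ (TruncatedWittVector p n k) :=
  ∑ j : Fin n, (p : MvPolynomial σ (TruncatedWittVector p n k)) ^ (j : ℕ) *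
    polyLift p n (x.coeff j) ^ p ^ (n - 1 - (j : ℕ))

/-- `D` is the Witt divided power derivation `∂_{i,n}^{[r]}` of `W_n(k[t])`, that is, the map which
corresponds to the divided power derivation of `W_n(k)[t]` under `wittGhost`. -/
def IsWittHasseDeriv {σ : Type*} (i : σ) (r : ℕ)
    (D : AddMonoid.End (TruncatedWittVector p n (MvPolynomial σ k))) : Prop :=
  ∀ x, wittGhost p n (D x) = mvHasseDeriv i r (wittGhost p n x)

/-- `P` is the operator `Φ^{v - (n - 1)}(a) ∂_{i,n}^{[r]}`, where `v = v_p(r)`, with `Φ` the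
Frobenius.  For `m = n - 1 - v ≥ 0` the values of `∂_{i,n}^{[r]}` are of the form `V^m(y)`,
and `Φ^{-m}(a) V^m(y)` means `V^m(a y)`. For `r = 0` it is the multiplication by `a`. -/
def IsTwistedWittHasseDeriv {σ : Type*} (a : WittVector p (MvPolynomial σ k)) (i : σ) (r : ℕ)
    (P : AddMonoid.End (TruncatedWittVector p n (MvPolynomial σ k))) : Prop :=
  ∃ D, IsWittHasseDeriv p n i r D ∧ ∀ x, ∃ y : WittVector p (MvPolynomial σ k),
    D x = WittVector.truncate n
      (WittVector.verschiebung^[if r = 0 then 0 else n - 1 - padicValNat p r] y) ∧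
    P x = WittVector.truncate n
      (WittVector.verschiebung^[if r = 0 then 0 else n - 1 - padicValNat p r] (a * y))

/-- The algebra `D_{W_n(A)}` of Witt differential operators on `W_n(A)`, `A = k[t_i : i ∈ σ]`: it is
generated by the multiplications with elements of `W_n(A)` and by the operators
`Φ^{v_p(r) - (n - 1)}(a) ∂_{i,n}^{[r]}`, where `a ∈ W(A)`, `i ∈ σ` and `r ≥ 0`. (For
`v_p(r) > n - 1` it suffices to take the multiples `a ∂_{i,n}^{[r]}`.) -/
def wittDiffOps (k : Type u) [Field k] (σ : Type*) :
    Subring (AddMonoid.End (TruncatedWittVector p n (MvPolynomial σ k))) :=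
  Subring.closure (Set.range mulOp ∪ {P | ∃ a i r, IsTwistedWittHasseDeriv p n a i r P})

end DiffOps


section Scalars

variable (p : ℕ) [Fact p.Prime] (n : ℕ) {X : Scheme.{u}}

/-- The operator on `W_n(Γ(X, U))` given by an endomorphism of the sheaf of abelian groups
`W_n O_X`. -/
def wittOp (θ : End (wittSheaf p n X)) (U : X.Opens) :
    AddMonoid.End (TruncatedWittVector p n Γ(X, U)) :=
  (θ.hom.app (op U)).hom

/-- The multiplication by global sections, as endomorphisms of the sheaf `W_n O_X`. -/
def wittScalar (X : Scheme.{u}) :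
    TruncatedWittVector p n Γ(X, ⊤) →+* End (wittSheaf p n X) where
  toFun a := ⟨{
    app := fun U => AddCommGrpCat.ofHom (mulOp (TruncatedWittVector.mapHom p n
      (X.presheaf.map (homOfLE (le_top : U.unop ≤ ⊤)).op).hom a))
    naturality := fun U V i => ConcreteCategory.hom_ext _ _
      fun x : TruncatedWittVector p n Γ(X, U.unop) => by
        have h : TruncatedWittVector.mapHom p n (X.presheaf.map i).hom
            (TruncatedWittVector.mapHom p n
              (X.presheaf.map (homOfLE (le_top : U.unop ≤ ⊤)).op).hom a) =
            TruncatedWittVector.mapHom p n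
              (X.presheaf.map (homOfLE (le_top : V.unop ≤ ⊤)).op).hom a := by
          rw [← TruncatedWittVector.mapHom_comp, ← CommRingCat.hom_comp, ← X.presheaf.map_comp]
          rfl
        have h' := map_mul (TruncatedWittVector.mapHom p n (X.presheaf.map i).hom)
          (TruncatedWittVector.mapHom p n
            (X.presheaf.map (homOfLE (le_top : U.unop ≤ ⊤)).op).hom a) x
        rw [h] at h'
        exact h'.symm }⟩
  map_one' := Sheaf.hom_ext <| NatTrans.ext <| funext fun U =>
    ConcreteCategory.hom_ext _ _ fun x : TruncatedWittVector p n Γ(X, U.unop) =>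
      (congrArg (· * x) (map_one (TruncatedWittVector.mapHom p n _))).trans (one_mul x)
  map_zero' := Sheaf.hom_ext <| NatTrans.ext <| funext fun U =>
    ConcreteCategory.hom_ext _ _ fun x : TruncatedWittVector p n Γ(X, U.unop) =>
      (congrArg (· * x) (map_zero (TruncatedWittVector.mapHom p n _))).trans (zero_mul x)
  map_add' a b := Sheaf.hom_ext <| NatTrans.ext <| funext fun U =>
    ConcreteCategory.hom_ext _ _ fun x : TruncatedWittVector p n Γ(X, U.unop) =>
      (congrArg (· * x) (map_add (TruncatedWittVector.mapHom p n _) a b)).trans (add_mul _ _ x)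
  map_mul' a b := Sheaf.hom_ext <| NatTrans.ext <| funext fun U =>
    ConcreteCategory.hom_ext _ _ fun x : TruncatedWittVector p n Γ(X, U.unop) =>
      (congrArg (· * x) (map_mul (TruncatedWittVector.mapHom p n _) a b)).trans (mul_assoc _ _ x)

end Scalars

section ProjSpace

attribute [local instance] MvPolynomial.gradedAlgebra

variable (k : Type u) [Field k] (d : ℕ)

/-- The projective space `P^d` over `k`, with homogeneous coordinates `z_0, …, z_d`. -/
def projSpace : Scheme.{u} :=
  Proj (MvPolynomial.homogeneousSubmodule (Fin (d + 1)) k)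

/-- The open subset `D_+(f)` of `P^d`. -/
def projBasicOpen (f : MvPolynomial (Fin (d + 1)) k) : (projSpace k d).Opens :=
  Proj.basicOpen (MvPolynomial.homogeneousSubmodule (Fin (d + 1)) k) f

/-- The closed subset `P^j ⊆ P^d`, `P^j = {z_{j + 1} = … = z_d = 0}`. -/
def linSubspace (j : ℕ) : Closeds (projSpace k d) :=
  (⨆ i : {i : Fin (d + 1) // j < i}, projBasicOpen k d (MvPolynomial.X i.1)).compl

/-- The structure map `k → Γ(P^d, O)`. -/
def projConst : k →+* Γ(projSpace k d, ⊤) :=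
  ((Scheme.ΓSpecIso _).inv ≫
    (Proj.toSpecZero (MvPolynomial.homogeneousSubmodule (Fin (d + 1)) k)).appTop).hom.comp
      (algebraMap k (MvPolynomial.homogeneousSubmodule (Fin (d + 1)) k 0))

/-- The coordinate function `z_i / z_l` on the chart `D_+(z_l)`. -/
def projCoord (l i : Fin (d + 1)) : Γ(projSpace k d, projBasicOpen k d (MvPolynomial.X l)) :=
  (Proj.awayToSection (MvPolynomial.homogeneousSubmodule (Fin (d + 1)) k) (MvPolynomial.X l)).hom
    (HomogeneousLocalization.Away.mk _ (MvPolynomial.isHomogeneous_X k l) 1 (MvPolynomial.X i)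
      ((one_smul ℕ 1).symm ▸ MvPolynomial.isHomogeneous_X k i))

/-- The isomorphism `k[t_i : i ≠ l] → Γ(D_+(z_l), O)`, `t_i ↦ z_i / z_l`. -/
def projChart (l : Fin (d + 1)) : MvPolynomial {i : Fin (d + 1) // i ≠ l} k →+*
    Γ(projSpace k d, projBasicOpen k d (MvPolynomial.X l)) :=
  MvPolynomial.eval₂Hom
    (((projSpace k d).presheaf.map (homOfLE le_top).op).hom.comp (projConst k d))
    fun i => projCoord k d l i.1

variable (p : ℕ) [Fact p.Prime] (n : ℕ)

/-- The scalar multiplication by `W_n(k)` on the sheaf `W_n O` on `P^d`. -/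
def projScalar : TruncatedWittVector p n k →+* End (wittSheaf p n (projSpace k d)) :=
  (wittScalar p n (projSpace k d)).comp (TruncatedWittVector.mapHom p n (projConst k d))

/-- The ring `D_n = Γ(P^d, D_{W_n(P^d)})` of global Witt differential operators: the
`W_n(k)`-linear endomorphisms of the sheaf `W_n O` which are (Grothendieck) differential operators
on all affine open subsets, and Witt differential operators on the standard charts
`D_+(z_l)`. -/
def globalWittDiffOps : Subring (End (wittSheaf p n (projSpace k d))) where
  carrier := {θ | (∀ c, θ * projScalar k d p n c = projScalar k d p n c * θ) ∧
    (∀ U : (projSpace k d).Opens, IsAffineOpen U → wittOp p n θ U ∈ groDiffOps _) ∧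
    ∀ l : Fin (d + 1), ∃ Q ∈ wittDiffOps p n k {i : Fin (d + 1) // i ≠ l}, ∀ x,
      wittOp p n θ _ (TruncatedWittVector.mapHom p n (projChart k d l) x) =
        TruncatedWittVector.mapHom p n (projChart k d l) (Q x)}
  mul_mem' := fun {θ η} hθ hη => ⟨fun c => by rw [mul_assoc, hη.1, ← mul_assoc, hθ.1, mul_assoc],
    fun U hU => (groDiffOps _).mul_mem (hθ.2.1 U hU) (hη.2.1 U hU), fun l => by
      obtain ⟨P, hP, hP'⟩ := hθ.2.2 l
      obtain ⟨Q, hQ, hQ'⟩ := hη.2.2 l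
      exact ⟨P * Q, mul_mem hP hQ, fun x =>
        (congrArg (wittOp p n θ _) (hQ' x)).trans (hP' (Q x))⟩⟩
  one_mem' := ⟨fun c => by rw [one_mul, mul_one], fun U hU => (groDiffOps _).one_mem,
    fun l => ⟨1, one_mem _, fun x => rfl⟩⟩
  add_mem' := fun {θ η} hθ hη => ⟨fun c => by rw [add_mul, mul_add, hθ.1, hη.1],
    fun U hU => (groDiffOps _).add_mem (hθ.2.1 U hU) (hη.2.1 U hU), fun l => by
      obtain ⟨P, hP, hP'⟩ := hθ.2.2 l
      obtain ⟨Q, hQ, hQ'⟩ := hη.2.2 l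
      refine ⟨P + Q, add_mem hP hQ, fun x => ?_⟩
      change wittOp p n θ _ _ + wittOp p n η _ _ = TruncatedWittVector.mapHom p n _ (P x + Q x)
      rw [hP', hQ', map_add]⟩
  zero_mem' := ⟨fun c => by rw [zero_mul, mul_zero], fun U hU => (groDiffOps _).zero_mem,
    fun l => ⟨0, zero_mem _, fun x => (map_zero _).symm⟩⟩
  neg_mem' := fun {θ} hθ => ⟨fun c => (neg_mul θ _).trans
      ((congrArg Neg.neg (hθ.1 c)).trans (mul_neg _ θ).symm),
    fun U hU => (groDiffOps _).neg_mem (hθ.2.1 U hU), fun l => by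
      obtain ⟨P, hP, hP'⟩ := hθ.2.2 l
      refine ⟨-P, neg_mem hP, fun x => ?_⟩
      change - wittOp p n θ _ _ = TruncatedWittVector.mapHom p n _ (-P x)
      rw [hP', map_neg]⟩

theorem projScalar_mem (c : TruncatedWittVector p n k) :
    projScalar k d p n c ∈ globalWittDiffOps k d p n := by
  refine ⟨fun c' => by rw [← map_mul, ← map_mul, mul_comm], fun U hU => mulOp_mem_groDiffOps _,
    fun l => ⟨mulOp (TruncatedWittVector.mapHom p n MvPolynomial.C c),
      Subring.subset_closure (Or.inl ⟨_, rfl⟩), fun x => ?_⟩⟩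
  have h : (projChart k d l).comp MvPolynomial.C =
      ((projSpace k d).presheaf.map (homOfLE le_top).op).hom.comp (projConst k d) :=
    MvPolynomial.eval₂Hom_comp_C _ _
  have h' := DFunLike.congr_fun (congrArg (TruncatedWittVector.mapHom p n) h) c
  exact ((map_mul (TruncatedWittVector.mapHom p n (projChart k d l)) _ x).trans
    (congrArg (· * TruncatedWittVector.mapHom p n (projChart k d l) x) h')).symm

instance : Algebra (TruncatedWittVector p n k) (globalWittDiffOps k d p n) where
  smul c θ := ⟨projScalar k d p n c, projScalar_mem k d p n c⟩ * θ
  algebraMap := (projScalar k d p n).codRestrict (globalWittDiffOps k d p n)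
    (projScalar_mem k d p n)
  commutes' c θ := Subtype.ext (θ.2.1 c).symm
  smul_def' _ _ := rfl

end ProjSpace

section Parabolic

variable (k : Type u) [Field k] (d j : ℕ)

/-- The stabilizer `P_j ⊆ GL_{d+1}(k)` of `P^j`, which consists of the matrices `(g_{ab})` with
`g_{ab} = 0` for `a ≤ j < b` (indices starting from `0`). -/
def parabolic : Subgroup (Matrix.GeneralLinearGroup (Fin (d + 1)) k) where
  carrier := {g | ∀ a b : Fin (d + 1), (a : ℕ) ≤ j → j < b → g a b = 0}
  mul_mem' := fun {g h} hg hh a b ha hb => by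
    rw [Matrix.GeneralLinearGroup.coe_mul, Matrix.mul_apply]
    refine Finset.sum_eq_zero fun c _ => ?_
    rcases le_or_gt (c : ℕ) j with hc | hc
    · rw [hh c b hc hb, mul_zero]
    · rw [hg a c ha hc, zero_mul]
  one_mem' := fun a b ha hb => Matrix.one_apply_ne (by rintro rfl; omega)
  inv_mem' := fun {g} hg => by
    have h : Matrix.BlockTriangular (g : Matrix (Fin (d + 1)) (Fin (d + 1)) k)
        (fun a => if (a : ℕ) ≤ j then 1 else 0) := by
      intro a b hab
      dsimp only at hab
      split_ifs at hab with hb ha ha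
      all_goals first | omega | exact hg a b ha (not_le.1 hb)
    let := g.invertible
    have h' := Matrix.blockTriangular_inv_of_blockTriangular h
    intro a b ha hb
    rw [Matrix.coe_units_inv]
    exact h' (by simp [ha, not_le.2 hb])

end Parabolic

section Action

attribute [local instance] MvPolynomial.gradedAlgebra

variable {k : Type u} [Field k] {d : ℕ}

/-- The action of `g ∈ GL_{d+1}(k)` on polynomials, `(g f)(z) = f(z g)` for row vectors `z`, so that
`z_b ↦ ∑_a g_{ab} z_a`. -/
def polyAct (g : Matrix.GeneralLinearGroup (Fin (d + 1)) k) :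
    MvPolynomial.homogeneousSubmodule (Fin (d + 1)) k →+*ᵍ
      MvPolynomial.homogeneousSubmodule (Fin (d + 1)) k where
  toRingHom := (MvPolynomial.aeval fun b => ∑ a, MvPolynomial.C (g a b) * MvPolynomial.X a :
    MvPolynomial (Fin (d + 1)) k →ₐ[k] MvPolynomial (Fin (d + 1)) k).toRingHom
  map_mem {i x} hx := by
    have h := MvPolynomial.IsHomogeneous.aeval (R := k) (n := 1) hx
      (fun b => ∑ a, MvPolynomial.C (g a b) * MvPolynomial.X a)
      (fun b => MvPolynomial.IsHomogeneous.sum _ _ _ fun a _ =>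
        MvPolynomial.isHomogeneous_C_mul_X _ _)
    rw [one_mul] at h
    exact h

@[simp]
theorem polyAct_X (g : Matrix.GeneralLinearGroup (Fin (d + 1)) k) (b : Fin (d + 1)) :
    polyAct g (MvPolynomial.X b) = ∑ a, MvPolynomial.C (g a b) * MvPolynomial.X a :=
  MvPolynomial.aeval_X _ b

@[simp]
theorem polyAct_C (g : Matrix.GeneralLinearGroup (Fin (d + 1)) k) (c : k) :
    polyAct g (MvPolynomial.C c) = MvPolynomial.C c :=
  MvPolynomial.aeval_C _ c

theorem polyAct_mul (g h : Matrix.GeneralLinearGroup (Fin (d + 1)) k) :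
    polyAct (g * h) = (polyAct g).comp (polyAct h) := by
  have key : (polyAct (g * h)).toRingHom = (polyAct g).toRingHom.comp (polyAct h).toRingHom := by
    refine MvPolynomial.ringHom_ext (fun c => ?_) fun b => ?_
    · change polyAct (g * h) _ = polyAct g (polyAct h _)
      rw [polyAct_C, polyAct_C, polyAct_C]
    · change polyAct (g * h) _ = polyAct g (polyAct h _)
      simp only [polyAct_X, map_sum, map_mul, polyAct_C, Matrix.GeneralLinearGroup.coe_mul,
        Matrix.mul_apply, Finset.sum_mul, Finset.mul_sum]
      rw [Finset.sum_comm]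
      exact Finset.sum_congr rfl fun _ _ => Finset.sum_congr rfl fun _ _ => by ring
  exact GradedRingHom.ext fun x => DFunLike.congr_fun key x

theorem polyAct_one :
    polyAct (1 : Matrix.GeneralLinearGroup (Fin (d + 1)) k) = .id _ := by
  have key : (polyAct (1 : Matrix.GeneralLinearGroup (Fin (d + 1)) k)).toRingHom =
      RingHom.id _ := by
    refine MvPolynomial.ringHom_ext (fun c => polyAct_C _ c) fun b => (polyAct_X _ b).trans ?_
    simp [Matrix.one_apply]
  exact GradedRingHom.ext fun x => DFunLike.congr_fun key x

theorem irrelevant_le_polyAct (g : Matrix.GeneralLinearGroup (Fin (d + 1)) k) :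
    HomogeneousIdeal.irrelevant (MvPolynomial.homogeneousSubmodule (Fin (d + 1)) k) ≤
      (HomogeneousIdeal.irrelevant (MvPolynomial.homogeneousSubmodule (Fin (d + 1)) k)).map
        (polyAct g) := by
  intro x hx
  have h1 : polyAct g (polyAct g⁻¹ x) = x := by
    have h := DFunLike.congr_fun (polyAct_mul g g⁻¹) x
    rw [mul_inv_cancel, polyAct_one] at h
    exact h.symm
  rw [← h1]
  refine Ideal.mem_map_of_mem (polyAct g) ?_
  have hx' : GradedRing.proj (MvPolynomial.homogeneousSubmodule (Fin (d + 1)) k) 0 x = 0 :=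
    (HomogeneousIdeal.mem_irrelevant_iff _ _).1 hx
  refine (HomogeneousIdeal.mem_irrelevant_iff _ _).2 ?_
  rw [GradedRing.proj_apply] at hx' ⊢
  rw [← GradedRingHom.map_directSumDecompose, hx', map_zero]

theorem projMap_comp_inv (g : Matrix.GeneralLinearGroup (Fin (d + 1)) k) :
    Proj.map (polyAct g) (irrelevant_le_polyAct g) ≫
      Proj.map (polyAct g⁻¹) (irrelevant_le_polyAct g⁻¹) = 𝟙 _ := by
  have h : (polyAct g).comp (polyAct g⁻¹) = .id _ := by
    rw [← polyAct_mul, mul_inv_cancel, polyAct_one]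
  rw [← Proj.map_comp]
  simp only [h]
  exact Proj.map_id

/-- The automorphism `[z] ↦ [z g]` of `P^d`. -/
def projAut (g : Matrix.GeneralLinearGroup (Fin (d + 1)) k) : projSpace k d ≅ projSpace k d where
  hom := Proj.map (polyAct g) (irrelevant_le_polyAct g)
  inv := Proj.map (polyAct g⁻¹) (irrelevant_le_polyAct g⁻¹)
  hom_inv_id := projMap_comp_inv g
  inv_hom_id := by
    have h := projMap_comp_inv g⁻¹
    simp only [inv_inv] at h
    exact h

theorem mem_linSubspace_compl {j : ℕ} {x : projSpace k d} :
    x ∈ (linSubspace k d j).compl ↔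
      ∃ i : Fin (d + 1), j < i ∧ x ∈ projBasicOpen k d (MvPolynomial.X i) := by
  have h : x ∈ (linSubspace k d j).compl ↔
      x ∈ ⨆ i : {i : Fin (d + 1) // j < i}, projBasicOpen k d (MvPolynomial.X i.1) :=
    not_not
  rw [h, Opens.mem_iSup]
  exact ⟨fun ⟨i, hi⟩ => ⟨i.1, i.2, hi⟩, fun ⟨i, hi, hx⟩ => ⟨⟨i, hi⟩, hx⟩⟩

theorem projAut_preimage_le {j : ℕ} {g : Matrix.GeneralLinearGroup (Fin (d + 1)) k}
    (hg : g ∈ parabolic k d j) :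
    (Opens.map (projAut g).inv.base).obj (linSubspace k d j).compl ≤
      (linSubspace k d j).compl := by
  intro x hx
  obtain ⟨i, hi, hx⟩ := mem_linSubspace_compl.1 hx
  rw [mem_linSubspace_compl]
  by_contra! hx'
  have hx : polyAct g⁻¹ (MvPolynomial.X i) ∉ ProjectiveSpectrum.asHomogeneousIdeal x := hx
  refine hx ?_
  rw [polyAct_X]
  refine sum_mem fun a _ => ?_
  rcases le_or_gt (a : ℕ) j with ha | ha
  · rw [(parabolic k d j).inv_mem hg a i ha hi, map_zero, zero_mul]
    exact zero_mem _
  · exact Ideal.mul_mem_left _ _ (not_not.1 (hx' a ha))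

variable (p : ℕ) [Fact p.Prime] (n : ℕ)

/-- The pullback of sections of `W_n O_X` along an automorphism `e` of `X`: the map
`W_n(Γ(X, e(U))) → W_n(Γ(X, U))`, `f ↦ f ∘ e`, for all `U`. -/
def wittPullback {X : Scheme.{u}} (e : X ≅ X) :
    (TopCat.Sheaf.pushforward AddCommGrpCat.{u} e.inv.base).obj (wittSheaf p n X) ⟶
      wittSheaf p n X where
  hom := {
    app := fun U => AddCommGrpCat.ofHom (TruncatedWittVector.mapHom p n
      (e.hom.appLE (e.inv ⁻¹ᵁ U.unop) U.unop (by
        rw [← Scheme.Hom.comp_preimage, e.hom_inv_id, Scheme.Hom.id_preimage])).hom).toAddMonoidHom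
    naturality := fun U V i => ConcreteCategory.hom_ext _ _
      fun x : TruncatedWittVector p n Γ(X, e.inv ⁻¹ᵁ U.unop) => by
        have h (W : X.Opens) : W ≤ e.hom ⁻¹ᵁ e.inv ⁻¹ᵁ W := by
          rw [← Scheme.Hom.comp_preimage, e.hom_inv_id, Scheme.Hom.id_preimage]
        have h1 : X.presheaf.map ((Opens.map e.inv.base).map i.unop).op ≫
            e.hom.appLE (e.inv ⁻¹ᵁ V.unop) V.unop (h _) =
              e.hom.appLE (e.inv ⁻¹ᵁ U.unop) U.unop (h _) ≫ X.presheaf.map i :=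
          (Scheme.Hom.map_appLE _ _ _).trans (Scheme.Hom.appLE_map _ _ _).symm
        have h2 := congrArg (fun f => TruncatedWittVector.mapHom p n f.hom x) h1
        simp only [CommRingCat.hom_comp, TruncatedWittVector.mapHom_comp] at h2
        exact h2 }

end Action

section WittLocalCohomology

variable (k : Type u) [Field k] (d p : ℕ) [Fact p.Prime] (n j : ℕ)

/-- The group `ker(H^{d-j}_{P^j}(P^d, W_n O) → H^{d-j}(P^d, W_n O))`. -/
def WittLocalCohomology : Type u :=
  reducedLocalCohomology (linSubspace k d j) (wittSheaf p n (projSpace k d)) (d - j)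

instance : AddCommGroup (WittLocalCohomology k d p n j) :=
  inferInstanceAs (AddCommGroup
    (reducedLocalCohomology (linSubspace k d j) (wittSheaf p n (projSpace k d)) (d - j)))

instance : Module (End (wittSheaf p n (projSpace k d))) (WittLocalCohomology k d p n j) :=
  inferInstanceAs (Module (End (wittSheaf p n (projSpace k d)))
    (reducedLocalCohomology (linSubspace k d j) (wittSheaf p n (projSpace k d)) (d - j)))

instance : Module (TruncatedWittVector p n k) (WittLocalCohomology k d p n j) :=
  Module.compHom _ (projScalar k d p n)

instance : IsScalarTower (TruncatedWittVector p n k) (globalWittDiffOps k d p n)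
    (WittLocalCohomology k d p n j) where
  smul_assoc c θ x := mul_smul (projScalar k d p n c) θ.1 x

/-- The action of `P_j` on local cohomology, induced by `(g f)(z) = f(z g)`. -/
def parabolicAct (g : parabolic k d j) :
    WittLocalCohomology k d p n j →+ WittLocalCohomology k d p n j :=
  reducedLocalCohomologyMap (projAut g.1).inv.base (projAut_preimage_le g.2)
    (wittPullback p n (projAut g.1)) (d - j)

end WittLocalCohomology

end

noncomputable section

section AbelianSheaves
variable {X : TopCat.{u}}

/-- Restriction of sections of a sheaf of abelian groups. -/
def secRes (F : TopCat.Sheaf AddCommGrpCat.{u} X) {U V : Opens X} (h : V ≤ U) :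
    F.obj.obj (op U) →+ F.obj.obj (op V) :=
  (F.obj.map (homOfLE h).op).hom

theorem secRes_secRes (F : TopCat.Sheaf AddCommGrpCat.{u} X) {U V W : Opens X} (h : V ≤ U)
    (h' : W ≤ V) (s : F.obj.obj (op U)) :
    secRes F h' (secRes F h s) = secRes F (h'.trans h) s := by
  change (F.obj.map _).hom ((F.obj.map _).hom s) = (F.obj.map _).hom s
  rw [← ConcreteCategory.comp_apply, ← F.obj.map_comp]
  rfl

theorem secRes_self (F : TopCat.Sheaf AddCommGrpCat.{u} X) {U : Opens X} (h : U ≤ U)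
    (s : F.obj.obj (op U)) : secRes F h s = s := by
  change (F.obj.map (𝟙 (op U))).hom s = s
  rw [F.obj.map_id]
  rfl

theorem secRes_app {F G : TopCat.Sheaf AddCommGrpCat.{u} X} (g : F ⟶ G) {U V : Opens X}
    (h : V ≤ U) (s : F.obj.obj (op U)) :
    secRes G h (g.hom.app (op U) s) = g.hom.app (op V) (secRes F h s) :=
  (DFunLike.congr_fun (congrArg AddCommGrpCat.Hom.hom (g.hom.naturality (homOfLE h).op)) s).symm

theorem exists_glue_pair (F : TopCat.Sheaf AddCommGrpCat.{u} X) {U V W : Opens X} (hU : U ≤ W)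
    (hV : V ≤ W) (hW : W ≤ U ⊔ V) (s : F.obj.obj (op U)) (t : F.obj.obj (op V))
    (h : secRes F (inf_le_left : U ⊓ V ≤ U) s = secRes F (inf_le_right : U ⊓ V ≤ V) t) :
    ∃ r : F.obj.obj (op W), secRes F hU r = s ∧ secRes F hV r = t := by
  let f : Bool → Opens X := fun b => if b then U else V
  let sf : ∀ b, F.obj.obj (op (f b)) := fun b =>
    match b with
    | true => s
    | false => t
  have hc : TopCat.Presheaf.IsCompatible F.obj f sf := by
    rintro (_ | _) (_ | _)
    · rfl
    · have h2 := congrArg (secRes F (inf_comm V U).le) h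
      rw [secRes_secRes, secRes_secRes] at h2
      exact h2.symm
    · exact h
    · rfl
  obtain ⟨r, hr, -⟩ := TopCat.Sheaf.existsUnique_gluing' F f W
    (fun b => homOfLE (by cases b <;> assumption)) (by
      rw [iSup_bool_eq]; exact hW) sf hc
  exact ⟨r, hr true, hr false⟩

instance mono_zSheaf_map {U V : Opens X} (i : U ⟶ V) : Mono ((zSheaf X).map i) := by
  change Mono ((presheafToSheaf _ AddCommGrpCat.{u}).map
    (Functor.whiskerRight (yoneda.map i) AddCommGrpCat.free))
  infer_instance

theorem secRes_surjective_of_injective (F : TopCat.Sheaf AddCommGrpCat.{u} X) [Injective F]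
    {U V : Opens X} (h : V ≤ U) : Function.Surjective (secRes F h) := by
  intro s
  refine ⟨zSheafHomEquiv U F (Injective.factorThru ((zSheafHomEquiv V F).symm s)
    ((zSheaf X).map (homOfLE h))), ?_⟩
  refine (zSheafHomEquiv_naturality (homOfLE h) _).symm.trans ?_
  rw [Injective.comp_factorThru, Equiv.apply_symm_apply]

/-- A family of open subsets such that properties of its members can be checked locally, by glueing
along unions of two members. -/
structure IsPairwiseLocalBasis (B : Opens X → Prop) : Prop where
  inf : ∀ {U V}, B U → B V → B (U ⊓ V)
  induction : ∀ R : Opens X → Prop, R ⊥ → (∀ U V, U ≤ V → R V → R U) →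
    (∀ U V, B U → B V → B (U ⊔ V) → R U → R V → R (U ⊔ V)) →
    ∀ W, B W → (∀ x ∈ W, ∃ U, x ∈ U ∧ R U) → R W

/-- Sections over `U ⊓ V` are differences of sections over `U` and `V`, for members `U` and `V` of
the family with union in the family. -/
def HasPairwiseSplitting (B : Opens X → Prop) (F : TopCat.Sheaf AddCommGrpCat.{u} X) : Prop :=
  ∀ U V, B U → B V → B (U ⊔ V) → ∀ t : F.obj.obj (op (U ⊓ V)), 
    ∃ (a : F.obj.obj (op U)) (b : F.obj.obj (op V)),
      t = secRes F inf_le_left a + secRes F inf_le_right b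

theorem exists_section_lift {B : Opens X → Prop} (hB : IsPairwiseLocalBasis B)
    {S : ShortComplex (TopCat.Sheaf AddCommGrpCat.{u} X)} (hS : S.ShortExact)
    (h : HasPairwiseSplitting B S.X₁) {W : Opens X} (hW : B W) (s : S.X₃.obj.obj (op W)) :
    ∃ t, S.g.hom.app (op W) t = s := by
  suffices H : ∃ hW' : W ≤ W, ∃ t, S.g.hom.app (op W) t = secRes S.X₃ hW' s by
    simpa only [secRes_self, le_refl, exists_true_left] using H
  refine hB.induction (fun U => ∃ hU : U ≤ W, ∃ t, S.g.hom.app (op U) t = secRes S.X₃ hU s)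
    ?_ ?_ ?_ W hW ?_
  · refine ⟨bot_le, 0, ?_⟩
    exact TopCat.Sheaf.eq_of_locally_eq' S.X₃ (fun i : PEmpty.{1} => i.elim) ⊥
      (fun i => i.elim) bot_le _ _ fun i => i.elim
  · rintro U V hUV ⟨hV, t, ht⟩
    exact ⟨hUV.trans hV, secRes _ hUV t, by rw [← secRes_app, ht, secRes_secRes]⟩
  · rintro U V hBU hBV hBUV ⟨hUW, a, ha⟩ ⟨hVW, b, hb⟩
    refine ⟨sup_le hUW hVW, ?_⟩
    have hd : S.g.hom.app (op (U ⊓ V)) (secRes _ inf_le_left a - secRes _ inf_le_right b) = 0 := by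
      rw [map_sub, ← secRes_app, ← secRes_app, ha, hb, secRes_secRes, secRes_secRes, sub_self]
    obtain ⟨c, hc⟩ := TopCat.Sheaf.sections_exact_of_left_exact hS.exact hS.mono_f _ hd
    obtain ⟨c₁, c₂, rfl⟩ := h U V hBU hBV hBUV c
    rw [map_add, ← secRes_app, ← secRes_app] at hc
    have hz (U : Opens X) (x) : S.g.hom.app (op U) (S.f.hom.app (op U) x) = 0 := by
      have := congrArg (fun f : S.X₁ ⟶ S.X₃ => f.hom.app (op U)) S.zero
      exact DFunLike.congr_fun (congrArg AddCommGrpCat.Hom.hom this) x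
    obtain ⟨r, hr₁, hr₂⟩ := exists_glue_pair S.X₂ le_sup_left le_sup_right le_rfl
      (a - S.f.hom.app (op U) c₁) (b + S.f.hom.app (op V) c₂) (by
        rw [map_sub, map_add, sub_eq_iff_eq_add, add_assoc, add_comm (secRes _ _ _) (secRes _ _ _),
          hc]
        abel)
    refine ⟨r, TopCat.Sheaf.eq_of_locally_eq₂ S.X₃ (homOfLE le_sup_left) (homOfLE le_sup_right)
      le_rfl _ _ ?_ ?_⟩
    · change secRes _ le_sup_left _ = secRes _ le_sup_left _
      rw [secRes_app, hr₁, map_sub, hz, ha, sub_zero, secRes_secRes]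
    · change secRes _ le_sup_right _ = secRes _ le_sup_right _
      rw [secRes_app, hr₂, map_add, hz, hb, add_zero, secRes_secRes]
  · intro x hx
    have := hS.epi_g
    obtain ⟨V, hV, ⟨t, ht⟩, hxV⟩ := (TopCat.Presheaf.isLocallySurjective_iff S.g.hom).1
      ((TopCat.Sheaf.isLocallySurjective_iff_epi S.g).2 inferInstance) W s x hx
    exact ⟨V, hxV, hV, t, ht⟩


open Abelian in
theorem ext_eq_zero_of_hasPairwiseSplitting {B : Opens X → Prop} (hB : IsPairwiseLocalBasis B)
    (i : ℕ) (F : TopCat.Sheaf AddCommGrpCat.{u} X) (hF : HasPairwiseSplitting B F) {U : Opens X}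
    (hU : B U) (x : Ext ((zSheaf X).obj U) F (i + 1)) : x = 0 := by
  induction i generalizing F with
  | zero =>
    let S := ShortComplex.mk (Injective.ι F) (cokernel.π (Injective.ι F)) (cokernel.condition _)
    have hS : S.ShortExact := { exact := ShortComplex.exact_cokernel _ }
    obtain ⟨y, hy⟩ := Ext.covariant_sequence_exact₁ _ hS x
      (Ext.eq_zero_of_injective (I := Injective.under F) _) rfl
    obtain ⟨f, rfl⟩ := Ext.homEquiv₀.symm.surjective y
    obtain ⟨t, ht⟩ := exists_section_lift hB hS hF hU (zSheafHomEquiv U _ f)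
    have hf : f = (zSheafHomEquiv U _).symm t ≫ S.g := by
      apply (zSheafHomEquiv U _).injective
      rw [zSheafHomEquiv_comp, Equiv.apply_symm_apply, ht]
    subst hf
    rw [← hy]
    change (Ext.mk₀ _).comp _ _ = 0
    rw [← Ext.mk₀_comp_mk₀, Ext.comp_assoc_of_second_deg_zero, hS.comp_extClass, Ext.comp_zero]
  | succ i ih =>
    let S := ShortComplex.mk (Injective.ι F) (cokernel.π (Injective.ι F)) (cokernel.condition _)
    have hS : S.ShortExact := { exact := ShortComplex.exact_cokernel _ }
    obtain ⟨y, hy⟩ := Ext.covariant_sequence_exact₁ _ hS x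
      (Ext.eq_zero_of_injective (I := Injective.under F) _) rfl
    have hQ : HasPairwiseSplitting B S.X₃ := by
      intro U V hU hV _ t
      obtain ⟨t, rfl⟩ := exists_section_lift hB hS hF (hB.inf hU hV) t
      obtain ⟨t, rfl⟩ := secRes_surjective_of_injective (Injective.under F)
        (inf_le_left : U ⊓ V ≤ U) t
      exact ⟨S.g.hom.app (op U) t, 0, by rw [map_zero, add_zero, secRes_app]⟩
    rw [← hy, ih _ hQ y, Ext.zero_comp]

open Abelian in
/-- All higher cohomology groups `H^i(U, F) = Ext^i(ℤ_U, F)` vanish. -/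
def IsAcyclicOn (F : TopCat.Sheaf AddCommGrpCat.{u} X) (U : Opens X) : Prop :=
  ∀ (i : ℕ) (x : Ext ((zSheaf X).obj U) F (i + 1)), x = 0

/-- The union of a list of open subsets. -/
def listSup (l : List (Opens X)) : Opens X := l.foldr (· ⊔ ·) ⊥

theorem listSup_map_inf (V : Opens X) (l : List (Opens X)) :
    listSup (l.map (V ⊓ ·)) = V ⊓ listSup l := by
  induction l with
  | nil => exact inf_bot_eq V |>.symm
  | cons U l ih => exact (congrArg (V ⊓ U ⊔ ·) ih).trans (inf_sup_left _ _ _).symm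

/-- The intersection of a list of open subsets. -/
def listInf (l : List (Opens X)) : Opens X := l.foldr (· ⊓ ·) ⊤

theorem listInf_map_inf (V : Opens X) (l : List (Opens X)) :
    V ⊓ listInf (l.map (V ⊓ ·)) = V ⊓ listInf l := by
  induction l with
  | nil => rfl
  | cons U l ih =>
    change V ⊓ (V ⊓ U ⊓ listInf _) = V ⊓ (U ⊓ listInf l)
    rw [inf_assoc, inf_left_idem, inf_left_comm, ih, inf_left_comm]

open Abelian in
theorem _root_.CategoryTheory.ShortComplex.ShortExact.exists_comp_extClass_of_biprod
    {C : Type*} [Category* C] [Abelian C] [HasExt C] {K A B Q F : C} {f : K ⟶ A ⊞ B} {a : A ⟶ Q}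
    {b : B ⟶ Q} {w : f ≫ biprod.desc a b = 0} (hS : (ShortComplex.mk f (biprod.desc a b) w).ShortExact)
    {i j : ℕ} (h : 1 + i = j) (x : Ext Q F j) (h₁ : (Ext.mk₀ a).comp x (zero_add j) = 0)
    (h₂ : (Ext.mk₀ b).comp x (zero_add j) = 0) : ∃ y : Ext K F i, x = hS.extClass.comp y h := by
  obtain ⟨y, hy⟩ := Ext.contravariant_sequence_exact₃ hS F x (by
    apply Ext.biprodAddEquiv.injective
    refine Prod.ext ?_ ?_
    · simp [h₁]
    · simp [h₂]) h
  exact ⟨y, hy.symm⟩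

open Abelian in
theorem exists_mayerVietoris_class (U V : Opens X) :
    ∃ c : Ext ((zSheaf X).obj (U ⊔ V)) ((zSheaf X).obj (U ⊓ V)) 1,
      ∀ (F : TopCat.Sheaf AddCommGrpCat.{u} X) (i j : ℕ) (h : 1 + i = j)
        (x : Ext ((zSheaf X).obj (U ⊔ V)) F j),
        (Ext.mk₀ ((zSheaf X).map (homOfLE (le_sup_left : U ≤ U ⊔ V)))).comp x (zero_add j) = 0 →
        (Ext.mk₀ ((zSheaf X).map (homOfLE (le_sup_right : V ≤ U ⊔ V)))).comp x (zero_add j) = 0 →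
        ∃ y : Ext ((zSheaf X).obj (U ⊓ V)) F i, x = c.comp y h := by
  exact ⟨_, fun F i j h x h₁ h₂ =>
    (CategoryTheory.ShortComplex.ShortExact.exists_comp_extClass_of_biprod
      (Opens.mayerVietorisSquare U V).shortComplex_shortExact h x h₁ h₂)⟩

open Abelian in
theorem ext_listSup (B : Opens X → Prop) (hinf : ∀ {U V}, B U → B V → B (U ⊓ V))
    (l : List (Opens X)) (hl : ∀ U ∈ l, B U) :
    (∀ F : TopCat.Sheaf AddCommGrpCat.{u} X, (∀ U, B U → IsAcyclicOn F U) →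
      ∀ (i : ℕ) (_ : l.length ≤ i) (x : Ext ((zSheaf X).obj (listSup l)) F i), x = 0) ∧
    ∀ m, l.length = m + 1 →
      ∃ c : Ext ((zSheaf X).obj (listSup l)) ((zSheaf X).obj (listInf l)) m,
        ∀ F : TopCat.Sheaf AddCommGrpCat.{u} X, (∀ U, B U → IsAcyclicOn F U) →
          ∀ x : Ext ((zSheaf X).obj (listSup l)) F m,
            ∃ f : (zSheaf X).obj (listInf l) ⟶ F, x = c.comp (Ext.mk₀ f) (add_zero m) := by
  induction h : l.length generalizing l with
  | zero =>
    obtain rfl := List.length_eq_zero_iff.1 h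
    refine ⟨fun F _ i _ x => ?_, fun m hm => absurd hm (by simp)⟩
    have h0 : 𝟙 ((zSheaf X).obj (⊥ : Opens X)) = 0 := by
      apply (zSheafHomEquiv ⊥ _).injective
      exact TopCat.Sheaf.eq_of_locally_eq' ((zSheaf X).obj ⊥) (fun i : PEmpty.{1} => i.elim) ⊥
        (fun i => i.elim) bot_le _ _ fun i => i.elim
    refine (Ext.mk₀_id_comp x).symm.trans ?_
    rw [show 𝟙 ((zSheaf X).obj (listSup [])) = 0 from h0, Ext.mk₀_zero, Ext.zero_comp]
  | succ r ih =>
    obtain ⟨U, l, rfl⟩ : ∃ U l', l = U :: l' := List.exists_cons_of_length_eq_add_one h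
    have hU : B U := hl U (by simp)
    have hl' : ∀ V ∈ l, B V := fun V hV => hl V (by simp [hV])
    have hlr : l.length = r := by simpa using h
    obtain ⟨c₀, hc₀⟩ := exists_mayerVietoris_class U (listSup l)
    have ih₁ := ih l hl' hlr
    have ih₂ := ih (l.map (U ⊓ ·)) (by
      intro V hV
      obtain ⟨W, hW, rfl⟩ := List.mem_map.1 hV
      exact hinf hU (hl' W hW)) (by simpa using hlr)
    rw [listSup_map_inf] at ih₂
    rw [show listSup (U :: l) = U ⊔ listSup l from rfl,
      show listInf (U :: l) = U ⊓ listInf l from rfl]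
    refine ⟨fun F hF i hi x => ?_, fun m hm => ?_⟩
    · obtain ⟨i, rfl⟩ : ∃ i', i = i' + 1 := ⟨i - 1, by simp at hi; omega⟩
      simp only [add_le_add_iff_right] at hi
      obtain ⟨y, rfl⟩ := hc₀ F i (i + 1) (add_comm _ _) x (hF U hU _ _)
        (ih₁.1 F hF _ (by omega) _)
      rw [ih₂.1 F hF i hi y, Ext.comp_zero]
    · obtain rfl : r = m := by simp at hm; omega
      rcases r with - | r
      · obtain rfl := List.length_eq_zero_iff.1 hlr
        refine ⟨Ext.mk₀ ((zSheaf X).map (homOfLE (by simp [listSup, listInf]))), fun F _ x => ?_⟩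
        obtain ⟨f, rfl⟩ := Ext.homEquiv₀.symm.surjective x
        refine ⟨(zSheaf X).map (homOfLE (by simp [listSup, listInf])) ≫ f, ?_⟩
        rw [Ext.mk₀_comp_mk₀, ← Category.assoc, ← Functor.map_comp,
          Subsingleton.elim (_ ≫ _) (𝟙 (U ⊔ listSup [])), CategoryTheory.Functor.map_id, Category.id_comp]
        rfl
      · obtain ⟨c₁, hc₁⟩ := ih₂.2 r rfl
        have hle : listInf (l.map (U ⊓ ·)) = U ⊓ listInf l := by
          obtain ⟨V, l, rfl⟩ := List.exists_cons_of_length_eq_add_one hlr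
          rw [← listInf_map_inf]
          exact (inf_eq_right.2 (inf_le_left.trans inf_le_left)).symm
        refine ⟨c₀.comp (c₁.comp (Ext.mk₀ ((zSheaf X).map (homOfLE hle.le))) (add_zero _))
          (add_comm _ _), fun F hF x => ?_⟩
        obtain ⟨y, rfl⟩ := hc₀ F r (r + 1) (add_comm _ _) x (hF U hU _ _)
          (ih₁.1 F hF _ (by omega) _)
        obtain ⟨f, rfl⟩ := hc₁ F hF y
        refine ⟨(zSheaf X).map (homOfLE hle.ge) ≫ f, ?_⟩
        rw [Ext.comp_assoc_of_third_deg_zero, Ext.comp_assoc_of_third_deg_zero]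
        congr 2
        rw [Ext.mk₀_comp_mk₀, ← Category.assoc, ← Functor.map_comp,
          Subsingleton.elim (_ ≫ _) (𝟙 (listInf (l.map (U ⊓ ·)))), CategoryTheory.Functor.map_id, Category.id_comp]

open Abelian in
/-- `H^{r + 1}_Z(X, F) → H^{r + 1}(X, F)` has kernel `Ext^r(ℤ_{X ∖ Z}, F)` up to a quotient. -/
theorem exists_localCohomology_class (Z : Closeds X) :
    ∃ c : Ext (zSheafClosed Z) ((zSheaf X).obj Z.compl) 1,
      (Ext.mk₀ (zSheafClosedπ Z)).comp c (zero_add 1) = 0 ∧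
      ∀ (F : TopCat.Sheaf AddCommGrpCat.{u} X) (i j : ℕ) (h : 1 + i = j)
        (x : Ext (zSheafClosed Z) F j), forgetSupports Z F j x = 0 →
        ∃ y : Ext ((zSheaf X).obj Z.compl) F i, x = c.comp y h := by
  let S := ShortComplex.mk _ _ (zSheafClosed_condition Z)
  have hS : S.ShortExact := { 
    exact := ShortComplex.exact_cokernel _
    mono_f := mono_zSheaf_map _
    epi_g := inferInstanceAs (Epi (zSheafClosedπ Z)) }
  refine ⟨hS.extClass, hS.comp_extClass, fun F i j h x hx => ?_⟩
  obtain ⟨y, hy⟩ := Ext.contravariant_sequence_exact₃ hS F x hx h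
  exact ⟨y, hy.symm⟩

open Abelian in
/-- If `X ∖ Z` is the union of `r + 1` members of a family of acyclic open subsets which is stable
under intersections, then every element of the kernel of `H^{r + 1}_Z(X, F) → H^{r + 1}(X, F)` is
the Yoneda product of a fixed class with a section of `F` over the intersection of these subsets. -/
theorem exists_reducedLocalCohomology_class (B : Opens X → Prop)
    (hinf : ∀ {U V}, B U → B V → B (U ⊓ V)) (l : List (Opens X)) (hl : ∀ U ∈ l, B U) (r : ℕ)
    (hr : l.length = r + 1) (Z : Closeds X) (hZ : Z.compl = listSup l) :
    ∃ c : Ext (zSheafClosed Z) ((zSheaf X).obj (listInf l)) (r + 1),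
      (Ext.mk₀ (zSheafClosedπ Z)).comp c (zero_add (r + 1)) = 0 ∧
      ∀ F : TopCat.Sheaf AddCommGrpCat.{u} X, (∀ U, B U → IsAcyclicOn F U) →
        ∀ x : Ext (zSheafClosed Z) F (r + 1), forgetSupports Z F (r + 1) x = 0 →
          ∃ f : (zSheaf X).obj (listInf l) ⟶ F, x = c.comp (Ext.mk₀ f) (add_zero _) := by
  have key := exists_localCohomology_class Z
  rw [hZ] at key
  obtain ⟨c, hc0, hc⟩ := key
  obtain ⟨c', hc'⟩ := (ext_listSup B hinf l hl).2 r hr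
  refine ⟨c.comp c' (add_comm _ _), ?_, fun F hF x hx => ?_⟩
  · rw [← Ext.comp_assoc (a₁₂ := 1) _ _ _ (by lia) (by lia) (by lia), hc0, Ext.zero_comp]
  obtain ⟨y, rfl⟩ := hc F r (r + 1) (add_comm _ _) x hx
  obtain ⟨f, rfl⟩ := hc' F hF y
  exact ⟨f, (Ext.comp_assoc_of_third_deg_zero _ _ _ _).symm⟩

theorem reducedLocalCohomology_zero (Z : Closeds X) (F : TopCat.Sheaf AddCommGrpCat.{u} X)
    (x : reducedLocalCohomology Z F 0) : x = 0 := by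
  refine Subtype.ext (Abelian.Ext.precomp_mk₀_injective_of_epi F (zSheafClosedπ Z) ?_)
  exact (AddMonoidHom.mem_ker.1 x.2).trans (map_zero _).symm

end AbelianSheaves

section WittMonomials
variable (p : ℕ) [Fact p.Prime] (n : ℕ) {R S : Type*} [CommRing R] [CommRing S]

theorem TruncatedWittVector.mapHom_injective {f : R →+* S} (hf : Function.Injective f) :
    Function.Injective (TruncatedWittVector.mapHom p n f) := fun _ _ h =>
  TruncatedWittVector.ext fun i =>
    hf (congrArg (fun z : TruncatedWittVector p n S => z.coeff i) h)

/-- The Teichmüller lift to Witt vectors of length `n`. -/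
def wittTeich : R →* TruncatedWittVector p n R :=
  (WittVector.truncate n).toMonoidHom.comp (WittVector.teichmuller p)

theorem wittTeich_apply (x : R) :
    wittTeich p n x = WittVector.truncate n (WittVector.teichmuller p x) := rfl

/-- The Witt vector `V^s [x]` of length `n`. -/
def wittMono (s : ℕ) (x : R) : TruncatedWittVector p n R :=
  WittVector.truncate n (WittVector.verschiebung^[s] (WittVector.teichmuller p x))

theorem WittVector.iterate_verschiebung_add (s : ℕ) (x y : WittVector p R) :
    WittVector.verschiebung^[s] (x + y) =
      WittVector.verschiebung^[s] x + WittVector.verschiebung^[s] y :=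
  iterate_map_add WittVector.verschiebung s x y

theorem wittMono_coeff (s : ℕ) (x : R) (i : Fin n) :
    (wittMono p n s x).coeff i = if (i : ℕ) = s then x else 0 := by
  rw [wittMono, WittVector.coeff_truncate]
  rcases lt_or_ge (i : ℕ) s with h | h
  · rw [WittVector.iterate_verschiebung_coeff_eq_zero _ h, if_neg h.ne]
  · obtain ⟨k, hk⟩ := Nat.exists_eq_add_of_le' h
    rw [hk, WittVector.iterate_verschiebung_coeff]
    rcases k with - | k
    · simp
    · rw [WittVector.teichmuller_coeff_pos _ _ _ k.succ_pos, if_neg (by omega)]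

theorem wittMono_zero (x : R) : wittMono p n 0 x = wittTeich p n x := rfl

theorem mapHom_wittMono (f : R →+* S) (s : ℕ) (x : R) :
    TruncatedWittVector.mapHom p n f (wittMono p n s x) = wittMono p n s (f x) :=
  TruncatedWittVector.ext fun i => by
    rw [TruncatedWittVector.coeff_mapHom, wittMono_coeff, wittMono_coeff, apply_ite f, map_zero]

theorem mapHom_wittTeich (f : R →+* S) (x : R) :
    TruncatedWittVector.mapHom p n f (wittTeich p n x) = wittTeich p n (f x) :=
  mapHom_wittMono p n f 0 x

theorem WittVector.exists_eq_teichmuller_add (y : WittVector p R) :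
    ∃ z, y = WittVector.teichmuller p (y.coeff 0) + WittVector.verschiebung z := by
  have h : ∀ i < 1, (y - WittVector.teichmuller p (y.coeff 0)).coeff i = 0 := by
    intro i hi
    obtain rfl : i = 0 := by omega
    have h := map_sub (WittVector.constantCoeff (p := p)) y (WittVector.teichmuller p (y.coeff 0))
    exact h.trans <| sub_eq_zero.2 (WittVector.teichmuller_coeff_zero p _).symm
  exact ⟨_, (sub_eq_iff_eq_add'.1 (WittVector.eq_iterate_verschiebung h))⟩

theorem WittVector.coeff_teichmuller_add_verschiebung (a : R) (z : WittVector p R) (i : ℕ) :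
    (WittVector.teichmuller p a + WittVector.verschiebung z).coeff (i + 1) = z.coeff i := by
  rw [WittVector.coeff_add_of_disjoint]
  · rw [WittVector.teichmuller_coeff_pos _ _ _ i.succ_pos, zero_add,
      WittVector.verschiebung_coeff_add_one]
  · rintro (- | i)
    · exact Or.inr (WittVector.verschiebung_coeff_zero z)
    · exact Or.inl (WittVector.teichmuller_coeff_pos _ _ _ i.succ_pos)

theorem truncate_eq_iff {x y : WittVector p R} :
    WittVector.truncate n x = WittVector.truncate n y ↔ ∀ i < n, x.coeff i = y.coeff i := by
  refine ⟨fun h i hi => ?_, fun h => TruncatedWittVector.ext fun i => ?_⟩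
  · exact congrArg (fun z : TruncatedWittVector p n R => z.coeff ⟨i, hi⟩) h
  · rw [WittVector.coeff_truncate, WittVector.coeff_truncate, h i i.2]

theorem mem_closure_wittMono {T : Set R} (hT : AddSubgroup.closure T = ⊤)
    (x : TruncatedWittVector p n R) :
    x ∈ AddSubgroup.closure {y | ∃ s < n, ∃ t ∈ T, y = wittMono p n s t} := by
  set C := AddSubgroup.closure {y | ∃ s < n, ∃ t ∈ T, y = wittMono p n s t} with hC
  have key (m : ℕ) : m ≤ n → ∀ y : WittVector p R,
      WittVector.truncate n (WittVector.verschiebung^[n - m] y) ∈ C := by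
    induction m with
    | zero =>
      intro _ y
      convert C.zero_mem
      refine TruncatedWittVector.ext fun i => ?_
      rw [WittVector.coeff_truncate, WittVector.iterate_verschiebung_coeff_eq_zero _ (by simp),
        TruncatedWittVector.coeff_zero]
    | succ m ih =>
      intro hm y
      have ih' (z : WittVector p R) : WittVector.truncate n
          (WittVector.verschiebung^[n - (m + 1)] (WittVector.verschiebung z)) ∈ C := by
        rw [← Function.iterate_succ_apply, show (n - (m + 1)).succ = n - m by omega]
        exact ih (by omega) z
      have hmono (f : R) : wittMono p n (n - (m + 1)) f ∈ C := by
        have hf : f ∈ AddSubgroup.closure T := hT ▸ AddSubgroup.mem_top f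
        have hadd (f g : R) (hf : wittMono p n (n - (m + 1)) f ∈ C) : 
            wittMono p n (n - (m + 1)) (f + g) ∈ C ↔ wittMono p n (n - (m + 1)) g ∈ C := by
          obtain ⟨z, hz⟩ := WittVector.exists_eq_teichmuller_add p
            (WittVector.teichmuller p f + WittVector.teichmuller p g)
          have h0 : (WittVector.teichmuller p f + WittVector.teichmuller p g).coeff 0 = f + g := by
            exact (map_add (WittVector.constantCoeff (p := p)) _ _).trans <| congrArg₂ _ (WittVector.teichmuller_coeff_zero p f)
              (WittVector.teichmuller_coeff_zero p g)
          rw [h0] at hz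
          have h1 := congrArg
            (fun z => WittVector.truncate n (WittVector.verschiebung^[n - (m + 1)] z)) hz
          simp only [WittVector.iterate_verschiebung_add, map_add] at h1
          change wittMono p n _ f + wittMono p n _ g = wittMono p n _ (f + g) + _ at h1
          rw [← C.add_mem_cancel_right (ih' z), ← h1, C.add_mem_cancel_left hf]
        have hzero : wittMono p n (n - (m + 1)) (0 : R) ∈ C := by
          convert C.zero_mem
          refine TruncatedWittVector.ext fun i => ?_
          rw [wittMono_coeff, ite_self, TruncatedWittVector.coeff_zero]
        induction hf using AddSubgroup.closure_induction with
        | mem f hf => exact AddSubgroup.subset_closure ⟨_, by omega, f, hf, rfl⟩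
        | zero => exact hzero
        | add f g _ _ hf hg => exact (hadd f g hf).2 hg
        | neg f _ hf => exact (hadd f (-f) hf).1 (by rwa [add_neg_cancel])
      obtain ⟨z, hz⟩ := WittVector.exists_eq_teichmuller_add p y
      rw [hz, WittVector.iterate_verschiebung_add, map_add]
      exact C.add_mem (hmono _) (ih' z)
  obtain ⟨y, rfl⟩ := WittVector.truncate_surjective p n R x
  have h := key n le_rfl y
  rwa [Nat.sub_self] at h

theorem wittMono_induction {T : Set R} (hT : AddSubgroup.closure T = ⊤)
    {C : AddSubgroup (TruncatedWittVector p n R)}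
    (hC : ∀ s < n, ∀ t ∈ T, wittMono p n s t ∈ C) : C = ⊤ := by
  rw [eq_top_iff]
  intro x _
  refine (AddSubgroup.closure_le C).2 ?_ (mem_closure_wittMono p n hT x)
  rintro _ ⟨s, hs, t, ht, rfl⟩
  exact hC s hs t ht

variable [CharP R p]

theorem WittVector.iterate_frobenius_teichmuller (i : ℕ) (a : R) :
    WittVector.frobenius^[i] (WittVector.teichmuller p a) =
      WittVector.teichmuller p (a ^ p ^ i) := by
  ext k
  rw [WittVector.iterate_frobenius_coeff]
  rcases k with - | k
  · rw [WittVector.teichmuller_coeff_zero, WittVector.teichmuller_coeff_zero]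
  · rw [WittVector.teichmuller_coeff_pos _ _ _ k.succ_pos,
      WittVector.teichmuller_coeff_pos _ _ _ k.succ_pos, zero_pow]
    exact pow_ne_zero _ (Fact.out : p.Prime).ne_zero

theorem wittTeich_mul_wittMono (s : ℕ) (a x : R) :
    wittTeich p n a * wittMono p n s x = wittMono p n s (a ^ p ^ s * x) := by
  rw [wittTeich_apply, wittMono, ← map_mul, mul_comm, WittVector.iterate_verschiebung_mul_left,
    WittVector.iterate_frobenius_teichmuller, ← map_mul, mul_comm, wittMono]

theorem WittVector.coeff_teichmuller_mul (a : R) (y : WittVector p R) (i : ℕ) :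
    (WittVector.teichmuller p a * y).coeff i = a ^ p ^ i * y.coeff i := by
  induction i generalizing a y with
  | zero =>
    rw [WittVector.mul_coeff_zero, WittVector.teichmuller_coeff_zero, pow_zero, pow_one]
  | succ i ih =>
    obtain ⟨z, hz⟩ := WittVector.exists_eq_teichmuller_add p y
    rw [hz, mul_add, ← map_mul, mul_comm _ (WittVector.verschiebung z)]
    have h1 := WittVector.iterate_verschiebung_mul_left z (WittVector.teichmuller p a) 1
    rw [WittVector.iterate_frobenius_teichmuller, mul_comm z] at h1
    simp only [Function.iterate_one] at h1
    rw [h1, WittVector.coeff_teichmuller_add_verschiebung,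
      WittVector.coeff_teichmuller_add_verschiebung, ih, pow_one, ← pow_mul, pow_succ']

theorem coeff_wittTeich_mul (a : R) (x : TruncatedWittVector p n R) (i : Fin n) :
    (wittTeich p n a * x).coeff i = a ^ p ^ (i : ℕ) * x.coeff i := by
  obtain ⟨y, rfl⟩ := WittVector.truncate_surjective p n R x
  rw [wittTeich_apply, ← map_mul, WittVector.coeff_truncate, WittVector.coeff_truncate,
    WittVector.coeff_teichmuller_mul]

theorem truncatedWitt_p_pow_eq_zero : (p : TruncatedWittVector p n R) ^ n = 0 := by
  rw [← map_natCast (WittVector.truncate (p := p) (R := R) n), ← map_pow]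
  refine TruncatedWittVector.ext fun i => ?_
  rw [WittVector.coeff_truncate, TruncatedWittVector.coeff_zero]
  exact WittVector.coeff_p_pow_eq_zero (p := p) (R := R) i.2.ne

end WittMonomials

section AffineAcyclicity
variable {X : Scheme.{u}}

/-- Restriction of functions on a scheme. -/
def schRes {U V : X.Opens} (h : V ≤ U) : Γ(X, U) →+* Γ(X, V) :=
  (X.presheaf.map (homOfLE h).op).hom

theorem schRes_schRes {U V W : X.Opens} (h : V ≤ U) (h' : W ≤ V) (s : Γ(X, U)) :
    schRes h' (schRes h s) = schRes (h'.trans h) s := by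
  change (X.presheaf.map _).hom ((X.presheaf.map _).hom s) = (X.presheaf.map _).hom s
  rw [← CommRingCat.comp_apply, ← X.presheaf.map_comp]
  rfl

theorem isUnit_schRes {U V : X.Opens} (h : V ≤ U) {f : Γ(X, U)} (hf : V ≤ X.basicOpen f) :
    IsUnit (schRes h f) := by
  have h1 : IsUnit (schRes (X.basicOpen_le f) f) := X.toRingedSpace.isUnit_res_basicOpen f
  rw [← schRes_schRes (X.basicOpen_le f) hf]
  exact h1.map (schRes hf)

theorem AlgebraicGeometry.IsAffineOpen.exists_mem_basicOpen_iff {W : X.Opens}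
    (hW : IsAffineOpen W) (P : Ideal Γ(X, W)) [hP : P.IsPrime] :
    ∃ x : X, ∀ f : Γ(X, W), x ∈ X.basicOpen f ↔ f ∉ P := by
  refine ⟨hW.fromSpec (⟨P, hP⟩ : PrimeSpectrum Γ(X, W)), fun f => ?_⟩
  have h := hW.fromSpec_preimage_basicOpen f
  have h' : ((⟨P, hP⟩ : PrimeSpectrum Γ(X, W)) : Spec Γ(X, W)) ∈
      hW.fromSpec ⁻¹ᵁ X.basicOpen f ↔ f ∉ P := by
    rw [h]
    exact PrimeSpectrum.mem_basicOpen f _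
  exact h'

/-- The family of the distinguished open subsets of `W`. -/
def IsDistinguished (W : X.Opens) (U : Opens X) : Prop := ∃ f : Γ(X, W), U = X.basicOpen f

theorem isPairwiseLocalBasis_isDistinguished {W : X.Opens} (hW : IsAffineOpen W) :
    IsPairwiseLocalBasis (X := X.toTopCat) (IsDistinguished W) where
  inf := by
    rintro _ _ ⟨f, rfl⟩ ⟨g, rfl⟩
    exact ⟨f * g, (X.basicOpen_mul f g).symm⟩
  induction := by
    rintro R h0 hle hsup _ ⟨h, rfl⟩ hloc
    let I : Ideal Γ(X, W) :=
      { carrier := {f | R (X.basicOpen f)}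
        zero_mem' := by
          change R (X.basicOpen (0 : Γ(X, W)))
          rwa [Scheme.basicOpen_zero]
        smul_mem' := fun c f hf => hle _ _ (by
          rw [smul_eq_mul, X.basicOpen_mul]
          exact inf_le_right) hf
        add_mem' := fun {f g} hf hg => by
          have e : X.basicOpen (f + g) =
              X.basicOpen (f * (f + g)) ⊔ X.basicOpen (g * (f + g)) := by
            refine le_antisymm ?_ ?_
            · rw [X.basicOpen_mul, X.basicOpen_mul, ← inf_sup_right]
              exact le_inf (X.basicOpen_add_le f g) le_rfl
            · rw [X.basicOpen_mul, X.basicOpen_mul]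
              exact sup_le inf_le_right inf_le_right
          change R (X.basicOpen (f + g))
          rw [e]
          refine hsup _ _ ⟨_, rfl⟩ ⟨_, rfl⟩ ⟨f + g, e.symm⟩ (hle _ _ ?_ hf) (hle _ _ ?_ hg)
          · rw [X.basicOpen_mul]
            exact inf_le_left
          · rw [X.basicOpen_mul]
            exact inf_le_left }
    have hI : h ∈ I.radical := by
      rw [Ideal.radical_eq_sInf, Ideal.mem_sInf]
      rintro P ⟨hIP, hP⟩
      by_contra hh
      obtain ⟨x, hx⟩ := hW.exists_mem_basicOpen_iff P
      obtain ⟨U, hxU, hU⟩ := hloc x ((hx h).2 hh)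
      obtain ⟨f, hfU, hxf⟩ := hW.exists_basicOpen_le (V := U) ⟨x, hxU⟩
        (X.basicOpen_le h ((hx h).2 hh))
      exact (hx f).1 hxf (hIP (hle _ _ hfU hU))
    obtain ⟨N, hN⟩ := hI
    rcases N with - | N
    · refine hle _ _ ?_ hN
      rw [pow_zero, Scheme.basicOpen_of_isUnit X isUnit_one]
      exact X.basicOpen_le h
    · refine hle _ _ ?_ hN
      rw [X.basicOpen_pow h N.succ_pos]

theorem exists_add_of_basicOpen_sup {W : X.Opens} (hW : IsAffineOpen W) {f g h : Γ(X, W)}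
    {U V T : X.Opens} (hU : U = X.basicOpen f) (hV : V = X.basicOpen g)
    (hT : T = X.basicOpen (f * g)) (hUV : U ⊔ V = X.basicOpen h) (hTU : T ≤ U) (hTV : T ≤ V)
    (y : Γ(X, T)) : ∃ a b, y = schRes hTU a + schRes hTV b := by
  have hUW : U ≤ W := hU ▸ X.basicOpen_le f
  have hVW : V ≤ W := hV ▸ X.basicOpen_le g
  have hTW : T ≤ W := hTU.trans hUW
  obtain ⟨N, c, hc⟩ : ∃ (N : ℕ) (c : Γ(X, W)), y * schRes hTW (f * g) ^ N = schRes hTW c := by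
    subst hT
    have := hW.isLocalization_basicOpen (f * g)
    exact IsLocalization.Away.surj (f * g) y
  obtain ⟨M, a, b, hab⟩ : ∃ (M : ℕ) (a b : Γ(X, W)), h ^ M = a * f ^ N + b * g ^ N := by
    have hh : h ∈ (Ideal.span {f ^ N, g ^ N}).radical := by
      rw [Ideal.radical_eq_sInf, Ideal.mem_sInf]
      rintro P ⟨hP', hP⟩
      by_contra hh
      obtain ⟨x, hx⟩ := hW.exists_mem_basicOpen_iff P
      have hx' := (hx h).2 hh
      rw [← hUV, hU, hV] at hx'
      rcases hx' with hx' | hx'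
      · exact (hx f).1 hx' (hP.mem_of_pow_mem N (hP' (Ideal.subset_span (by simp))))
      · exact (hx g).1 hx' (hP.mem_of_pow_mem N (hP' (Ideal.subset_span (by simp))))
    obtain ⟨M, hM⟩ := hh
    obtain ⟨a, b, hab⟩ := Ideal.mem_span_pair.1 hM
    exact ⟨M, a, b, hab.symm⟩
  have hUh : IsUnit (schRes hUW h) := isUnit_schRes hUW (hUV ▸ le_sup_left)
  have hVh : IsUnit (schRes hVW h) := isUnit_schRes hVW (hUV ▸ le_sup_right)
  have hUf : IsUnit (schRes hUW f) := isUnit_schRes hUW hU.le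
  have hVg : IsUnit (schRes hVW g) := isUnit_schRes hVW hV.le
  obtain ⟨u, hu⟩ := (hUh.pow M).mul (hUf.pow N)
  obtain ⟨v, hv⟩ := (hVh.pow M).mul (hVg.pow N)
  refine ⟨schRes hUW (b * c) * ↑u⁻¹, schRes hVW (a * c) * ↑v⁻¹, ?_⟩
  have h1 : schRes hTU ↑u⁻¹ * (schRes hTW h ^ M * schRes hTW f ^ N) = 1 := by
    have e := congrArg (schRes hTU) (u.inv_mul)
    rw [hu] at e
    simpa only [map_mul, map_pow, map_one, schRes_schRes] using e
  have h2 : schRes hTV ↑v⁻¹ * (schRes hTW h ^ M * schRes hTW g ^ N) = 1 := by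
    have e := congrArg (schRes hTV) (v.inv_mul)
    rw [hv] at e
    simpa only [map_mul, map_pow, map_one, schRes_schRes] using e
  have h3 := congrArg (schRes hTW) hab
  simp only [map_add, map_mul, map_pow] at h3 hc
  simp only [map_mul, schRes_schRes]
  set F := schRes hTW f
  set G := schRes hTW g
  set H := schRes hTW h
  set u' := schRes hTU ↑u⁻¹
  set v' := schRes hTV ↑v⁻¹
  set A := schRes hTW a
  set B := schRes hTW b
  have e1 : y = (u' * (H ^ M * F ^ N)) * (v' * (H ^ M * G ^ N)) * y := by rw [h1, h2]; ring
  have e2 : (u' * (H ^ M * F ^ N)) * (v' * (H ^ M * G ^ N)) * y =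
      u' * v' * H ^ M * (H ^ M * (y * (F * G) ^ N)) := by ring
  rw [e1, e2, hc, h3]
  have e3 : B * schRes hTW c * u' = B * schRes hTW c * u' * (v' * (H ^ M * G ^ N)) := by
    rw [h2, mul_one]
  have e4 : A * schRes hTW c * v' = A * schRes hTW c * v' * (u' * (H ^ M * F ^ N)) := by
    rw [h1, mul_one]
  rw [e3, e4, h3]
  ring

variable (p : ℕ) [Fact p.Prime] (n : ℕ)

theorem hasPairwiseSplitting_wittSheaf {W : X.Opens} (hW : IsAffineOpen W) :
    HasPairwiseSplitting (X := X.toTopCat) (IsDistinguished W) (wittSheaf p n X) := by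
  rintro U V ⟨f, hU⟩ ⟨g, hV⟩ ⟨h, hUV⟩ t
  let rU : Γ(X, U) →+* Γ(X, U ⊓ V) := schRes (X := X) inf_le_left
  let rV : Γ(X, V) →+* Γ(X, U ⊓ V) := schRes (X := X) inf_le_right
  let C : AddSubgroup (TruncatedWittVector p n Γ(X, U ⊓ V)) :=
    (TruncatedWittVector.mapHom p n rU).toAddMonoidHom.range ⊔
      (TruncatedWittVector.mapHom p n rV).toAddMonoidHom.range
  have hC : C = ⊤ := by
    refine wittMono_induction (T := Set.range rU ∪ Set.range rV) p n ?_ fun s _ x hx => ?_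
    · rw [eq_top_iff]
      intro y _
      obtain ⟨a, b, rfl⟩ := exists_add_of_basicOpen_sup hW hU hV
        (by rw [X.basicOpen_mul, hU, hV]) hUV inf_le_left inf_le_right y
      exact add_mem (AddSubgroup.subset_closure (Or.inl ⟨a, rfl⟩))
        (AddSubgroup.subset_closure (Or.inr ⟨b, rfl⟩))
    · rcases hx with ⟨a, rfl⟩ | ⟨a, rfl⟩
      · exact AddSubgroup.mem_sup_left ⟨wittMono p n s a, mapHom_wittMono p n rU s a⟩
      · exact AddSubgroup.mem_sup_right ⟨wittMono p n s a, mapHom_wittMono p n rV s a⟩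
  have ht : (t : TruncatedWittVector p n Γ(X, U ⊓ V)) ∈ C := hC ▸ AddSubgroup.mem_top _
  obtain ⟨_, ⟨a, rfl⟩, _, ⟨b, rfl⟩, hab⟩ := AddSubgroup.mem_sup.1 ht
  exact ⟨a, b, hab.symm⟩

theorem isAcyclicOn_wittSheaf {W : X.Opens} (hW : IsAffineOpen W) :
    IsAcyclicOn (wittSheaf p n X) W := fun i x =>
  ext_eq_zero_of_hasPairwiseSplitting (isPairwiseLocalBasis_isDistinguished hW) i _
    (hasPairwiseSplitting_wittSheaf p n hW)
    ⟨1, (Scheme.basicOpen_of_isUnit X isUnit_one).symm⟩ x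

end AffineAcyclicity

section Residue
variable (p : ℕ) [Fact p.Prime] (n : ℕ) (k : Type*) [Field k] {σ : Type*}

/-- The residue map `W_n(k) → k`. -/
def wittResidue [NeZero n] : TruncatedWittVector p n k →+* k where
  toFun x := x.coeff 0
  map_one' := by
    rw [← map_one (WittVector.truncate (p := p) n), WittVector.coeff_truncate]
    exact WittVector.one_coeff_zero p k
  map_zero' := TruncatedWittVector.coeff_zero p n k 0
  map_mul' x y := by
    obtain ⟨x, rfl⟩ := WittVector.truncate_surjective p n k x
    obtain ⟨y, rfl⟩ := WittVector.truncate_surjective p n k y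
    rw [← map_mul, WittVector.coeff_truncate, WittVector.coeff_truncate,
      WittVector.coeff_truncate]
    exact WittVector.mul_coeff_zero x y
  map_add' x y := by
    obtain ⟨x, rfl⟩ := WittVector.truncate_surjective p n k x
    obtain ⟨y, rfl⟩ := WittVector.truncate_surjective p n k y
    rw [← map_add, WittVector.coeff_truncate, WittVector.coeff_truncate,
      WittVector.coeff_truncate]
    exact WittVector.add_coeff_zero x y

theorem wittResidue_apply [NeZero n] (x : TruncatedWittVector p n k) :
    wittResidue p n k x = x.coeff 0 := rfl

/-- The reduction map `W_n(k)[t] → k[t]`. -/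
def polyResidue [NeZero n] (σ : Type*) :
    MvPolynomial σ (TruncatedWittVector p n k) →+* MvPolynomial σ k :=
  MvPolynomial.map (wittResidue p n k)

variable {k}

theorem wittResidue_teichmuller [NeZero n] (c : k) :
    wittResidue p n k (WittVector.truncate n (WittVector.teichmuller p c)) = c := by
  rw [wittResidue_apply, WittVector.coeff_truncate]
  exact WittVector.teichmuller_coeff_zero p c

theorem polyResidue_polyLift [NeZero n] (f : MvPolynomial σ k) :
    polyResidue p n k σ (polyLift p n f) = f := by
  rw [polyLift, map_sum]
  conv_rhs => rw [← MvPolynomial.support_sum_monomial_coeff f]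
  refine Finset.sum_congr rfl fun e _ => ?_
  rw [polyResidue, MvPolynomial.map_monomial, wittResidue_teichmuller]

variable [CharP k p] [PerfectRing k p]

theorem exists_p_pow_mul_of_coeff_eq_zero (s : ℕ) (x : TruncatedWittVector p n k)
    (h : ∀ i : Fin n, (i : ℕ) < s → x.coeff i = 0) : (p : TruncatedWittVector p n k) ^ s ∣ x := by
  rcases le_or_gt n s with hs | hs
  · obtain rfl : x = 0 := TruncatedWittVector.ext fun i =>
      (h i (i.2.trans_le hs)).trans (TruncatedWittVector.coeff_zero p n k i).symm
    exact dvd_zero _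
  obtain ⟨x, rfl⟩ := WittVector.truncate_surjective p n k x
  have hx : ∀ i < s, x.coeff i = 0 := fun i hi => by
    simpa using h ⟨i, hi.trans hs⟩ hi
  rw [WittVector.eq_iterate_verschiebung hx]
  obtain ⟨y, hy⟩ : ∃ y, WittVector.frobenius^[s] y = x.shift s :=
    ((WittVector.frobeniusEquiv p k).surjective.iterate s) _
  rw [← hy, WittVector.iterate_verschiebung_iterate_frobenius, map_mul, map_pow, map_natCast]
  exact dvd_mul_left _ _

theorem coeff_p_pow_mul (s : ℕ) (x : TruncatedWittVector p n k) (i : Fin n) :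
    ((p : TruncatedWittVector p n k) ^ s * x).coeff i =
      if h : s ≤ i then x.coeff ⟨i - s, by omega⟩ ^ p ^ s else 0 := by
  obtain ⟨x, rfl⟩ := WittVector.truncate_surjective p n k x
  rw [← map_natCast (WittVector.truncate (p := p) n), ← map_pow, ← map_mul, mul_comm,
    ← WittVector.iterate_verschiebung_iterate_frobenius, WittVector.coeff_truncate]
  split_ifs with h
  · rw [WittVector.coeff_truncate]
    have := WittVector.iterate_verschiebung_coeff (WittVector.frobenius^[s] x) s (i - s)
    rw [Nat.sub_add_cancel h] at this
    rw [this, WittVector.iterate_frobenius_coeff]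
  · exact WittVector.iterate_verschiebung_coeff_eq_zero _ (not_le.1 h)

theorem p_dvd_of_polyResidue_eq_zero [NeZero n] {F : MvPolynomial σ (TruncatedWittVector p n k)}
    (h : polyResidue p n k σ F = 0) : (p : MvPolynomial σ (TruncatedWittVector p n k)) ∣ F := by
  have h1 : (p : MvPolynomial σ (TruncatedWittVector p n k)) =
    MvPolynomial.C (p : TruncatedWittVector p n k) := (map_natCast _ _).symm
  rw [h1, MvPolynomial.C_dvd_iff_dvd_coeff]
  intro e
  have h2 := exists_p_pow_mul_of_coeff_eq_zero p n 1 (F.coeff e) fun i hi => by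
    obtain rfl : i = 0 := by
      apply Fin.ext
      rw [Fin.val_zero]
      omega
    have := congrArg (MvPolynomial.coeff e) h
    rwa [polyResidue, MvPolynomial.coeff_map, MvPolynomial.coeff_zero, wittResidue_apply] at this
  rwa [pow_one] at h2

theorem mvPoly_p_pow_eq_zero :
    (p : MvPolynomial σ (TruncatedWittVector p n k)) ^ n = 0 := by
  rw [← map_natCast MvPolynomial.C, ← map_pow, truncatedWitt_p_pow_eq_zero, map_zero]

theorem wittGhost_truncate_map [NeZero n] (X : WittVector p (MvPolynomial σ (TruncatedWittVector p n k))) :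
    wittGhost p n (WittVector.truncate n (WittVector.map (polyResidue p n k σ) X)) =
      WittVector.ghostComponent (n - 1) X := by
  have hn : n - 1 + 1 = n := Nat.sub_add_cancel (NeZero.one_le)
  rw [WittVector.ghostComponent_apply, aeval_wittPolynomial, hn, Finset.sum_range, wittGhost]
  refine Finset.sum_congr rfl fun i _ => sub_eq_zero.1 ?_
  rw [← mul_sub]
  have h1 : (p : MvPolynomial σ (TruncatedWittVector p n k)) ∣ polyLift p n
      ((WittVector.truncate n (WittVector.map (polyResidue p n k σ) X)).coeff i) - X.coeff i := by
    apply p_dvd_of_polyResidue_eq_zero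
    rw [map_sub, polyResidue_polyLift, WittVector.coeff_truncate, WittVector.map_coeff, sub_self]
  obtain ⟨c, hc⟩ := dvd_sub_pow_of_dvd_sub h1 (n - 1 - i)
  rw [hc, ← mul_assoc, ← pow_add, show (i : ℕ) + (n - 1 - i + 1) = n by omega,
    mvPoly_p_pow_eq_zero, zero_mul]

theorem exists_truncate_map_polyResidue [NeZero n] (x : TruncatedWittVector p n (MvPolynomial σ k)) :
    ∃ X, WittVector.truncate n (WittVector.map (polyResidue p n k σ) X) = x := by
  obtain ⟨y, rfl⟩ := WittVector.truncate_surjective p n _ x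
  obtain ⟨X, rfl⟩ := WittVector.map_surjective (p := p) (polyResidue p n k σ)
    (fun f => ⟨_, polyResidue_polyLift p n f⟩) y
  exact ⟨X, rfl⟩

/-- `wittGhost` as a ring homomorphism. -/
def wittGhostHom [NeZero n] : TruncatedWittVector p n (MvPolynomial σ k) →+*
    MvPolynomial σ (TruncatedWittVector p n k) where
  toFun := wittGhost p n
  map_one' := by
    have := wittGhost_truncate_map p n (k := k) (σ := σ) 1
    rwa [map_one, map_one, map_one] at this
  map_zero' := by
    have := wittGhost_truncate_map p n (k := k) (σ := σ) 0
    rwa [map_zero, map_zero, map_zero] at this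
  map_mul' x y := by
    obtain ⟨X, rfl⟩ := exists_truncate_map_polyResidue p n x
    obtain ⟨Y, rfl⟩ := exists_truncate_map_polyResidue p n y
    rw [← map_mul, ← map_mul, wittGhost_truncate_map, wittGhost_truncate_map,
      wittGhost_truncate_map, map_mul]
  map_add' x y := by
    obtain ⟨X, rfl⟩ := exists_truncate_map_polyResidue p n x
    obtain ⟨Y, rfl⟩ := exists_truncate_map_polyResidue p n y
    rw [← map_add, ← map_add, wittGhost_truncate_map, wittGhost_truncate_map,
      wittGhost_truncate_map, map_add]

theorem wittGhostHom_apply [NeZero n] (x : TruncatedWittVector p n (MvPolynomial σ k)) :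
    wittGhostHom p n x = wittGhost p n x := rfl

theorem wittGhost_injective [NeZero n] :
    Function.Injective (wittGhost p n (k := k) (σ := σ)) := by
  refine (injective_iff_map_eq_zero (wittGhostHom p n (k := k) (σ := σ))).2 fun x hx => ?_
  have key (s : ℕ) : ∀ hs : s < n, x.coeff ⟨s, hs⟩ = 0 := by
    induction s using Nat.strong_induction_on with
    | _ s ih =>
      intro hs
      set R := MvPolynomial σ (TruncatedWittVector p n k)
      have h1 : (p : R) ^ (s + 1) ∣ (p : R) ^ s *
          polyLift p n (x.coeff ⟨s, hs⟩) ^ p ^ (n - 1 - s) := by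
        have h2 : wittGhost p n x = _ :=
          (Finset.sum_erase_add (a := ⟨s, hs⟩) _ _ (Finset.mem_univ _)).symm
        rw [show wittGhost p n x = 0 from hx] at h2
        rw [eq_neg_of_add_eq_zero_right h2.symm, dvd_neg]
        refine Finset.dvd_sum fun i hi => ?_
        rcases lt_trichotomy (i : ℕ) s with h | h | h
        · have := ih i h i.2
          rw [show x.coeff i = 0 from this]
          have h3 : polyLift p n (0 : MvPolynomial σ k) = 0 := by simp [polyLift]
          rw [h3, zero_pow (pow_ne_zero _ (Fact.out : p.Prime).ne_zero), mul_zero]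
          exact dvd_zero _
        · exact absurd (Fin.ext h) (Finset.ne_of_mem_erase hi)
        · exact (pow_dvd_pow _ h).mul_right _
      set F := polyLift p n (x.coeff ⟨s, hs⟩) ^ p ^ (n - 1 - s)
      have h4 : polyResidue p n k σ F = 0 := by
        ext e
        rw [polyResidue, MvPolynomial.coeff_map, MvPolynomial.coeff_zero, wittResidue_apply]
        have h5 : MvPolynomial.C ((p : TruncatedWittVector p n k) ^ (s + 1)) ∣
            MvPolynomial.C ((p : TruncatedWittVector p n k) ^ s) * F := by
          simpa using h1
        obtain ⟨c, hc⟩ := (MvPolynomial.C_dvd_iff_dvd_coeff _ _).1 h5 e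
        rw [MvPolynomial.coeff_C_mul] at hc
        have hc' := congrArg (TruncatedWittVector.coeff ⟨s, hs⟩) hc
        rw [coeff_p_pow_mul, coeff_p_pow_mul, dif_pos le_rfl,
          dif_neg (by simp)] at hc'
        have := eq_zero_of_pow_eq_zero hc'
        have e0 : (⟨s - s, by omega⟩ : Fin n) = 0 := Fin.ext (by simp)
        rwa [e0] at this
      rw [map_pow, polyResidue_polyLift] at h4
      exact eq_zero_of_pow_eq_zero h4
  exact TruncatedWittVector.ext fun i =>
    (key i i.2).trans (TruncatedWittVector.coeff_zero p n _ i).symm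

theorem polyLift_monomial (e : σ →₀ ℕ) (c : k) :
    polyLift p n (MvPolynomial.monomial e c) = MvPolynomial.monomial e
      (WittVector.truncate n (WittVector.teichmuller p c)) := by
  classical
  rw [polyLift]
  rcases eq_or_ne c 0 with rfl | hc
  · simp
  · rw [MvPolynomial.support_monomial, if_neg hc, Finset.sum_singleton,
      MvPolynomial.coeff_monomial, if_pos rfl]

theorem wittGhost_wittMono [NeZero n] {s : ℕ} (hs : s < n) (e : σ →₀ ℕ) (c : k) :
    wittGhost p n (wittMono p n s (MvPolynomial.monomial e c)) =
      MvPolynomial.monomial (p ^ (n - 1 - s) • e)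
        ((p : TruncatedWittVector p n k) ^ s * wittTeich p n c ^ p ^ (n - 1 - s)) := by
  rw [wittGhost, Finset.sum_eq_single ⟨s, hs⟩]
  · rw [wittMono_coeff, if_pos rfl, polyLift_monomial, MvPolynomial.monomial_pow,
      ← map_natCast MvPolynomial.C, ← map_pow, MvPolynomial.C_mul_monomial]
    rfl
  · intro i _ hi
    rw [wittMono_coeff, if_neg fun h => hi (Fin.ext h)]
    have h3 : polyLift p n (0 : MvPolynomial σ k) = 0 := by simp [polyLift]
    rw [h3, zero_pow (pow_ne_zero _ (Fact.out : p.Prime).ne_zero), mul_zero]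
  · exact fun h => absurd (Finset.mem_univ _) h

theorem wittMono_monomial_induction {C : AddSubgroup (TruncatedWittVector p n (MvPolynomial σ k))}
    (hC : ∀ s < n, ∀ (e : σ →₀ ℕ) (c : k), wittMono p n s (MvPolynomial.monomial e c) ∈ C) :
    C = ⊤ := by
  refine wittMono_induction (T := {f | ∃ (e : σ →₀ ℕ) (c : k), f = MvPolynomial.monomial e c})
    p n ?_ ?_
  · rw [eq_top_iff]
    intro f _
    rw [← MvPolynomial.support_sum_monomial_coeff f]
    exact sum_mem fun e _ => AddSubgroup.subset_closure ⟨e, _, rfl⟩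
  · rintro s hs _ ⟨e, c, rfl⟩
    exact hC s hs e c

end Residue

section FrobeniusVerschiebung
variable (p : ℕ) [Fact p.Prime] (n : ℕ) {R : Type*} [CommRing R] [CharP R p]

omit [CharP R p] in
variable {p} in
theorem iterate_verschiebung_nsmul (s c : ℕ) (y : WittVector p R) :
    WittVector.verschiebung^[s] (c • y) = c • WittVector.verschiebung^[s] y := by
  induction s with
  | zero => rfl
  | succ s ih => rw [Function.iterate_succ_apply', Function.iterate_succ_apply', ih, map_nsmul]

theorem wittMono_add_pow (s b : ℕ) (x : R) :
    wittMono p n (s + b) (x ^ p ^ b) = (p : TruncatedWittVector p n R) ^ b * wittMono p n s x := by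
  rw [wittMono, wittMono, Function.iterate_add_apply, ← WittVector.iterate_frobenius_teichmuller,
    WittVector.iterate_verschiebung_iterate_frobenius, ← map_natCast (WittVector.truncate n),
    ← map_pow, ← map_mul, mul_comm]
  congr 1
  have := iterate_verschiebung_nsmul s (p ^ b) (WittVector.teichmuller p x)
  rwa [nsmul_eq_mul, nsmul_eq_mul, Nat.cast_pow] at this

end FrobeniusVerschiebung

section HasseDeriv
variable {σ S : Type*} [CommRing S]

theorem MvPolynomial.monomial_congr {e e' : σ →₀ ℕ} {c c' : S} (h : e = e') (h' : c = c') :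
    MvPolynomial.monomial e c = MvPolynomial.monomial e' c' := by
  rw [h, h']

theorem mvHasseDeriv_monomial (i : σ) (r : ℕ) (e : σ →₀ ℕ) (c : S) :
    mvHasseDeriv i r (MvPolynomial.monomial e c) =
      MvPolynomial.monomial (e - Finsupp.single i r) (c * ((e i).choose r : S)) := by
  have h : MvPolynomial.monomial e c = c • MvPolynomial.basisMonomials σ S e := by
    rw [MvPolynomial.coe_basisMonomials, MvPolynomial.smul_monomial, smul_eq_mul, mul_one]
  rw [h, map_smul, mvHasseDeriv, Module.Basis.constr_basis, MvPolynomial.smul_monomial, smul_eq_mul]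

theorem mvHasseDeriv_zero (i : σ) (f : MvPolynomial σ S) : mvHasseDeriv i 0 f = f := by
  induction f using MvPolynomial.induction_on' with
  | monomial e c => rw [mvHasseDeriv_monomial]; simp
  | add f g hf hg => rw [map_add, hf, hg]

theorem mvHasseDeriv_mul (i : σ) (r : ℕ) (f g : MvPolynomial σ S) :
    mvHasseDeriv i r (f * g) = ∑ a ∈ Finset.HasAntidiagonal.antidiagonal r,
      mvHasseDeriv i a.1 f * mvHasseDeriv i a.2 g := by
  induction f using MvPolynomial.induction_on' with
  | add f f' hf hf' =>
    rw [add_mul, map_add, hf, hf', ← Finset.sum_add_distrib]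
    exact Finset.sum_congr rfl fun _ _ => by rw [map_add, add_mul]
  | monomial e c =>
    induction g using MvPolynomial.induction_on' with
    | add f f' hf hf' =>
      rw [mul_add, map_add, hf, hf', ← Finset.sum_add_distrib]
      exact Finset.sum_congr rfl fun _ _ => by rw [map_add, mul_add]
    | monomial e' c' =>
      rw [MvPolynomial.monomial_mul, mvHasseDeriv_monomial, Finsupp.add_apply, Nat.add_choose_eq,
        Nat.cast_sum, Finset.mul_sum, map_sum]
      refine Finset.sum_congr rfl fun a ha => ?_
      have ha := Finset.HasAntidiagonal.mem_antidiagonal.1 ha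
      rw [mvHasseDeriv_monomial, mvHasseDeriv_monomial, MvPolynomial.monomial_mul]
      rcases lt_or_ge (e i) a.1 with h | h
      · simp [Nat.choose_eq_zero_of_lt h]
      rcases lt_or_ge (e' i) a.2 with h' | h'
      · simp [Nat.choose_eq_zero_of_lt h']
      refine MvPolynomial.monomial_congr (Finsupp.ext fun l => ?_) ?_
      · by_cases hl : i = l
        · subst hl
          simp
          omega
        · simp [Finsupp.single_eq_of_ne' hl]
      · push_cast
        ring

theorem isDiffOpOfOrder_mulOp {B : Type*} [CommRing B] (a : B) : IsDiffOpOfOrder 0 (mulOp a) :=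
  fun b => AddMonoidHom.ext fun x => mul_left_comm a b x

theorem isDiffOpOfOrder_sum {B ι : Type*} [CommRing B] {m : ℕ} (T : Finset ι)
    (P : ι → AddMonoid.End B) (h : ∀ i ∈ T, IsDiffOpOfOrder m (P i)) :
    IsDiffOpOfOrder m (∑ i ∈ T, P i) := by
  classical
  induction T using Finset.induction_on with
  | empty => exact .zero m
  | insert i T hi ih =>
    rw [Finset.sum_insert hi]
    exact (h i (Finset.mem_insert_self i T)).add
      (ih fun l hl => h l (Finset.mem_insert_of_mem hl))

theorem addMonoidEnd_sum_apply {B ι : Type*} [AddCommGroup B] (T : Finset ι)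
    (P : ι → AddMonoid.End B) (x : B) : (∑ i ∈ T, P i) x = ∑ i ∈ T, P i x :=
  map_sum (AddMonoidHom.eval x : (B →+ B) →+ B) P T

variable (S) in
/-- The divided power derivation as an additive endomorphism. -/
def mvHasseEnd (i : σ) (r : ℕ) : AddMonoid.End (MvPolynomial σ S) :=
  (mvHasseDeriv i r).toAddMonoidHom

theorem isDiffOpOfOrder_mvHasseEnd (i : σ) (r : ℕ) :
    IsDiffOpOfOrder r (mvHasseEnd S i r) := by
  induction r using Nat.strong_induction_on with
  | _ r ih =>
    cases r with
    | zero =>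
      intro f
      refine AddMonoidHom.ext fun g => ?_
      change mvHasseDeriv i 0 (f * g) = f * mvHasseDeriv i 0 g
      rw [mvHasseDeriv_zero, mvHasseDeriv_zero]
    | succ r =>
      intro f
      have e : mvHasseEnd S i (r + 1) * mulOp f - mulOp f * mvHasseEnd S i (r + 1) =
          ∑ a ∈ Finset.HasAntidiagonal.antidiagonal r, mulOp (mvHasseDeriv i (a.1 + 1) f) *
            mvHasseEnd S i a.2 := by
        refine AddMonoidHom.ext fun g => ?_
        refine Eq.trans ?_ (addMonoidEnd_sum_apply _ _ g).symm
        change mvHasseDeriv i (r + 1) (f * g) - f * mvHasseDeriv i (r + 1) g =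
          ∑ a ∈ Finset.HasAntidiagonal.antidiagonal r, mvHasseDeriv i (a.1 + 1) f * mvHasseDeriv i a.2 g
        rw [mvHasseDeriv_mul, Finset.Nat.sum_antidiagonal_succ, mvHasseDeriv_zero, add_sub_cancel_left]
      rw [e]
      refine isDiffOpOfOrder_sum _ _ fun a ha => ?_
      have ha := Finset.HasAntidiagonal.mem_antidiagonal.1 ha
      exact (((isDiffOpOfOrder_mulOp _).mul (ih a.2 (by omega))).mono (by omega))

/-- Differential operators restrict along injective ring homomorphisms. -/
theorem IsDiffOpOfOrder.restrict {B C : Type*} [CommRing B] [CommRing C] {φ : B →+* C}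
    (hφ : Function.Injective φ) {m : ℕ} {P : AddMonoid.End B} {Q : AddMonoid.End C}
    (h : ∀ x, φ (P x) = Q (φ x)) (hQ : IsDiffOpOfOrder m Q) : IsDiffOpOfOrder m P := by
  induction m generalizing P Q with
  | zero =>
    intro b
    refine AddMonoidHom.ext fun x => hφ ?_
    change φ (P (b * x)) = φ (b * P x)
    rw [h, map_mul φ, map_mul φ, h]
    exact DFunLike.congr_fun (hQ (φ b)) (φ x)
  | succ m ih =>
    intro b
    refine ih (fun x => ?_) (hQ (φ b))
    change φ (P (b * x) - b * P x) = Q (φ b * φ x) - φ b * Q (φ x)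
    rw [map_sub, map_mul φ, h, h, map_mul φ]

end HasseDeriv

section WittHasse
variable (p : ℕ) [Fact p.Prime] (n : ℕ) {k : Type*} [Field k] [CharP k p] {σ : Type*}

theorem truncate_verschiebung_mul_eq_zero {R : Type*} [CommRing R] (m : ℕ) (a z : WittVector p R)
    (h : WittVector.truncate n (WittVector.verschiebung^[m] z) = 0) :
    WittVector.truncate n (WittVector.verschiebung^[m] (a * z)) = 0 := by
  rw [← map_zero (WittVector.truncate (p := p) n), truncate_eq_iff] at h
  have h1 : ∀ i < n - m, z.coeff i = 0 := fun i hi => by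
    have := h (i + m) (by omega)
    rwa [WittVector.iterate_verschiebung_coeff, WittVector.zero_coeff] at this
  rw [WittVector.eq_iterate_verschiebung h1, mul_comm, WittVector.iterate_verschiebung_mul_left,
    ← Function.iterate_add_apply]
  rw [← map_zero (WittVector.truncate (p := p) n), truncate_eq_iff]
  intro i hi
  rw [WittVector.iterate_verschiebung_coeff_eq_zero _ (by omega), WittVector.zero_coeff]

theorem pow_dvd_choose_mul {v a N r r' : ℕ} (hr : r = p ^ v * r') (hp : ¬ p ∣ r') (hv : v ≤ a) :
    p ^ (a - v) ∣ (p ^ a * N).choose r := by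
  have hpp : p.Prime := Fact.out
  have hr0 : r ≠ 0 := by
    rintro rfl
    rcases Nat.mul_eq_zero.1 hr.symm with h | h
    · exact pow_ne_zero _ hpp.ne_zero h
    · exact hp (h ▸ dvd_zero p)
  obtain ⟨t, rfl⟩ := Nat.exists_eq_succ_of_ne_zero hr0
  rcases Nat.eq_zero_or_pos (p ^ a * N) with h0 | h0
  · rw [h0, Nat.choose_zero_succ]
    exact dvd_zero _
  obtain ⟨M, hM⟩ := Nat.exists_eq_succ_of_ne_zero h0.ne'
  have h1 := Nat.add_one_mul_choose_eq M t
  rw [hM]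
  have h2 : p ^ v * p ^ (a - v) ∣ p ^ v * (((M + 1).choose (t + 1)) * r') := by
    rw [← pow_add, Nat.add_sub_cancel' hv]
    have : p ^ v * (((M + 1).choose (t + 1)) * r') = (M + 1).choose (t + 1) * (t + 1) := by
      rw [show t + 1 = p ^ v * r' from hr]
      ring
    rw [this, ← h1, show M + 1 = p ^ a * N from hM.symm]
    exact (dvd_mul_right _ _).mul_right _
  have h3 := Nat.dvd_of_mul_dvd_mul_left (pow_pos hpp.pos v) h2
  exact Nat.Coprime.dvd_of_dvd_mul_right
    (Nat.Coprime.pow_left _ ((Nat.Prime.coprime_iff_not_dvd hpp).2 hp)) h3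

theorem X_pow_mul_monomial_sub {S : Type*} [CommRing S] (i : σ) {r : ℕ} {e : σ →₀ ℕ} (h : r ≤ e i)
    (c : S) : MvPolynomial.X i ^ r * MvPolynomial.monomial (e - Finsupp.single i r) c =
      MvPolynomial.monomial e c := by
  rw [MvPolynomial.X_pow_eq_monomial, MvPolynomial.monomial_mul, one_mul,
    add_tsub_cancel_of_le (Finsupp.single_le_iff.2 h)]

variable [PerfectRing k p]

theorem exists_mvHasseDeriv_wittGhost_wittMono [NeZero n] (i : σ) {r : ℕ} (hr : r ≠ 0) {s : ℕ}
    (hs : s < n) (e : σ →₀ ℕ) (c : k) : ∃ y : WittVector p (MvPolynomial σ k),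
      wittGhost p n (WittVector.truncate n
        (WittVector.verschiebung^[n - 1 - padicValNat p r] y)) =
          mvHasseDeriv i r (wittGhost p n (wittMono p n s (MvPolynomial.monomial e c))) ∧
      WittVector.truncate n (WittVector.verschiebung^[n - 1 - padicValNat p r]
        (WittVector.teichmuller p (MvPolynomial.X i ^ (r / p ^ min (padicValNat p r) (n - 1))) * y)) =
          ((p ^ (n - 1 - s) * e i).choose r) • wittMono p n s (MvPolynomial.monomial e c) := by
  have hpp : p.Prime := Fact.out
  obtain ⟨r', hr', hpr'⟩ : ∃ r', r = p ^ padicValNat p r * r' ∧ ¬ p ∣ r' := by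
    obtain ⟨r', h⟩ := (pow_padicValNat_dvd : p ^ padicValNat p r ∣ r)
    refine ⟨r', h, ?_⟩
    rintro ⟨t, rfl⟩
    refine pow_succ_padicValNat_not_dvd hr (p := p) ⟨t, ?_⟩
    rw [pow_succ, mul_assoc]
    exact h
  set v := padicValNat p r
  set a := n - 1 - s with ha
  set A := MvPolynomial σ k
  rw [wittGhost_wittMono p n hs, mvHasseDeriv_monomial, ← ha]
  simp only [Finsupp.smul_apply, smul_eq_mul]
  rcases lt_or_ge (p ^ a * e i) r with hlt | hge
  · refine ⟨0, ?_, ?_⟩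
    · rw [Nat.choose_eq_zero_of_lt hlt, Nat.cast_zero, mul_zero, map_zero]
      have h0 : WittVector.verschiebung^[n - 1 - v] (0 : WittVector p A) = 0 :=
        iterate_map_zero _ _
      rw [h0, map_zero]
      exact map_zero (wittGhostHom p n)
    · rw [Nat.choose_eq_zero_of_lt hlt, zero_smul, mul_zero]
      have h0 : WittVector.verschiebung^[n - 1 - v] (0 : WittVector p A) = 0 :=
        iterate_map_zero _ _
      rw [h0, map_zero]
  rcases le_or_gt a (min v (n - 1)) with haw | haw
  · have hdvd : p ^ a ∣ r := by
      rw [hr']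
      exact (pow_dvd_pow p (haw.trans (min_le_left _ _))).mul_right _
    obtain ⟨ρ, hρ⟩ := hdvd
    have hρe : ρ ≤ e i := Nat.le_of_mul_le_mul_left (hρ ▸ hge) (pow_pos hpp.pos a)
    have hsm : n - 1 - v + (s - (n - 1 - v)) = s := by omega
    set C := (p ^ a * e i).choose r
    refine ⟨C • WittVector.verschiebung^[s - (n - 1 - v)] (WittVector.teichmuller p
      (MvPolynomial.monomial (e - Finsupp.single i ρ) c)), ?_, ?_⟩
    · rw [iterate_verschiebung_nsmul, ← Function.iterate_add_apply, hsm, map_nsmul,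
        ← wittMono, ← wittGhostHom_apply, map_nsmul, wittGhostHom_apply, wittGhost_wittMono p n hs,
        ← ha, ← map_nsmul]
      refine MvPolynomial.monomial_congr (Finsupp.ext fun l => ?_) ?_
      · by_cases hl : i = l
        · subst hl
          simp [Nat.mul_sub, hρ]
        · simp [Finsupp.single_eq_of_ne' hl]
      · rw [nsmul_eq_mul, mul_comm]
    · rw [mul_smul_comm, iterate_verschiebung_nsmul, map_nsmul, mul_comm,
        WittVector.iterate_verschiebung_mul_left, WittVector.iterate_frobenius_teichmuller,
        ← map_mul, ← Function.iterate_add_apply, hsm, ← wittMono, mul_comm, ← pow_mul]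
      have h1 : r / p ^ min v (n - 1) * p ^ (s - (n - 1 - v)) = ρ := by
        have h2 : s - (n - 1 - v) = min v (n - 1) - a := by omega
        have h3 : p ^ min v (n - 1) ∣ r := by
          rw [hr']
          exact (pow_dvd_pow p (min_le_left _ _)).mul_right _
        refine Nat.eq_of_mul_eq_mul_left (pow_pos hpp.pos a) ?_
        rw [← hρ, h2, mul_left_comm, ← pow_add, Nat.add_sub_cancel' haw, Nat.div_mul_cancel h3]
      rw [h1, X_pow_mul_monomial_sub i hρe]
  · have hwv : min v (n - 1) = v := by omega
    rw [hwv] at haw ⊢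
    obtain ⟨C', hC'⟩ := pow_dvd_choose_mul p (N := e i) hr' hpr' haw.le
    have hm : n - 1 - v = s + (a - v) := by omega
    have hle : r' ≤ p ^ (a - v) * e i := by
      refine Nat.le_of_mul_le_mul_left ?_ (pow_pos hpp.pos v)
      rw [← hr', ← mul_assoc, ← pow_add, Nat.add_sub_cancel' haw.le]
      exact hge
    have hrv : r / p ^ v = r' := by
      conv_lhs => rw [hr']
      exact Nat.mul_div_cancel_left _ (pow_pos hpp.pos v)
    refine ⟨C' • WittVector.teichmuller p (MvPolynomial.monomial
      (p ^ (a - v) • e - Finsupp.single i r') (c ^ p ^ (a - v))), ?_, ?_⟩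
    · rw [iterate_verschiebung_nsmul, map_nsmul,
        ← wittMono, ← wittGhostHom_apply, map_nsmul, wittGhostHom_apply,
        wittGhost_wittMono p n (by omega), show n - 1 - (n - 1 - v) = v by omega, ← map_nsmul]
      refine MvPolynomial.monomial_congr (Finsupp.ext fun l => ?_) ?_
      · by_cases hl : i = l
        · subst hl
          simp only [Finsupp.smul_apply, Finsupp.tsub_apply, Finsupp.single_eq_same, smul_eq_mul,
            Nat.mul_sub, ← hr']
          rw [← mul_assoc, ← pow_add, Nat.add_sub_cancel' haw.le]
        · simp only [Finsupp.smul_apply, Finsupp.tsub_apply, Finsupp.single_eq_of_ne' hl,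
            smul_eq_mul, Nat.sub_zero]
          rw [← mul_assoc, ← pow_add, Nat.add_sub_cancel' haw.le]
      · rw [hC', hm, map_pow, ← pow_mul, ← pow_add, Nat.sub_add_cancel haw.le, nsmul_eq_mul]
        push_cast
        ring
    · rw [hrv, mul_smul_comm, iterate_verschiebung_nsmul, map_nsmul, ← map_mul,
        X_pow_mul_monomial_sub i (by simpa using hle), ← wittMono, hm, ← MvPolynomial.monomial_pow,
        wittMono_add_pow, hC', nsmul_eq_mul, nsmul_eq_mul]
      push_cast
      ring

theorem exists_mvHasseDeriv_wittGhost [NeZero n] (i : σ) {r : ℕ} (hr : r ≠ 0)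
    (x : TruncatedWittVector p n (MvPolynomial σ k)) : ∃ y : WittVector p (MvPolynomial σ k),
      wittGhost p n (WittVector.truncate n
        (WittVector.verschiebung^[n - 1 - padicValNat p r] y)) =
          mvHasseDeriv i r (wittGhost p n x) := by
  let C : AddSubgroup (TruncatedWittVector p n (MvPolynomial σ k)) :=
    AddSubgroup.comap
      ((mvHasseDeriv i r).toAddMonoidHom.comp (wittGhostHom p n).toAddMonoidHom)
      (AddMonoidHom.range ((wittGhostHom p n).toAddMonoidHom.comp
        ((WittVector.truncate n).toAddMonoidHom.comp
          (AddMonoidHom.mk' _ (WittVector.iterate_verschiebung_add p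
            (R := MvPolynomial σ k) (n - 1 - padicValNat p r))))))
  have hC : C = ⊤ := wittMono_monomial_induction p n fun s hs e c => by
    obtain ⟨y, hy, -⟩ := exists_mvHasseDeriv_wittGhost_wittMono p n i hr hs e c
    exact ⟨y, hy⟩
  obtain ⟨y, hy⟩ : x ∈ C := hC ▸ AddSubgroup.mem_top _
  exact ⟨y, hy⟩

theorem exists_isTwistedWittHasseDeriv [NeZero n] (a : WittVector p (MvPolynomial σ k)) (i : σ)
    {r : ℕ} (hr : r ≠ 0) : ∃ P, IsTwistedWittHasseDeriv p n a i r P ∧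
      ∀ x y, wittGhost p n (WittVector.truncate n
        (WittVector.verschiebung^[n - 1 - padicValNat p r] y)) =
          mvHasseDeriv i r (wittGhost p n x) →
        P x = WittVector.truncate n
          (WittVector.verschiebung^[n - 1 - padicValNat p r] (a * y)) := by
  choose y hy using exists_mvHasseDeriv_wittGhost p n (k := k) i hr
  set m := n - 1 - padicValNat p r
  have hadd (y y' : WittVector p (MvPolynomial σ k)) := WittVector.iterate_verschiebung_add p m y y'
  have key (x) (z z' : WittVector p (MvPolynomial σ k))
      (h : WittVector.truncate n (WittVector.verschiebung^[m] z) =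
        WittVector.truncate n (WittVector.verschiebung^[m] z')) :
      WittVector.truncate n (WittVector.verschiebung^[m] (x * z)) =
        WittVector.truncate n (WittVector.verschiebung^[m] (x * z')) := by
    have hz : z = (z - z') + z' := by ring
    rw [hz, hadd, map_add, add_eq_right] at h
    have := truncate_verschiebung_mul_eq_zero p n m x _ h
    rw [hz, mul_add, hadd, map_add, this, zero_add]
  have hyadd (x x') : WittVector.truncate n (WittVector.verschiebung^[m] (y (x + x'))) =
      WittVector.truncate n (WittVector.verschiebung^[m] (y x + y x')) := by
    apply wittGhost_injective p n
    rw [hy, hadd, map_add, ← wittGhostHom_apply, ← wittGhostHom_apply, map_add, map_add, map_add,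
      wittGhostHom_apply, wittGhostHom_apply, ← hy, ← hy]
    rfl
  refine ⟨AddMonoidHom.mk' (fun x => WittVector.truncate n (WittVector.verschiebung^[m]
    (a * y x))) fun x x' => ?_, ⟨AddMonoidHom.mk' (fun x => WittVector.truncate n
      (WittVector.verschiebung^[m] (y x))) fun x x' => ?_, fun x => hy x, fun x => ⟨y x, ?_, ?_⟩⟩,
      fun x z hz => key _ _ _ (wittGhost_injective p n ((hy x).trans hz.symm))⟩
  · rw [← map_add, ← hadd, ← mul_add]
    exact key _ _ _ (hyadd x x')
  · rw [← map_add, ← hadd]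
    exact hyadd x x'
  · rw [if_neg hr]
    rfl
  · rw [if_neg hr]
    rfl

variable (k σ) in
/-- The Witt differential operators which are Grothendieck differential operators. -/
def wittGroDiffOps : Subring (AddMonoid.End (TruncatedWittVector p n (MvPolynomial σ k))) :=
  wittDiffOps p n k σ ⊓ groDiffOps _

theorem mem_groDiffOps_of_wittGhost [NeZero n]
    {P : AddMonoid.End (TruncatedWittVector p n (MvPolynomial σ k))}
    {Q : AddMonoid.End (MvPolynomial σ (TruncatedWittVector p n k))} {m : ℕ}
    (hQ : IsDiffOpOfOrder m Q)
    (h : ∀ s < n, ∀ (e : σ →₀ ℕ) (c : k),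
      wittGhost p n (P (wittMono p n s (MvPolynomial.monomial e c))) =
        Q (wittGhost p n (wittMono p n s (MvPolynomial.monomial e c)))) : P ∈ groDiffOps _ := by
  refine ⟨m, hQ.restrict (φ := wittGhostHom p n) (wittGhost_injective p n) fun x => ?_⟩
  let C : AddSubgroup (TruncatedWittVector p n (MvPolynomial σ k)) :=
    AddMonoidHom.eqLocus (((wittGhostHom p n).toAddMonoidHom).comp P)
      (AddMonoidHom.comp Q (wittGhostHom p n).toAddMonoidHom)
  have hC : C = ⊤ := wittMono_monomial_induction p n h
  exact (hC ▸ AddSubgroup.mem_top x : x ∈ C)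

theorem exists_diagonal_choose [NeZero n] (i : σ) (r : ℕ) : ∃ P ∈ wittGroDiffOps p n k σ,
    ∀ s < n, ∀ (e : σ →₀ ℕ) (c : k), P (wittMono p n s (MvPolynomial.monomial e c)) =
      ((p ^ (n - 1 - s) * e i).choose r) • wittMono p n s (MvPolynomial.monomial e c) := by
  rcases eq_or_ne r 0 with rfl | hr
  · exact ⟨1, one_mem _, fun s _ e c => by rw [Nat.choose_zero_right, one_smul]; rfl⟩
  obtain ⟨P, hP, hP'⟩ := exists_isTwistedWittHasseDeriv p n (WittVector.teichmuller p
    (MvPolynomial.X i ^ (r / p ^ min (padicValNat p r) (n - 1)) : MvPolynomial σ k)) i hr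
  have key : ∀ s < n, ∀ (e : σ →₀ ℕ) (c : k), P (wittMono p n s (MvPolynomial.monomial e c)) =
      ((p ^ (n - 1 - s) * e i).choose r) • wittMono p n s (MvPolynomial.monomial e c) := by
    intro s hs e c
    obtain ⟨y, hy, hy'⟩ := exists_mvHasseDeriv_wittGhost_wittMono p n i hr hs e c
    rw [hP' _ y hy, hy']
  refine ⟨P, ⟨Subring.subset_closure (Or.inr ⟨_, i, r, hP⟩), ?_⟩, key⟩
  refine mem_groDiffOps_of_wittGhost p n ((isDiffOpOfOrder_mulOp (MvPolynomial.X i ^ r)).mul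
    (isDiffOpOfOrder_mvHasseEnd i r)) fun s hs e c => ?_
  rw [key s hs, ← wittGhostHom_apply, map_nsmul, wittGhostHom_apply]
  change _ = MvPolynomial.X i ^ r * mvHasseDeriv i r _
  rw [wittGhost_wittMono p n hs, mvHasseDeriv_monomial]
  rcases lt_or_ge ((p ^ (n - 1 - s) • e) i) r with h | h
  · have h' : p ^ (n - 1 - s) * e i < r := by simpa using h
    rw [Nat.choose_eq_zero_of_lt h, Nat.choose_eq_zero_of_lt h']
    simp
  · rw [X_pow_mul_monomial_sub i h, ← map_nsmul, nsmul_eq_mul, mul_comm]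
    simp

theorem exists_shift_choose [NeZero n] (i : σ) (c : ℕ) (hc : c ≠ 0) :
    ∃ P ∈ wittGroDiffOps p n k σ, ∀ s < n, ∀ (e : σ →₀ ℕ) (x : k),
      P (wittMono p n s (MvPolynomial.monomial e x)) =
        ((p ^ (n - 1 - s) * e i).choose (p ^ (n - 1) * c)) •
          wittMono p n s (MvPolynomial.monomial (e - Finsupp.single i (p ^ s * c)) x) := by
  have hpp : p.Prime := Fact.out
  have hr : p ^ (n - 1) * c ≠ 0 := mul_ne_zero (pow_ne_zero _ hpp.ne_zero) hc
  set r := p ^ (n - 1) * c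
  obtain ⟨P, hP, hP'⟩ := exists_isTwistedWittHasseDeriv p n
    (1 : WittVector p (MvPolynomial σ k)) i hr
  have key : ∀ s < n, ∀ (e : σ →₀ ℕ) (x : k),
      wittGhost p n (P (wittMono p n s (MvPolynomial.monomial e x))) = mvHasseDeriv i r
        (wittGhost p n (wittMono p n s (MvPolynomial.monomial e x))) := by
    intro s hs e x
    obtain ⟨y, hy, -⟩ := exists_mvHasseDeriv_wittGhost_wittMono p n i hr hs e x
    rw [hP' _ y hy, one_mul, hy]
  refine ⟨P, ⟨Subring.subset_closure (Or.inr ⟨_, i, r, hP⟩), mem_groDiffOps_of_wittGhost p n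
    (isDiffOpOfOrder_mvHasseEnd i r) key⟩, fun s hs e x => wittGhost_injective p n ?_⟩
  rw [key s hs, ← wittGhostHom_apply, ← wittGhostHom_apply, map_nsmul, wittGhostHom_apply,
    wittGhostHom_apply, wittGhost_wittMono p n hs, wittGhost_wittMono p n hs,
    mvHasseDeriv_monomial, ← map_nsmul]
  have hs' : n - 1 = n - 1 - s + s := by omega
  refine MvPolynomial.monomial_congr (Finsupp.ext fun l => ?_) ?_
  · by_cases hl : i = l
    · subst hl
      simp only [Finsupp.smul_apply, Finsupp.tsub_apply, Finsupp.single_eq_same, smul_eq_mul,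
        Nat.mul_sub, r]
      rw [← mul_assoc, ← pow_add, ← hs']
    · simp [Finsupp.single_eq_of_ne' hl]
  · rw [nsmul_eq_mul, mul_comm]
    simp

end WittHasse

section DiffOpExtension
variable {B C : Type*} [CommRing B] [CommRing C]

theorem apply_pow_succ_mul {P : AddMonoid.End B} {h : B} (D : AddMonoid.End B)
    (hP : ∀ x, P (h * x) = h * P x + D x) (hD : ∀ x, D (h * x) = h * D x) (t : ℕ) (x : B) :
    P (h ^ (t + 1) * x) = h ^ (t + 1) * P x + ((t + 1 : ℕ) : B) * (h ^ t * D x) := by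
  induction t generalizing x with
  | zero => simp [hP]
  | succ t ih =>
    rw [pow_succ, mul_assoc, ih, hP, hD]
    push_cast
    ring

/-- On a ring in which `p` is nilpotent, a differential operator is linear over high powers. -/
theorem IsDiffOpOfOrder.exists_apply_pow_mul {p n m : ℕ} (hp : p ≠ 0) (hB : (p : B) ^ n = 0)
    {P : AddMonoid.End B} (hP : IsDiffOpOfOrder m P) :
    ∃ M, ∀ g x : B, P (g ^ p ^ M * x) = g ^ p ^ M * P x := by
  suffices H : ∃ M, ∀ P : AddMonoid.End B, IsDiffOpOfOrder m P →
      ∀ g x : B, P (g ^ p ^ M * x) = g ^ p ^ M * P x by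
    obtain ⟨M, hM⟩ := H
    exact ⟨M, hM P hP⟩
  clear hP P
  induction m with
  | zero => exact ⟨0, fun P hP g x => DFunLike.congr_fun (hP _) x⟩
  | succ m ih =>
    obtain ⟨M, hM⟩ := ih
    refine ⟨M + n, fun P hP g x => ?_⟩
    obtain ⟨t, ht⟩ := Nat.exists_eq_succ_of_ne_zero (pow_ne_zero n hp)
    have key := apply_pow_succ_mul (P := P) (h := g ^ p ^ M)
      (P * mulOp (g ^ p ^ M) - mulOp (g ^ p ^ M) * P)
      (fun x => (add_sub_cancel (g ^ p ^ M * P x) (P (g ^ p ^ M * x))).symm)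
      (hM _ (hP _) g) t x
    rw [show t + 1 = p ^ n from ht.symm, Nat.cast_pow, hB, zero_mul, add_zero] at key
    rw [pow_add, pow_mul]
    exact key

variable {φ : B →+* C} {S : Set B}

/-- Operators which are linear over `S` extend to a localization at `S`. -/
theorem exists_extension (hφ : Function.Injective φ) (hS : ∀ s ∈ S, IsUnit (φ s))
    (hfrac : ∀ c, ∃ s ∈ S, ∃ x, φ s * c = φ x) {P : AddMonoid.End B}
    (hP : ∀ s ∈ S, ∀ x, P (s * x) = s * P x) :
    ∃ Q : AddMonoid.End C, (∀ x, Q (φ x) = φ (P x)) ∧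
      ∀ s ∈ S, ∀ c, Q (φ s * c) = φ s * Q c := by
  choose den hden num hnum using hfrac
  have key (c : C) (s : B) (hs : s ∈ S) (x : B) (h : φ s * c = φ x) :
      Ring.inverse (φ (den c)) * φ (P (num c)) = Ring.inverse (φ s) * φ (P x) := by
    have h1 : s * num c = den c * x := hφ (by rw [map_mul, map_mul, ← hnum, ← h]; ring)
    have h2 : φ s * φ (P (num c)) = φ (den c) * φ (P x) := by
      rw [← map_mul, ← map_mul, ← hP s hs, h1, hP _ (hden c)]
    have e1 := Ring.inverse_mul_cancel _ (hS s hs)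
    have e2 := Ring.inverse_mul_cancel _ (hS _ (hden c))
    calc Ring.inverse (φ (den c)) * φ (P (num c))
        = Ring.inverse (φ (den c)) * (Ring.inverse (φ s) * φ s) * φ (P (num c)) := by
          rw [e1, mul_one]
      _ = Ring.inverse (φ (den c)) * Ring.inverse (φ s) * (φ s * φ (P (num c))) := by ring
      _ = (Ring.inverse (φ (den c)) * φ (den c)) * (Ring.inverse (φ s) * φ (P x)) := by
          rw [h2]; ring
      _ = _ := by rw [e2, one_mul]
  have hinv (s) (hs : s ∈ S) (y z : C) (h : y = Ring.inverse (φ s) * z) : φ s * y = z := by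
    rw [h, ← mul_assoc, Ring.mul_inverse_cancel _ (hS s hs), one_mul]
  have huniq (c y : C) (s : B) (hs : s ∈ S) (x : B) (h : φ s * c = φ x) (hy : φ s * y = φ (P x)) :
      Ring.inverse (φ (den c)) * φ (P (num c)) = y := by
    rw [key c s hs x h, ← hy, ← mul_assoc, Ring.inverse_mul_cancel _ (hS s hs), one_mul]
  have hden' (c) : φ (den c) * (Ring.inverse (φ (den c)) * φ (P (num c))) = φ (P (num c)) :=
    hinv _ (hden c) _ _ rfl
  refine ⟨AddMonoidHom.mk' (fun c => Ring.inverse (φ (den c)) * φ (P (num c))) fun c c' => ?_,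
    fun x => ?_, fun s hs c => ?_⟩
  · set y := Ring.inverse (φ (den c)) * φ (P (num c)) with hy
    set y' := Ring.inverse (φ (den c')) * φ (P (num c')) with hy'
    have h0 : φ (den (c + c')) * (y + y') = φ (P (num (c + c'))) := by
      have h1 : den c * (den c' * num (c + c')) =
          den (c + c') * (den c' * num c + den c * num c') := hφ (by
        simp only [map_mul, map_add, ← hnum]
        ring)
      have h2 := congrArg P h1
      rw [hP _ (hden _), hP _ (hden _), hP _ (hden _), map_add, hP _ (hden _), hP _ (hden _)] at h2
      have h3 := congrArg φ h2
      simp only [map_mul, map_add] at h3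
      rw [← hden' c, ← hden' c', ← hy, ← hy'] at h3
      have e1 := Ring.inverse_mul_cancel _ (hS _ (hden c))
      have e2 := Ring.inverse_mul_cancel _ (hS _ (hden c'))
      calc φ (den (c + c')) * (y + y') = (Ring.inverse (φ (den c)) * φ (den c)) *
            (Ring.inverse (φ (den c')) * φ (den c')) * (φ (den (c + c')) * (y + y')) := by
            rw [e1, e2]; ring
        _ = Ring.inverse (φ (den c)) * Ring.inverse (φ (den c')) * (φ (den (c + c')) *
            (φ (den c') * (φ (den c) * y) + φ (den c) * (φ (den c') * y'))) := by ring
        _ = (Ring.inverse (φ (den c)) * φ (den c)) *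
            (Ring.inverse (φ (den c')) * φ (den c')) * φ (P (num (c + c'))) := by
            rw [← h3]; ring
        _ = _ := by rw [e1, e2]; ring
    exact huniq _ _ _ (hden (c + c')) _ (hnum _) h0
  · refine huniq _ _ _ (hden (φ x)) (den (φ x) * x) (map_mul _ _ _).symm ?_
    rw [hP _ (hden _), map_mul]
  · refine huniq _ _ _ (hden c) (s * num c) ?_ ?_
    · rw [map_mul, ← hnum]
      ring
    · rw [hP s hs, map_mul]
      refine (mul_left_comm _ _ _).trans ?_
      exact congrArg (φ s * ·) (hden' c)

theorem extension_unique (hS : ∀ s ∈ S, IsUnit (φ s))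
    (hfrac : ∀ c, ∃ s ∈ S, ∃ x, φ s * c = φ x) {Q Q' : AddMonoid.End C}
    (h : ∀ x, Q (φ x) = Q' (φ x)) (hQ : ∀ s ∈ S, ∀ c, Q (φ s * c) = φ s * Q c)
    (hQ' : ∀ s ∈ S, ∀ c, Q' (φ s * c) = φ s * Q' c) : Q = Q' := by
  refine AddMonoidHom.ext fun c => ?_
  obtain ⟨s, hs, x, hx⟩ := hfrac c
  refine (hS s hs).mul_left_cancel ?_
  refine (hQ s hs c).symm.trans (Eq.trans ?_ (hQ' s hs c))
  rw [hx, h]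

theorem IsDiffOpOfOrder.of_localization (hS : ∀ s ∈ S, IsUnit (φ s))
    (hfrac : ∀ c, ∃ s ∈ S, ∃ x, φ s * c = φ x) {m : ℕ} {P : AddMonoid.End B}
    {Q : AddMonoid.End C} (hP : IsDiffOpOfOrder m P) (h : ∀ x, Q (φ x) = φ (P x))
    (hQ : ∀ s ∈ S, ∀ c, Q (φ s * c) = φ s * Q c) : IsDiffOpOfOrder m Q := by
  have red (m) (Q : AddMonoid.End C) (hQ : ∀ s ∈ S, ∀ c, Q (φ s * c) = φ s * Q c) (c : C)
      (H : ∀ x, IsDiffOpOfOrder m (Q * mulOp (φ x) - mulOp (φ x) * Q)) :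
      IsDiffOpOfOrder m (Q * mulOp c - mulOp c * Q) := by
    obtain ⟨s, hs, x, hx⟩ := hfrac c
    have e : Q * mulOp c - mulOp c * Q =
        mulOp (Ring.inverse (φ s)) * (Q * mulOp (φ x) - mulOp (φ x) * Q) := by
      refine AddMonoidHom.ext fun y => ?_
      change Q (c * y) - c * Q y = Ring.inverse (φ s) * (Q (φ x * y) - φ x * Q y)
      rw [← hx, mul_assoc (φ s) c, hQ s hs, mul_assoc (φ s) c, ← mul_sub, ← mul_assoc,
        Ring.inverse_mul_cancel _ (hS s hs), one_mul]
    rw [e]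
    simpa using (isDiffOpOfOrder_mulOp (Ring.inverse (φ s))).mul (H x)
  induction m generalizing P Q with
  | zero =>
    intro c
    refine sub_eq_zero.1 ?_
    have e (x) : Q * mulOp (φ x) - mulOp (φ x) * Q = 0 := by
      refine extension_unique hS hfrac (fun y => ?_) (fun s hs c => ?_) fun s _ c =>
        (mul_zero (φ s)).symm
      · change Q (φ x * φ y) - φ x * Q (φ y) = 0
        rw [← map_mul, h, h, ← map_mul, sub_eq_zero]
        exact congrArg φ (DFunLike.congr_fun (hP x) y)
      · change Q (φ x * (φ s * c)) - φ x * Q (φ s * c) = φ s * (Q (φ x * c) - φ x * Q c)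
        rw [mul_left_comm, hQ s hs, hQ s hs]
        ring
    obtain ⟨s, hs, x, hx⟩ := hfrac c
    refine AddMonoidHom.ext fun y => ?_
    have := DFunLike.congr_fun (e x) y
    change Q (φ x * y) - φ x * Q y = 0 at this
    change Q (c * y) - c * Q y = 0
    rw [← hx, mul_assoc (φ s) c, hQ s hs, mul_assoc (φ s) c, ← mul_sub] at this
    exact (hS s hs).mul_right_eq_zero.1 this
  | succ m ih =>
    intro c
    refine red m Q hQ c fun x => ih (hP x) (fun y => ?_) fun s hs c => ?_
    · change Q (φ x * φ y) - φ x * Q (φ y) = φ (P (x * y) - x * P y)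
      rw [← map_mul, h, h, ← map_mul, map_sub]
    · change Q (φ x * (φ s * c)) - φ x * Q (φ s * c) = φ s * (Q (φ x * c) - φ x * Q c)
      rw [mul_left_comm, hQ s hs, hQ s hs]
      ring

end DiffOpExtension

section Binomial
variable (p : ℕ) [Fact p.Prime]

theorem pow_dvd_choose_of_le {N n j : ℕ} (hj : j ≠ 0) (hjN : j ≤ p ^ N) (z : ℕ) :
    p ^ n ∣ (p ^ (N + n) * z).choose j := by
  have hpp : p.Prime := Fact.out
  obtain ⟨r', h⟩ := (pow_padicValNat_dvd : p ^ padicValNat p j ∣ j)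
  have hpr' : ¬ p ∣ r' := by
    rintro ⟨t, rfl⟩
    refine pow_succ_padicValNat_not_dvd hj (p := p) ⟨t, ?_⟩
    rw [pow_succ, mul_assoc]
    exact h
  have hv : padicValNat p j ≤ N := by
    have h1 : p ^ padicValNat p j ≤ p ^ N :=
      (Nat.le_of_dvd (Nat.pos_of_ne_zero hj) pow_padicValNat_dvd).trans hjN
    exact (Nat.pow_le_pow_iff_right hpp.one_lt).1 h1
  exact (pow_dvd_pow p (by omega)).trans (pow_dvd_choose_mul p h hpr' (by omega : _ ≤ N + n))

theorem choose_add_modEq (N n : ℕ) (x : ℤ) (z : ℕ) :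
    Ring.choose (x + (p : ℤ) ^ (N + n) * z) (p ^ N) ≡ Ring.choose x (p ^ N) [ZMOD (p : ℤ) ^ n] := by
  rw [Ring.add_choose_eq _ (Commute.all _ _)]
  rw [Finset.sum_eq_add_sum_sdiff_singleton_of_mem (i := (p ^ N, 0))
    (Finset.HasAntidiagonal.mem_antidiagonal.2 (add_zero _))]
  rw [Ring.choose_zero_right, mul_one]
  refine (Int.modEq_iff_dvd.2 ?_).symm
  rw [add_sub_cancel_left]
  refine Finset.dvd_sum fun a ha => ?_
  rw [Finset.mem_sdiff, Finset.HasAntidiagonal.mem_antidiagonal, Finset.mem_singleton] at ha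
  have h2 : a.2 ≠ 0 := fun h => ha.2 (Prod.ext (by simpa [h] using ha.1) h)
  have h3 : Ring.choose ((p : ℤ) ^ (N + n) * z) a.2 = ((p ^ (N + n) * z).choose a.2 : ℕ) := by
    rw [← Ring.choose_natCast]
    push_cast
    rfl
  rw [h3]
  refine Dvd.dvd.mul_left ?_ _
  exact_mod_cast pow_dvd_choose_of_le p h2 (by omega) z

theorem choose_modEq_of_modEq {N n : ℕ} {x y : ℤ} (h : x ≡ y [ZMOD (p : ℤ) ^ (N + n)]) :
    Ring.choose x (p ^ N) ≡ Ring.choose y (p ^ N) [ZMOD (p : ℤ) ^ n] := by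
  obtain ⟨z, hz⟩ := Int.modEq_iff_dvd.1 h
  rcases le_total 0 z with h0 | h0
  · obtain ⟨z, rfl⟩ := Int.eq_ofNat_of_zero_le h0
    obtain rfl : y = x + (p : ℤ) ^ (N + n) * z := by linarith
    exact (choose_add_modEq p N n x z).symm
  · obtain ⟨w, hw⟩ := Int.eq_ofNat_of_zero_le (neg_nonneg.2 h0)
    obtain rfl : x = y + (p : ℤ) ^ (N + n) * w := by
      rw [← hw]
      linarith
    exact choose_add_modEq p N n y w

theorem choose_neg_isCoprime {N : ℕ} {y : ℕ} (h0 : 0 < y) (hy : y ≤ p ^ N) :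
    IsCoprime (Ring.choose (-(y : ℤ)) (p ^ N)) p := by
  have hpp : p.Prime := Fact.out
  obtain ⟨t, rfl⟩ := Nat.exists_eq_succ_of_ne_zero h0.ne'
  have h1 : Ring.choose (-((t + 1 : ℕ) : ℤ)) (p ^ N) =
      ((p ^ N : ℕ) : ℤ).negOnePow • (((p ^ N + t).choose (p ^ N) : ℕ) : ℤ) := by
    rw [Ring.choose_neg, ← Ring.choose_natCast]
    congr 2
    push_cast
    ring
  have h2 : ((p ^ N + t).choose (p ^ N)) ≡ 1 [MOD p] := by
    rw [Nat.add_choose_eq, Finset.sum_eq_add_sum_sdiff_singleton_of_mem (i := (p ^ N, 0))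
      (Finset.HasAntidiagonal.mem_antidiagonal.2 (add_zero _))]
    rw [Nat.choose_self, Nat.choose_zero_right, mul_one]
    have : p ∣ ∑ x ∈ Finset.HasAntidiagonal.antidiagonal (p ^ N) \ {(p ^ N, 0)},
        (p ^ N).choose x.1 * t.choose x.2 := by
      refine Finset.dvd_sum fun a ha => ?_
      rw [Finset.mem_sdiff, Finset.HasAntidiagonal.mem_antidiagonal, Finset.mem_singleton] at ha
      rcases eq_or_ne a.1 0 with h | h
      · rw [Nat.choose_eq_zero_of_lt (n := t) (k := a.2) (by omega), mul_zero]
        exact dvd_zero _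
      · refine (hpp.dvd_choose_pow h fun h' => ha.2 (Prod.ext h' ?_)).mul_right _
        simpa [h'] using ha.1
    exact ((Nat.modEq_zero_iff_dvd.2 this).add_left 1)
  have h3 : Nat.Coprime ((p ^ N + t).choose (p ^ N)) p := by
    rw [Nat.Coprime, h2.gcd_eq, Nat.gcd_one_left]
  rw [h1]
  have h4 := Nat.isCoprime_iff_coprime.2 h3
  rcases Int.even_or_odd ((p ^ N : ℕ) : ℤ) with h | h
  · rw [Int.negOnePow_even _ h, one_smul]
    exact h4
  · rw [Int.negOnePow_odd _ h, Units.neg_smul, one_smul]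
    exact h4.neg_left

end Binomial

section DiagonalOps
variable (p : ℕ) [Fact p.Prime] (n : ℕ) [NeZero n] (k : Type*) [Field k] [CharP k p]
  [PerfectRing k p] (σ : Type*)

/-- The functions `c` for which `V^s[λ t^e] ↦ c(s, e) V^s[λ t^e]` is a differential operator. -/
def diagonalSymbols : Subring (ℕ → (σ →₀ ℕ) → ℤ) where
  carrier := {c | ∃ P ∈ wittGroDiffOps p n k σ, ∀ s < n, ∀ (e : σ →₀ ℕ) (x : k),
    P (wittMono p n s (MvPolynomial.monomial e x)) =
      c s e • wittMono p n s (MvPolynomial.monomial e x)}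
  mul_mem' := fun {c c'} ⟨P, hP, h⟩ ⟨P', hP', h'⟩ => ⟨P * P', mul_mem hP hP', fun s hs e x => by
    change P (P' _) = _
    rw [h' s hs, map_zsmul, h s hs, smul_smul, mul_comm]
    rfl⟩
  one_mem' := ⟨1, one_mem _, fun s hs e x => (one_smul ℤ _).symm⟩
  add_mem' := fun {c c'} ⟨P, hP, h⟩ ⟨P', hP', h'⟩ => ⟨P + P', add_mem hP hP', fun s hs e x => by
    change P _ + P' _ = _
    rw [h s hs, h' s hs, ← add_smul]
    rfl⟩
  zero_mem' := ⟨0, zero_mem _, fun s hs e x => (zero_smul ℤ _).symm⟩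
  neg_mem' := fun {c} ⟨P, hP, h⟩ => ⟨-P, neg_mem hP, fun s hs e x => by
    change - P _ = _
    rw [h s hs, ← neg_smul]
    rfl⟩

variable {σ}

theorem choose_sum_mem_diagonalSymbols (T : Finset σ) (r : ℕ) :
    (fun s e => (((p ^ (n - 1 - s) * ∑ i ∈ T, e i).choose r : ℕ) : ℤ)) ∈
      diagonalSymbols p n k σ := by
  classical
  induction T using Finset.induction_on generalizing r with
  | empty =>
    have : (fun (s : ℕ) (e : σ →₀ ℕ) => (((p ^ (n - 1 - s) * ∑ i ∈ (∅ : Finset σ), e i).choose r : ℕ) : ℤ)) =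
        ((Nat.choose 0 r : ℕ) : ℕ → (σ →₀ ℕ) → ℤ) := by
      funext s e
      simp
    rw [this]
    exact natCast_mem _ _
  | insert i T hi ih =>
    have : (fun (s : ℕ) (e : σ →₀ ℕ) => (((p ^ (n - 1 - s) * ∑ i ∈ insert i T, e i).choose r : ℕ) : ℤ)) =
        ∑ a ∈ Finset.HasAntidiagonal.antidiagonal r,
          (fun (s : ℕ) (e : σ →₀ ℕ) => (((p ^ (n - 1 - s) * e i).choose a.1 : ℕ) : ℤ)) *
          (fun (s : ℕ) (e : σ →₀ ℕ) => (((p ^ (n - 1 - s) * ∑ i ∈ T, e i).choose a.2 : ℕ) : ℤ)) := by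
      funext s e
      rw [Finset.sum_insert hi, mul_add, Nat.add_choose_eq]
      simp [Finset.sum_apply]
    rw [this]
    refine sum_mem fun a _ => mul_mem ?_ (ih _)
    obtain ⟨P, hP, h⟩ := exists_diagonal_choose p n (k := k) i a.1
    exact ⟨P, hP, fun s hs e x => by rw [h s hs, natCast_zsmul]⟩

theorem choose_neg_sum_mem_diagonalSymbols [Fintype σ] {r : ℕ} (hr : r ≠ 0) :
    (fun s e => Ring.choose ((p : ℤ) ^ (n - 1 - s) * -∑ i, (e i : ℤ)) r) ∈
      diagonalSymbols p n k σ := by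
  obtain ⟨t, rfl⟩ := Nat.exists_eq_succ_of_ne_zero hr
  have : (fun (s : ℕ) (e : σ →₀ ℕ) => Ring.choose ((p : ℤ) ^ (n - 1 - s) * -∑ i, (e i : ℤ)) (t + 1)) =
      ((((t + 1 : ℕ) : ℤ).negOnePow : ℤ) : ℕ → (σ →₀ ℕ) → ℤ) *
      ∑ a ∈ Finset.HasAntidiagonal.antidiagonal (t + 1),
        (fun (s : ℕ) (e : σ →₀ ℕ) => (((p ^ (n - 1 - s) * ∑ i, e i).choose a.1 : ℕ) : ℤ)) *
          ((t.choose a.2 : ℕ) : ℕ → (σ →₀ ℕ) → ℤ) := by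
    funext s e
    have h1 : ((p : ℤ) ^ (n - 1 - s) * -∑ i, (e i : ℤ)) = -((p ^ (n - 1 - s) * ∑ i, e i : ℕ) : ℤ) := by
      push_cast
      ring
    have h2 : ((p ^ (n - 1 - s) * ∑ i, e i : ℕ) : ℤ) + ((t + 1 : ℕ) : ℤ) - 1 =
        ((p ^ (n - 1 - s) * ∑ i, e i + t : ℕ) : ℤ) := by
      push_cast
      ring
    rw [h1, Ring.choose_neg, h2, Ring.choose_natCast, Nat.add_choose_eq]
    generalize ((t + 1 : ℕ) : ℤ).negOnePow = w
    simp [Finset.sum_apply, Units.smul_def]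
  rw [this]
  refine mul_mem (intCast_mem _ _) (sum_mem fun a _ => mul_mem ?_ (natCast_mem _ _))
  exact choose_sum_mem_diagonalSymbols p n k Finset.univ a.1

end DiagonalOps

section Charts

/-- The ring homomorphism `k[t_i : i ≠ l] → K`, `t_i ↦ u_i / u_l`. -/
def chartHom (k : Type*) {K : Type*} [Field k] [Field K] [Algebra k K] {d : ℕ} (u : Fin (d + 1) → K)
    (l : Fin (d + 1)) : MvPolynomial {i : Fin (d + 1) // i ≠ l} k →+* K :=
  (MvPolynomial.aeval fun i : {i : Fin (d + 1) // i ≠ l} => u i / u l :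
    MvPolynomial {i : Fin (d + 1) // i ≠ l} k →ₐ[k] K).toRingHom

/-- The function field `K` of `P^d`, described by its affine charts. -/
structure ProjCharts (k K : Type*) [Field k] [Field K] [Algebra k K] (d : ℕ) where
  /-- The homogeneous coordinates, up to a common factor. -/
  u : Fin (d + 1) → K
  u_ne_zero : ∀ i, u i ≠ 0
  injective : ∀ l, Function.Injective (chartHom k u l)
  frac : ∀ l z, ∃ f ≠ 0, ∃ g, chartHom k u l f * z = chartHom k u l g

variable {k K : Type*} [Field k] [Field K] [Algebra k K] {d : ℕ} (D : ProjCharts k K d)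

namespace ProjCharts

/-- The inclusion of the functions on the chart `z_l ≠ 0`. -/
abbrev chart (l : Fin (d + 1)) : MvPolynomial {i : Fin (d + 1) // i ≠ l} k →+* K :=
  chartHom k D.u l

theorem chart_X (l : Fin (d + 1)) (i : {i : Fin (d + 1) // i ≠ l}) :
    D.chart l (MvPolynomial.X i) = D.u i / D.u l := MvPolynomial.aeval_X _ i

/-- The Laurent monomial `u^m`. -/
def umon (m : Fin (d + 1) → ℤ) : K := ∏ i, D.u i ^ m i

theorem umon_ne_zero (m : Fin (d + 1) → ℤ) : D.umon m ≠ 0 :=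
  Finset.prod_ne_zero_iff.2 fun i _ => zpow_ne_zero _ (D.u_ne_zero i)

theorem umon_add (m m' : Fin (d + 1) → ℤ) : D.umon (m + m') = D.umon m * D.umon m' := by
  rw [umon, umon, umon, ← Finset.prod_mul_distrib]
  exact Finset.prod_congr rfl fun i _ => zpow_add₀ (D.u_ne_zero i) _ _

theorem umon_nsmul (t : ℕ) (m : Fin (d + 1) → ℤ) : D.umon (t • m) = D.umon m ^ t := by
  rw [umon, umon, ← Finset.prod_pow]
  refine Finset.prod_congr rfl fun i _ => ?_
  rw [Pi.smul_apply, nsmul_eq_mul, mul_comm, zpow_mul, zpow_natCast]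

/-- The homogeneous exponent of a monomial on the chart `z_l ≠ 0`. -/
def homExp (l : Fin (d + 1)) (e : {i : Fin (d + 1) // i ≠ l} →₀ ℕ) (i : Fin (d + 1)) : ℤ :=
  if h : i ≠ l then (e ⟨i, h⟩ : ℤ) else -∑ i, (e i : ℤ)

@[to_additive]
theorem prod_ne_mul {M : Type*} [CommMonoid M] (l : Fin (d + 1)) (f : Fin (d + 1) → M) :
    (∏ i : {i : Fin (d + 1) // i ≠ l}, f i.1) * f l = ∏ i, f i := by
  rw [← Fintype.prod_subtype_mul_prod_subtype (fun i => i ≠ l) f]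
  congr 1
  have : Unique {i : Fin (d + 1) // ¬ i ≠ l} :=
    ⟨⟨⟨l, not_not.2 rfl⟩⟩, fun x => Subtype.ext (not_not.1 x.2)⟩
  rw [Fintype.prod_unique]
  exact congrArg f (not_not.1 (default : {i : Fin (d + 1) // ¬ i ≠ l}).2).symm

theorem chart_monomial (l : Fin (d + 1)) (e : {i : Fin (d + 1) // i ≠ l} →₀ ℕ) (c : k) :
    D.chart l (MvPolynomial.monomial e c) = algebraMap k K c * D.umon (homExp l e) := by
  have h1 : D.chart l (MvPolynomial.monomial e c) = _ := MvPolynomial.aeval_monomial _ e c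
  rw [h1, umon, ← prod_ne_mul l, Finsupp.prod_fintype _ _ fun i => pow_zero _]
  congr 1
  have h2 : homExp l e l = -∑ i, (e i : ℤ) := dif_neg (not_not.2 rfl)
  rw [h2, zpow_neg, ← Nat.cast_sum, zpow_natCast, ← Finset.prod_pow_eq_pow_sum, ← Finset.prod_inv_distrib, ← Finset.prod_mul_distrib]
  refine Finset.prod_congr rfl fun i _ => ?_
  have h3 : homExp l e i = e i := dif_pos i.2
  rw [h3, zpow_natCast, div_pow, div_eq_mul_inv]


end ProjCharts
end Charts

section Denominators
variable (p : ℕ) [Fact p.Prime] (n : ℕ)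

theorem exists_eq_mapHom {A B : Type*} [CommRing A] [CommRing B] (ψ : A →+* B)
    (y : TruncatedWittVector p n B) (h : ∀ i, ∃ g, y.coeff i = ψ g) :
    ∃ x, y = TruncatedWittVector.mapHom p n ψ x := by
  choose g hg using h
  exact ⟨TruncatedWittVector.mk p g, TruncatedWittVector.ext fun i => by
    rw [TruncatedWittVector.coeff_mapHom, TruncatedWittVector.coeff_mk, hg]⟩

theorem exists_wittTeich_mul_eq_mapHom {A B : Type*} [CommRing A] [CommRing B] [CharP B p]
    (ψ : A →+* B) (z : TruncatedWittVector p n B) (f : A) (h : ∀ i, ∃ g, ψ f * z.coeff i = ψ g)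
    {t : ℕ} (ht : t ≠ 0) :
    ∃ x, wittTeich p n (ψ f ^ t) * z = TruncatedWittVector.mapHom p n ψ x := by
  refine exists_eq_mapHom p n ψ _ fun i => ?_
  obtain ⟨g, hg⟩ := h i
  obtain ⟨r, hr⟩ := Nat.exists_eq_succ_of_ne_zero
    (mul_ne_zero ht (pow_ne_zero i (Fact.out : p.Prime).ne_zero))
  refine ⟨f ^ r * g, ?_⟩
  rw [coeff_wittTeich_mul, ← pow_mul, hr, Nat.succ_eq_add_one, pow_succ, mul_assoc, hg, map_mul,
    map_pow]

theorem exists_ne_zero_wittTeich_mul_eq_mapHom {A K : Type*} [CommRing A] [IsDomain A] [Field K]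
    [CharP K p] (ψ : A →+* K) (hψ : ∀ z, ∃ f ≠ 0, ∃ g, ψ f * z = ψ g)
    (z : TruncatedWittVector p n K) {t : ℕ} (ht : t ≠ 0) :
    ∃ f ≠ 0, ∃ x, wittTeich p n (ψ f ^ t) * z = TruncatedWittVector.mapHom p n ψ x := by
  choose f hf g hg using fun i => hψ (z.coeff i)
  refine ⟨∏ i, f i, Finset.prod_ne_zero_iff.2 fun i _ => hf i,
    exists_wittTeich_mul_eq_mapHom p n ψ z _ (fun i => ?_) ht⟩
  obtain ⟨c, hc⟩ := Finset.dvd_prod_of_mem f (Finset.mem_univ i)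
  exact ⟨c * g i, by rw [hc, map_mul, map_mul, ← hg]; ring⟩

theorem zsmul_eq_of_modEq {R : Type*} [CommRing R] [CharP R p] {x y : ℤ}
    (h : x ≡ y [ZMOD (p : ℤ) ^ n]) (w : TruncatedWittVector p n R) : x • w = y • w := by
  obtain ⟨z, hz⟩ := Int.modEq_iff_dvd.1 h
  obtain rfl : y = x + p ^ n * z := by linarith
  rw [zsmul_eq_mul, zsmul_eq_mul]
  push_cast
  rw [truncatedWitt_p_pow_eq_zero]
  ring

theorem isUnit_wittTeich {R : Type*} [CommRing R] {x : R} (h : IsUnit x) :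
    IsUnit (wittTeich p n x) := h.map _

end Denominators

section Theta
variable {k K : Type*} [Field k] [Field K] [Algebra k K] {d : ℕ} (D : ProjCharts k K d)
  (p : ℕ) [Fact p.Prime] (n : ℕ) [NeZero n] [CharP k p] [PerfectRing k p] [CharP K p]

namespace ProjCharts

theorem exists_chartOp {a b : Fin (d + 1)} (hab : a ≠ b) {N : ℕ} (hN : n - 1 ≤ N)
    (l : Fin (d + 1)) : ∃ P ∈ wittGroDiffOps p n k {i : Fin (d + 1) // i ≠ l},
      ∀ s < n, ∀ e c, TruncatedWittVector.mapHom p n (D.chart l)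
        (P (wittMono p n s (MvPolynomial.monomial e c))) =
          Ring.choose ((p : ℤ) ^ (n - 1 - s) * homExp l e b) (p ^ N) •
            (wittTeich p n (D.u a / D.u b) *
              wittMono p n s (D.chart l (MvPolynomial.monomial e c))) := by
  have hpp : p.Prime := Fact.out
  have hmem (x : TruncatedWittVector p n (MvPolynomial {i : Fin (d + 1) // i ≠ l} k)) :
      mulOp x ∈ wittGroDiffOps p n k {i : Fin (d + 1) // i ≠ l} :=
    ⟨Subring.subset_closure (Or.inl ⟨x, rfl⟩), mulOp_mem_groDiffOps x⟩
  by_cases hb : b ≠ l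
  · obtain ⟨tA, htA⟩ : ∃ tA, D.chart l tA = D.u a / D.u l := by
      by_cases ha : a ≠ l
      · exact ⟨MvPolynomial.X ⟨a, ha⟩, D.chart_X l ⟨a, ha⟩⟩
      · obtain rfl : a = l := not_not.1 ha
        exact ⟨1, by rw [map_one, div_self (D.u_ne_zero a)]⟩
    obtain ⟨r, hr⟩ := Nat.exists_eq_succ_of_ne_zero (pow_ne_zero (N - (n - 1)) hpp.ne_zero)
    obtain ⟨P, hP, h⟩ := exists_shift_choose p n (k := k)
      (⟨b, hb⟩ : {i : Fin (d + 1) // i ≠ l}) (r + 1) r.succ_ne_zero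
    refine ⟨mulOp (wittTeich p n (tA * MvPolynomial.X ⟨b, hb⟩ ^ r)) * P, mul_mem (hmem _) hP,
      fun s hs e c => ?_⟩
    change TruncatedWittVector.mapHom p n (D.chart l) (_ * P _) = _
    have hQ : p ^ (n - 1) * (r + 1) = p ^ N := by
      rw [← Nat.succ_eq_add_one, ← hr, ← pow_add, Nat.add_sub_cancel' hN]
    have hx : homExp l e b = e ⟨b, hb⟩ := dif_pos hb
    have hch : Ring.choose ((p : ℤ) ^ (n - 1 - s) * homExp l e b) (p ^ N) =
        (((p ^ (n - 1 - s) * e ⟨b, hb⟩).choose (p ^ N) : ℕ) : ℤ) := by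
      rw [← Ring.choose_natCast, hx]
      push_cast
      rfl
    rw [h s hs, hch, hQ, mul_smul_comm, wittTeich_mul_wittMono, map_nsmul, mapHom_wittMono,
      natCast_zsmul, wittTeich_mul_wittMono]
    rcases lt_or_ge (e ⟨b, hb⟩) (p ^ s * (r + 1)) with hlt | hge
    · rw [Nat.choose_eq_zero_of_lt, zero_smul, zero_smul]
      have : p ^ N = p ^ (n - 1 - s) * (p ^ s * (r + 1)) := by
        rw [← hQ, ← mul_assoc, ← pow_add, show n - 1 - s + s = n - 1 by omega]
      rw [this]
      exact Nat.mul_lt_mul_of_pos_left hlt (pow_pos hpp.pos _)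
    · rw [← X_pow_mul_monomial_sub _ hge c]
      congr 2
      simp only [map_mul, map_pow, htA, D.chart_X]
      have hu := D.u_ne_zero b
      have hl := D.u_ne_zero l
      rw [← mul_assoc, mul_pow, ← pow_mul, mul_comm r, mul_add, mul_one, pow_add]
      have : (D.u a / D.u l) ^ p ^ s = (D.u a / D.u b) ^ p ^ s * (D.u b / D.u l) ^ p ^ s := by
        rw [← mul_pow, div_mul_div_cancel₀ hu]
      rw [this]
      ring
  · obtain rfl : b = l := not_not.1 hb
    obtain ⟨P, hP, h⟩ := choose_neg_sum_mem_diagonalSymbols p n k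
      (σ := {i : Fin (d + 1) // i ≠ b}) (pow_ne_zero N hpp.ne_zero)
    refine ⟨mulOp (wittTeich p n (MvPolynomial.X ⟨a, hab⟩)) * P, mul_mem (hmem _) hP,
      fun s hs e c => ?_⟩
    change TruncatedWittVector.mapHom p n (D.chart b) (_ * P _) = _
    have hx : homExp b e b = -∑ i, (e i : ℤ) := dif_neg (not_not.2 rfl)
    rw [h s hs, hx, mul_smul_comm, map_zsmul, map_mul, mapHom_wittTeich, mapHom_wittMono,
      D.chart_X]

theorem exists_homExp (l : Fin (d + 1)) (m : Fin (d + 1) → ℤ) (hm : ∑ i, m i = 0) :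
    ∃ h : Fin (d + 1) → ℤ, ∃ R : ℕ, ∀ T : ℕ, R ≤ T → ∃ e, homExp l e = m + T • h := by
  refine ⟨homExp l (Finsupp.equivFunOnFinite.symm fun _ => 1), ∑ i, (m i).natAbs, fun T hT => ?_⟩
  refine ⟨Finsupp.equivFunOnFinite.symm fun i => (m i + T).toNat, ?_⟩
  have hnn (i) : ((m i + T).toNat : ℤ) = m i + T := by
    refine Int.toNat_of_nonneg ?_
    have : (m i).natAbs ≤ ∑ i, (m i).natAbs :=
      Finset.single_le_sum (f := fun i => (m i).natAbs) (fun _ _ => Nat.zero_le _)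
        (Finset.mem_univ i)
    omega
  funext i
  by_cases hi : i ≠ l
  · simp [homExp, hi]
    simpa using hnn i
  · obtain rfl : i = l := not_not.1 hi
    have h1 := sum_ne_add i m
    rw [hm] at h1
    rw [Pi.add_apply, Pi.smul_apply]
    simp only [homExp, hi, dif_neg, not_false_iff, Finsupp.equivFunOnFinite_symm_apply_apply, hnn,
      nsmul_eq_mul, Nat.cast_one, Finset.sum_add_distrib, Finset.sum_const, Finset.card_univ]
    linarith

/-- The formula which characterizes the operator `θ_{a, b, N}`. -/
def IsTheta (a b : Fin (d + 1)) (N : ℕ) (θ : AddMonoid.End (TruncatedWittVector p n K)) : Prop :=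
  ∀ m : Fin (d + 1) → ℤ, ∑ i, m i = 0 → ∀ s < n, ∀ c : k,
    θ (wittMono p n s (algebraMap k K c * D.umon m)) =
      Ring.choose ((p : ℤ) ^ (n - 1 - s) * m b) (p ^ N) •
        (wittTeich p n (D.u a / D.u b) * wittMono p n s (algebraMap k K c * D.umon m))

theorem exists_theta_of_chart {a b : Fin (d + 1)} (hab : a ≠ b) {N : ℕ} (hN : n - 1 ≤ N)
    (l : Fin (d + 1)) : ∃ θ ∈ groDiffOps (TruncatedWittVector p n K), D.IsTheta p n a b N θ ∧
      ∃ Q ∈ wittDiffOps p n k {i : Fin (d + 1) // i ≠ l}, ∀ x,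
        θ (TruncatedWittVector.mapHom p n (D.chart l) x) =
          TruncatedWittVector.mapHom p n (D.chart l) (Q x) := by
  have hpp : p.Prime := Fact.out
  obtain ⟨P, ⟨hPw, o, ho⟩, hP⟩ := D.exists_chartOp p n hab hN l
  obtain ⟨M, hM⟩ := ho.exists_apply_pow_mul hpp.ne_zero (truncatedWitt_p_pow_eq_zero p n)
  let φ := TruncatedWittVector.mapHom p n (D.chart l)
  let S : Set (TruncatedWittVector p n (MvPolynomial {i : Fin (d + 1) // i ≠ l} k)) :=
    {x | ∃ f ≠ 0, x = wittTeich p n f ^ p ^ M}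
  have hS : ∀ s ∈ S, IsUnit (φ s) := by
    rintro _ ⟨f, hf, rfl⟩
    rw [map_pow, mapHom_wittTeich]
    exact (isUnit_wittTeich p n (isUnit_iff_ne_zero.2
      ((map_ne_zero_iff _ (D.injective l)).2 hf))).pow _
  have hfrac : ∀ c, ∃ s ∈ S, ∃ x, φ s * c = φ x := fun c => by
    obtain ⟨f, hf, x, hx⟩ := exists_ne_zero_wittTeich_mul_eq_mapHom p n (D.chart l)
      (D.frac l) c (pow_ne_zero M hpp.ne_zero)
    refine ⟨_, ⟨f, hf, rfl⟩, x, ?_⟩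
    rw [map_pow, mapHom_wittTeich, ← map_pow]
    exact hx
  obtain ⟨θ, hθ, hθS⟩ := exists_extension
    (TruncatedWittVector.mapHom_injective p n (D.injective l)) hS hfrac
    (P := P) (by
      rintro _ ⟨f, -, rfl⟩ x
      exact hM _ x)
  have hθo := ho.of_localization hS hfrac hθ hθS
  refine ⟨θ, ⟨o, hθo⟩, fun m hm s hs c => ?_, P, hPw, hθ⟩
  obtain ⟨M', hM'⟩ := hθo.exists_apply_pow_mul hpp.ne_zero (truncatedWitt_p_pow_eq_zero p n)
  obtain ⟨h, R, hR⟩ := exists_homExp l m hm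
  let T := p ^ (M' + (N + n)) * R
  obtain ⟨e, he⟩ := hR (p ^ s * T) (by
    have h1 : 0 < p ^ s * p ^ (M' + (N + n)) :=
      mul_pos (pow_pos hpp.pos _) (pow_pos hpp.pos _)
    calc R ≤ (p ^ s * p ^ (M' + (N + n))) * R := Nat.le_mul_of_pos_left R h1
      _ = p ^ s * T := by simp only [T]; ring)
  have e1 : wittMono p n s (D.chart l (MvPolynomial.monomial e c)) =
      wittTeich p n (D.umon h ^ T) * wittMono p n s (algebraMap k K c * D.umon m) := by
    rw [wittTeich_mul_wittMono, D.chart_monomial, he, D.umon_add, D.umon_nsmul, ← pow_mul,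
      mul_comm T]
    congr 1
    ring
  have e2 : wittTeich p n (D.umon h ^ T) =
      wittTeich p n (D.umon h ^ (p ^ (N + n) * R)) ^ p ^ M' := by
    rw [← map_pow, ← pow_mul]
    congr 2
    simp only [T]
    ring
  have e3 := hP s hs e c
  rw [← hθ, mapHom_wittMono, e1, e2, hM', ← e2] at e3
  refine (isUnit_wittTeich p n (isUnit_iff_ne_zero.2
    (pow_ne_zero T (D.umon_ne_zero h)))).mul_left_cancel (e3.trans ?_)
  rw [zsmul_eq_of_modEq p n (y := Ring.choose ((p : ℤ) ^ (n - 1 - s) * m b) (p ^ N)), mul_smul_comm,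
    mul_left_comm]
  refine choose_modEq_of_modEq p ((Int.modEq_iff_dvd.2 ?_).symm)
  rw [he]
  refine ⟨p ^ (n - 1 - s) * (p ^ s * (p ^ M' * R) * h b), ?_⟩
  rw [Pi.add_apply, Pi.smul_apply, nsmul_eq_mul]
  simp only [T]
  push_cast
  ring

theorem IsTheta.unique {a b : Fin (d + 1)} {N : ℕ} {θ θ' : AddMonoid.End (TruncatedWittVector p n K)}
    (h : D.IsTheta p n a b N θ) (h' : D.IsTheta p n a b N θ') (hθ : θ ∈ groDiffOps _)
    (hθ' : θ' ∈ groDiffOps _) : θ = θ' := by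
  have hpp : p.Prime := Fact.out
  obtain ⟨o, ho⟩ := hθ
  obtain ⟨o', ho'⟩ := hθ'
  obtain ⟨M, hM⟩ := ho.exists_apply_pow_mul hpp.ne_zero (truncatedWitt_p_pow_eq_zero p n)
  obtain ⟨M', hM'⟩ := ho'.exists_apply_pow_mul hpp.ne_zero (truncatedWitt_p_pow_eq_zero p n)
  let φ := TruncatedWittVector.mapHom p n (D.chart 0)
  let S : Set (TruncatedWittVector p n (MvPolynomial {i : Fin (d + 1) // i ≠ 0} k)) :=
    {x | ∃ f ≠ 0, x = wittTeich p n f ^ p ^ (M + M')}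
  refine extension_unique (φ := φ) (S := S) ?_ ?_ ?_ ?_ ?_
  · rintro _ ⟨f, hf, rfl⟩
    rw [map_pow, mapHom_wittTeich]
    exact (isUnit_wittTeich p n (isUnit_iff_ne_zero.2
      ((map_ne_zero_iff _ (D.injective 0)).2 hf))).pow _
  · intro c
    obtain ⟨f, hf, x, hx⟩ := exists_ne_zero_wittTeich_mul_eq_mapHom p n (D.chart 0)
      (D.frac 0) c (pow_ne_zero (M + M') hpp.ne_zero)
    refine ⟨_, ⟨f, hf, rfl⟩, x, ?_⟩
    rw [map_pow, mapHom_wittTeich, ← map_pow]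
    exact hx
  · intro x
    let C : AddSubgroup (TruncatedWittVector p n (MvPolynomial {i : Fin (d + 1) // i ≠ 0} k)) :=
      AddMonoidHom.eqLocus (AddMonoidHom.comp θ φ.toAddMonoidHom)
        (AddMonoidHom.comp θ' φ.toAddMonoidHom)
    have hC : C = ⊤ := wittMono_monomial_induction p n fun s hs e c => by
      change θ (φ _) = θ' (φ _)
      have hm : ∑ i, homExp 0 e i = 0 := by
        rw [← sum_ne_add 0 (homExp 0 e)]
        have h2 : homExp 0 e 0 = -∑ i, (e i : ℤ) := dif_neg (not_not.2 rfl)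
        rw [h2, add_neg_eq_zero]
        exact Finset.sum_congr rfl fun i _ => dif_pos i.2
      rw [mapHom_wittMono, D.chart_monomial, h _ hm s hs, h' _ hm s hs]
    exact (hC ▸ AddSubgroup.mem_top x : x ∈ C)
  · rintro _ ⟨f, -, rfl⟩ c
    rw [map_pow, pow_add, pow_mul', hM]
  · rintro _ ⟨f, -, rfl⟩ c
    rw [map_pow, pow_add, pow_mul, hM']

theorem exists_theta {a b : Fin (d + 1)} (hab : a ≠ b) {N : ℕ} (hN : n - 1 ≤ N) :
    ∃ θ ∈ groDiffOps (TruncatedWittVector p n K), D.IsTheta p n a b N θ ∧ ∀ l,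
      ∃ Q ∈ wittDiffOps p n k {i : Fin (d + 1) // i ≠ l}, ∀ x,
        θ (TruncatedWittVector.mapHom p n (D.chart l) x) =
          TruncatedWittVector.mapHom p n (D.chart l) (Q x) := by
  obtain ⟨θ, hθ, h, -⟩ := D.exists_theta_of_chart p n hab hN 0
  refine ⟨θ, hθ, h, fun l => ?_⟩
  obtain ⟨θ', hθ', h', H⟩ := D.exists_theta_of_chart p n hab hN l
  rwa [← IsTheta.unique D p n h h' hθ hθ'] at H

end ProjCharts

omit [NeZero n] in
/-- A differential operator on `W_n(K)` is `W_n(k)`-linear. -/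
theorem apply_mapHom_mul_of_mem_groDiffOps {θ : AddMonoid.End (TruncatedWittVector p n K)}
    (hθ : θ ∈ groDiffOps _) (c : TruncatedWittVector p n k) (x : TruncatedWittVector p n K) :
    θ (TruncatedWittVector.mapHom p n (algebraMap k K) c * x) =
      TruncatedWittVector.mapHom p n (algebraMap k K) c * θ x := by
  have hpp : p.Prime := Fact.out
  obtain ⟨o, ho⟩ := hθ
  obtain ⟨M, hM⟩ := ho.exists_apply_pow_mul hpp.ne_zero (truncatedWitt_p_pow_eq_zero p n)
  let ι := TruncatedWittVector.mapHom p n (algebraMap k K)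
  let C : AddSubgroup (TruncatedWittVector p n k) :=
    { carrier := {c | ∀ x, θ (ι c * x) = ι c * θ x}
      zero_mem' := fun x => by rw [map_zero, zero_mul, zero_mul, map_zero]
      add_mem' := fun {c c'} h h' x => by rw [map_add, add_mul, add_mul, map_add, h, h']
      neg_mem' := fun {c} h x => by rw [map_neg, neg_mul, neg_mul, map_neg, h] }
  have hC : C = ⊤ := by
    refine wittMono_induction p n (T := Set.univ) (by rw [AddSubgroup.closure_univ]) ?_
    intro s hs c _ x
    obtain ⟨y, hy⟩ : ∃ y, y ^ p ^ M = c := ⟨(iterateFrobeniusEquiv k p M).symm c, by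
      rw [← iterateFrobeniusEquiv_def]; exact (iterateFrobeniusEquiv k p M).apply_symm_apply c⟩
    obtain ⟨z, hz⟩ : ∃ z, z ^ p ^ s = y := ⟨(iterateFrobeniusEquiv k p s).symm y, by
      rw [← iterateFrobeniusEquiv_def]; exact (iterateFrobeniusEquiv k p s).apply_symm_apply y⟩
    have e : wittMono p n s c = (p ^ s : ℕ) • wittTeich p n z ^ p ^ M := by
      rw [← hy, ← hz, ← pow_mul, mul_comm, pow_mul, nsmul_eq_mul, Nat.cast_pow, ← map_pow,
        ← wittMono_zero, ← wittMono_add_pow, zero_add]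
    rw [e, map_nsmul, map_pow, smul_mul_assoc, map_nsmul, hM, smul_mul_assoc]
  exact (hC ▸ AddSubgroup.mem_top c : c ∈ C) x

end Theta

section ProjIntegral

attribute [local instance] MvPolynomial.gradedAlgebra

variable (k : Type u) [Field k] (d : ℕ)

local notation "𝒜" => MvPolynomial.homogeneousSubmodule (Fin (d + 1)) k

theorem X_mem_homogeneousSubmodule (i : Fin (d + 1)) :
    (MvPolynomial.X i : MvPolynomial (Fin (d + 1)) k) ∈ 𝒜 1 := MvPolynomial.isHomogeneous_X k i

/-- The generic point of `P^d`. -/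
def projGenericPoint : ProjectiveSpectrum 𝒜 where
  asHomogeneousIdeal := ⊥
  isPrime := Ideal.isPrime_bot
  not_irrelevant_le h := by
    have h1 : (MvPolynomial.X 0 : MvPolynomial (Fin (d + 1)) k) ∈ HomogeneousIdeal.irrelevant 𝒜 := by
      rw [HomogeneousIdeal.mem_irrelevant_iff, GradedRing.proj_apply]
      exact DirectSum.decompose_of_mem_ne 𝒜 (X_mem_homogeneousSubmodule k d 0) one_ne_zero
    have h2 : (MvPolynomial.X 0 : MvPolynomial (Fin (d + 1)) k) ∈ (⊥ : Ideal _) := h h1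
    exact MvPolynomial.X_ne_zero 0 ((Submodule.mem_bot _).1 h2)

theorem projGenericPoint_mem (U : (projSpace k d).Opens) {x : projSpace k d} (hx : x ∈ U) :
    (projGenericPoint k d : projSpace k d) ∈ U := by
  obtain ⟨_, ⟨f, rfl⟩, hxf, hfU⟩ :=
    TopologicalSpace.Opens.isBasis_iff_nbhd.1 (Proj.isBasis_basicOpen 𝒜) hx
  refine hfU ?_
  have hf : f ≠ 0 := by
    rintro rfl
    rw [Proj.basicOpen_zero] at hxf
    exact hxf
  exact fun h => hf ((Submodule.mem_bot _).1 h)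

instance : IrreducibleSpace (projSpace k d) where
  isPreirreducible_univ := fun U V hU hV ⟨_, _, hx⟩ ⟨_, _, hy⟩ =>
    ⟨projGenericPoint k d, trivial, projGenericPoint_mem k d ⟨U, hU⟩ hx,
      projGenericPoint_mem k d ⟨V, hV⟩ hy⟩
  toNonempty := ⟨(projGenericPoint k d : projSpace k d)⟩

instance : IsReduced (projSpace k d) := by
  have (x : projSpace k d) : _root_.IsReduced ((projSpace k d).presheaf.stalk x) := by
    have := ProjectiveSpectrum.isPrime x
    let e := (Proj.stalkIso 𝒜 x).commRingCatIsoToRingEquiv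
    have h1 : _root_.IsReduced (HomogeneousLocalization.AtPrime 𝒜
        (ProjectiveSpectrum.asHomogeneousIdeal x).toIdeal) := by
      have h2 : IsDomain (Localization.AtPrime (ProjectiveSpectrum.asHomogeneousIdeal x).toIdeal) :=
        inferInstance
      exact isReduced_of_injective (algebraMap _ (Localization.AtPrime
        (ProjectiveSpectrum.asHomogeneousIdeal x).toIdeal))
          (HomogeneousLocalization.val_injective _)
    exact isReduced_of_injective e.toRingHom e.injective
  exact isReduced_of_isReduced_stalk _

instance : IsIntegral (projSpace k d) := isIntegral_of_irreducibleSpace_of_isReduced _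

instance (f : MvPolynomial (Fin (d + 1)) k) [Fact (f ≠ 0)] : Nonempty (projBasicOpen k d f) :=
  ⟨⟨(projGenericPoint k d : projSpace k d), fun h => (Fact.out : f ≠ 0) ((Submodule.mem_bot _).1 h)⟩⟩

instance (l : Fin (d + 1)) : Fact ((MvPolynomial.X l : MvPolynomial (Fin (d + 1)) k) ≠ 0) :=
  ⟨MvPolynomial.X_ne_zero l⟩

open HomogeneousLocalization in
theorem basicOpen_ι_toSpecZero (f : MvPolynomial (Fin (d + 1)) k) {m : ℕ} (hf : f ∈ 𝒜 m)
    (hm : 0 < m) : (Proj.basicOpen 𝒜 f).ι ≫ Proj.toSpecZero 𝒜 =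
      Proj.basicOpenToSpec 𝒜 f ≫ Spec.map (CommRingCat.ofHom (fromZeroRingHom 𝒜 _)) := by
  rw [← Proj.awayι_toSpecZero 𝒜 f hf hm, Proj.awayι, ← Proj.basicOpenIsoSpec_hom 𝒜 f hf hm,
    Category.assoc, Iso.hom_inv_id_assoc]

open HomogeneousLocalization in
theorem schRes_projConst (f : MvPolynomial (Fin (d + 1)) k) {m : ℕ} (hf : f ∈ 𝒜 m)
    (hm : 0 < m) (c : k) : schRes (X := projSpace k d) (le_top : projBasicOpen k d f ≤ ⊤)
      (projConst k d c) =
        (Proj.awayToSection 𝒜 f).hom (fromZeroRingHom 𝒜 _ (algebraMap k (𝒜 0) c)) := by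
  have h1 := congrArg (fun φ => (Scheme.ΓSpecIso (.of <| 𝒜 0)).inv ≫ Scheme.Hom.appTop φ ≫
    (Proj.basicOpen 𝒜 f).topIso.hom) (basicOpen_ι_toSpecZero k d f hf hm)
  simp only [Scheme.Hom.comp_appTop] at h1
  have h2 : (Proj.basicOpenToSpec 𝒜 f).appTop = _ := Proj.basicOpenToSpec_app_top 𝒜 f
  rw [h2] at h1
  have h3 : (Proj.basicOpen 𝒜 f).ι.appTop ≫ (Proj.basicOpen 𝒜 f).topIso.hom =
      (Proj 𝒜).presheaf.map (homOfLE (le_top : Proj.basicOpen 𝒜 f ≤ ⊤)).op := by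
    rw [Scheme.Opens.ι_appTop, Scheme.Opens.topIso_hom]
    exact ((Proj 𝒜).presheaf.map_comp _ _).symm
  rw [Category.assoc, h3] at h1
  simp only [Category.assoc, Iso.inv_hom_id, Category.comp_id] at h1
  rw [← Scheme.ΓSpecIso_inv_naturality_assoc, Iso.inv_hom_id_assoc] at h1
  exact congrArg (fun φ => φ.hom (algebraMap k (𝒜 0) c)) h1

open HomogeneousLocalization in
/-- The isomorphism `k[t_i : i ≠ l] → k[z]_{(z_l)}`, `t_i ↦ z_i / z_l`. -/
def awayChart (l : Fin (d + 1)) : MvPolynomial {i : Fin (d + 1) // i ≠ l} k →+*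
    Away 𝒜 (MvPolynomial.X l) :=
  MvPolynomial.eval₂Hom ((fromZeroRingHom 𝒜 _).comp (algebraMap k (𝒜 0))) fun i =>
    Away.mk 𝒜 (X_mem_homogeneousSubmodule k d l) 1 (MvPolynomial.X i.1)
      ((one_smul ℕ 1).symm ▸ X_mem_homogeneousSubmodule k d i.1)

open HomogeneousLocalization in
theorem awayChart_C (l : Fin (d + 1)) (c : k) :
    awayChart k d l (MvPolynomial.C c) = fromZeroRingHom 𝒜 _ (algebraMap k (𝒜 0) c) := by
  rw [awayChart, MvPolynomial.coe_eval₂Hom, MvPolynomial.eval₂_C]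
  rfl

open HomogeneousLocalization in
theorem awayChart_X (l : Fin (d + 1)) (i : {i : Fin (d + 1) // i ≠ l}) :
    awayChart k d l (MvPolynomial.X i) =
      Away.mk 𝒜 (X_mem_homogeneousSubmodule k d l) 1 (MvPolynomial.X i.1)
        ((one_smul ℕ 1).symm ▸ X_mem_homogeneousSubmodule k d i.1) := by
  rw [awayChart, MvPolynomial.coe_eval₂Hom, MvPolynomial.eval₂_X]

open HomogeneousLocalization in
theorem projChart_eq (l : Fin (d + 1)) (f : MvPolynomial {i : Fin (d + 1) // i ≠ l} k) :
    projChart k d l f = (Proj.awayToSection 𝒜 (MvPolynomial.X l)).hom (awayChart k d l f) := by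
  have h : projChart k d l =
      (Proj.awayToSection 𝒜 (MvPolynomial.X l)).hom.comp (awayChart k d l) := by
    refine MvPolynomial.ringHom_ext (fun c => ?_) fun i => ?_
    · exact (MvPolynomial.eval₂_C _ _ c).trans
        ((schRes_projConst k d _ (X_mem_homogeneousSubmodule k d l) one_pos c).trans
          (congrArg (Proj.awayToSection 𝒜 (MvPolynomial.X l)).hom
            (awayChart_C k d l c).symm))
    · exact (MvPolynomial.eval₂_X _ _ i).trans
          (congrArg (Proj.awayToSection 𝒜 (MvPolynomial.X l)).hom
            (awayChart_X k d l i).symm)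
  rw [h]
  rfl

open HomogeneousLocalization in
theorem awayChart_X_val (l : Fin (d + 1)) (i : {i : Fin (d + 1) // i ≠ l}) :
    (awayChart k d l (MvPolynomial.X i)).val =
      Localization.mk (MvPolynomial.X i.1) ⟨MvPolynomial.X l ^ 1, (Submonoid.mem_powers_iff _ _).2 ⟨1, rfl⟩⟩ := by
  rw [awayChart, MvPolynomial.coe_eval₂Hom, MvPolynomial.eval₂_X, Away.val_mk]

open HomogeneousLocalization in
theorem awayChart_C_val (l : Fin (d + 1)) (c : k) :
    (awayChart k d l (MvPolynomial.C c)).val =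
      algebraMap (MvPolynomial (Fin (d + 1)) k) (Localization.Away (MvPolynomial.X l : MvPolynomial (Fin (d + 1)) k))
        (MvPolynomial.C c) := by
  rw [awayChart, MvPolynomial.coe_eval₂Hom, MvPolynomial.eval₂_C]
  rfl

/-- Setting `z_l = 1`. -/
def dehomogenize (l : Fin (d + 1)) : MvPolynomial (Fin (d + 1)) k →ₐ[k]
    MvPolynomial {i : Fin (d + 1) // i ≠ l} k :=
  MvPolynomial.aeval fun i => if h : i ≠ l then MvPolynomial.X ⟨i, h⟩ else 1

theorem dehomogenize_X_self (l : Fin (d + 1)) :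
    dehomogenize k d l (MvPolynomial.X l) = 1 := by
  rw [dehomogenize, MvPolynomial.aeval_X, dif_neg (not_not.2 rfl)]

theorem dehomogenize_X (l : Fin (d + 1)) (i : {i : Fin (d + 1) // i ≠ l}) :
    dehomogenize k d l (MvPolynomial.X i.1) = MvPolynomial.X i := by
  rw [dehomogenize, MvPolynomial.aeval_X, dif_pos i.2]

theorem exists_lift_dehomogenize (l : Fin (d + 1)) :
    ∃ r : Localization.Away (MvPolynomial.X l : MvPolynomial (Fin (d + 1)) k) →+*
      MvPolynomial {i : Fin (d + 1) // i ≠ l} k,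
      ∀ x, r (algebraMap (MvPolynomial (Fin (d + 1)) k)
        (Localization.Away (MvPolynomial.X l : MvPolynomial (Fin (d + 1)) k)) x) =
          dehomogenize k d l x := by
  have h : IsUnit ((dehomogenize k d l).toRingHom (MvPolynomial.X l)) := by
    change IsUnit (dehomogenize k d l (MvPolynomial.X l))
    rw [dehomogenize_X_self]
    exact isUnit_one
  exact ⟨IsLocalization.Away.lift (MvPolynomial.X l) h, fun x => IsLocalization.Away.lift_eq _ h x⟩

theorem mk_X_mul_algebraMap_X (l : Fin (d + 1)) (x : MvPolynomial (Fin (d + 1)) k) :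
    Localization.mk x (⟨MvPolynomial.X l ^ 1, (Submonoid.mem_powers_iff _ _).2 ⟨1, rfl⟩⟩ :
        Submonoid.powers (MvPolynomial.X l)) *
      algebraMap (MvPolynomial (Fin (d + 1)) k)
        (Localization.Away (MvPolynomial.X l : MvPolynomial (Fin (d + 1)) k)) (MvPolynomial.X l) =
      algebraMap (MvPolynomial (Fin (d + 1)) k)
        (Localization.Away (MvPolynomial.X l : MvPolynomial (Fin (d + 1)) k)) x := by
  rw [← Localization.mk_one_eq_algebraMap, ← Localization.mk_one_eq_algebraMap,
    Localization.mk_mul, Localization.mk_eq_mk_iff, Localization.r_iff_exists]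
  exact ⟨1, by simp [mul_comm]⟩

open HomogeneousLocalization in
theorem awayChart_injective (l : Fin (d + 1)) : Function.Injective (awayChart k d l) := by
  obtain ⟨r, hr⟩ := exists_lift_dehomogenize k d l
  have h : (r.comp (algebraMap (Away 𝒜 (MvPolynomial.X l)) (Localization.Away
      (MvPolynomial.X l : MvPolynomial (Fin (d + 1)) k)))).comp (awayChart k d l) =
      RingHom.id _ := by
    refine MvPolynomial.ringHom_ext (fun c => ?_) fun i => ?_
    · change r (awayChart k d l _).val = _
      rw [awayChart_C_val, hr]
      exact MvPolynomial.aeval_C _ c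
    · change r (awayChart k d l _).val = _
      rw [awayChart_X_val]
      have h2 := congrArg r (mk_X_mul_algebraMap_X k d l (MvPolynomial.X i.1))
      rw [map_mul, hr, hr, dehomogenize_X_self, dehomogenize_X, mul_one] at h2
      exact h2
  exact Function.LeftInverse.injective (g := fun x => r x.val) fun x =>
    DFunLike.congr_fun h x

open HomogeneousLocalization in
theorem awayChart_dehomogenize_val (l : Fin (d + 1)) (f : MvPolynomial (Fin (d + 1)) k) :
    ∀ t, f.IsHomogeneous t → (awayChart k d l (dehomogenize k d l f)).val *
      algebraMap (MvPolynomial (Fin (d + 1)) k) (Localization.Away (MvPolynomial.X l : MvPolynomial (Fin (d + 1)) k))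
        (MvPolynomial.X l) ^ t = algebraMap _ _ f := by
  intro t hf
  set L := Localization.Away (MvPolynomial.X l : MvPolynomial (Fin (d + 1)) k)
  let ψ : MvPolynomial (Fin (d + 1)) k →+* L :=
    (algebraMap (Away 𝒜 (MvPolynomial.X l)) L).comp
      ((awayChart k d l).comp (dehomogenize k d l).toRingHom)
  have hC (c : k) : ψ (MvPolynomial.C c) = algebraMap (MvPolynomial (Fin (d + 1)) k) L (MvPolynomial.C c) := by
    change (awayChart k d l (dehomogenize k d l (MvPolynomial.C c))).val = _
    rw [← awayChart_C_val]
    congr 2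
    exact MvPolynomial.aeval_C _ c
  have hX (i : Fin (d + 1)) : ψ (MvPolynomial.X i) * algebraMap (MvPolynomial (Fin (d + 1)) k) L (MvPolynomial.X l) =
      algebraMap (MvPolynomial (Fin (d + 1)) k) L (MvPolynomial.X i) := by
    change (awayChart k d l (dehomogenize k d l (MvPolynomial.X i))).val * _ = _
    by_cases hi : i ≠ l
    · rw [dehomogenize_X k d l ⟨i, hi⟩, awayChart_X_val, ← Localization.mk_one_eq_algebraMap,
        ← Localization.mk_one_eq_algebraMap,
        Localization.mk_mul, Localization.mk_eq_mk_iff, Localization.r_iff_exists]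
      exact ⟨1, by simp [mul_comm]⟩
    · obtain rfl : i = l := not_not.1 hi
      rw [dehomogenize_X_self, map_one, val_one, one_mul]
  change ψ f * algebraMap (MvPolynomial (Fin (d + 1)) k) L (MvPolynomial.X l) ^ t = _
  have hf' := f.support_sum_monomial_coeff
  rw [← hf', map_sum, map_sum, Finset.sum_mul]
  refine Finset.sum_congr rfl fun e he => ?_
  have het : ∑ i, e i = t := by
    have h1 := hf (MvPolynomial.mem_support_iff.1 he)
    rw [Finsupp.weight_apply, Finsupp.sum_fintype _ _ (by simp)] at h1
    simpa using h1
  rw [MvPolynomial.monomial_eq, map_mul, map_mul, hC, mul_assoc, Finsupp.prod_fintype _ _ (by simp),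
    map_prod, map_prod, ← het, ← Finset.prod_pow_eq_pow_sum, ← Finset.prod_mul_distrib]
  congr 1
  refine Finset.prod_congr rfl fun i _ => ?_
  rw [map_pow, map_pow, ← mul_pow, hX]

open HomogeneousLocalization in
theorem awayChart_surjective (l : Fin (d + 1)) : Function.Surjective (awayChart k d l) := by
  intro y
  obtain ⟨t, f, hf, rfl⟩ := Away.mk_surjective 𝒜 (X_mem_homogeneousSubmodule k d l) y
  refine ⟨dehomogenize k d l f, val_injective _ ?_⟩
  have h1 := awayChart_dehomogenize_val k d l f _ hf
  rw [Away.val_mk, Localization.mk_eq_mk', IsLocalization.eq_mk'_iff_mul_eq, ← h1, smul_eq_mul,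
    mul_one, map_pow]

theorem projChart_bijective (l : Fin (d + 1)) : Function.Bijective (projChart k d l) := by
  have h : ⇑(projChart k d l) = (Proj.awayToSection 𝒜 (MvPolynomial.X l)).hom ∘ awayChart k d l :=
    funext fun f => projChart_eq k d l f
  rw [h]
  have e := (Proj.basicOpenIsoAway 𝒜 (MvPolynomial.X l) (X_mem_homogeneousSubmodule k d l)
    one_pos).commRingCatIsoToRingEquiv.bijective
  exact Function.Bijective.comp e ⟨awayChart_injective k d l, awayChart_surjective k d l⟩

open HomogeneousLocalization in
theorem awayMap_mk_mul (l i a : Fin (d + 1)) :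
    awayMap 𝒜 (X_mem_homogeneousSubmodule k d a)
        (rfl : MvPolynomial.X l * MvPolynomial.X a = _)
        (Away.mk 𝒜 (X_mem_homogeneousSubmodule k d l) 1
          (MvPolynomial.X i) ((one_smul ℕ 1).symm ▸ X_mem_homogeneousSubmodule k d i)) *
      awayMap 𝒜 (X_mem_homogeneousSubmodule k d l)
        (mul_comm (MvPolynomial.X l) (MvPolynomial.X a))
        (Away.mk 𝒜 (X_mem_homogeneousSubmodule k d a) 1
          (MvPolynomial.X l) ((one_smul ℕ 1).symm ▸ X_mem_homogeneousSubmodule k d l)) =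
      awayMap 𝒜 (X_mem_homogeneousSubmodule k d l)
        (mul_comm (MvPolynomial.X l) (MvPolynomial.X a))
        (Away.mk 𝒜 (X_mem_homogeneousSubmodule k d a) 1
          (MvPolynomial.X i) ((one_smul ℕ 1).symm ▸ X_mem_homogeneousSubmodule k d i)) := by
  refine val_injective _ ?_
  rw [val_mul, awayMap_mk, awayMap_mk, awayMap_mk, Away.val_mk, Away.val_mk, Away.val_mk,
    Localization.mk_mul, Localization.mk_eq_mk_iff, Localization.r_iff_exists]
  refine ⟨1, ?_⟩
  simp only [OneMemClass.coe_one, one_mul, Submonoid.coe_mul, pow_one]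
  ring

open HomogeneousLocalization in
theorem schRes_awayToSection (f g x : MvPolynomial (Fin (d + 1)) k) {m : ℕ} (hg : g ∈ 𝒜 m)
    (hx : x = f * g) (h : Proj.basicOpen 𝒜 x ≤ Proj.basicOpen 𝒜 f) (y : Away 𝒜 f) :
    schRes (X := projSpace k d) h ((Proj.awayToSection 𝒜 f).hom y) =
      (Proj.awayToSection 𝒜 x).hom (awayMap 𝒜 hg hx y) :=
  (congrArg (fun φ => φ.hom y) (Proj.awayMap_awayToSection 𝒜 hg hx)).symm

theorem schRes_projCoord_mul (l i a : Fin (d + 1))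
    (hl : projBasicOpen k d (MvPolynomial.X l * MvPolynomial.X a) ≤
      projBasicOpen k d (MvPolynomial.X l))
    (ha : projBasicOpen k d (MvPolynomial.X l * MvPolynomial.X a) ≤
      projBasicOpen k d (MvPolynomial.X a)) :
    schRes hl (projCoord k d l i) * schRes ha (projCoord k d a l) =
      schRes ha (projCoord k d a i) := by
  have h1 := schRes_awayToSection k d (MvPolynomial.X l) (MvPolynomial.X a) _
    (X_mem_homogeneousSubmodule k d a) rfl hl
  have h2 := schRes_awayToSection k d (MvPolynomial.X a) (MvPolynomial.X l) _
    (X_mem_homogeneousSubmodule k d l) (mul_comm (MvPolynomial.X l) (MvPolynomial.X a)) ha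
  unfold projCoord
  erw [h1, h2, h2, ← map_mul, awayMap_mk_mul]
  rfl

end ProjIntegral

section IntegralSchemes
variable {X : Scheme.{u}} [IsIntegral X]

theorem genericPoint_mem {U : X.Opens} {x : X} (hx : x ∈ U) : genericPoint X ∈ U :=
  ((genericPoint_spec X).mem_open_set_iff U.isOpen).2 ⟨x, trivial, hx⟩

/-- The inclusion of the functions on a nonempty open subset into the function field. -/
def funRes {U : X.Opens} (hU : genericPoint X ∈ U) : Γ(X, U) →+* X.functionField :=
  (X.presheaf.germ U (genericPoint X) hU).hom

theorem funRes_injective {U : X.Opens} (hU : genericPoint X ∈ U) :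
    Function.Injective (funRes hU) := germ_injective_of_isIntegral _ _ _

theorem funRes_schRes {U V : X.Opens} (h : V ≤ U) (hU : genericPoint X ∈ U)
    (hV : genericPoint X ∈ V) (s : Γ(X, U)) : funRes hV (schRes h s) = funRes hU s :=
  X.presheaf.germ_res_apply (homOfLE h) (genericPoint X) hV s

theorem subsingleton_sections {U : X.Opens} (hU : genericPoint X ∉ U) :
    Subsingleton Γ(X, U) := by
  obtain rfl : U = ⊥ := by
    refine le_bot_iff.1 fun x hx => (hU (genericPoint_mem hx)).elim
  infer_instance

theorem exists_funRes_eq {U : X.Opens} (hU : genericPoint X ∈ U) (z : X.functionField)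
    (h : ∀ x ∈ U, ∃ V ≤ U, x ∈ V ∧ ∃ (hV : genericPoint X ∈ V) (s : Γ(X, V)), funRes hV s = z) :
    ∃ s, funRes hU s = z := by
  choose V hVU hxV hV s hs using fun x : U => h x.1 x.2
  obtain ⟨t, ht, -⟩ := X.sheaf.existsUnique_gluing' V U (fun x => homOfLE (hVU x))
    (fun x hx => Opens.mem_iSup.2 ⟨⟨x, hx⟩, hxV _⟩) s (fun x y => by
      have hxy : genericPoint X ∈ V x ⊓ V y := ⟨hV x, hV y⟩
      refine funRes_injective hxy ?_
      exact (funRes_schRes inf_le_left (hV x) hxy (s x)).trans (((hs x).trans (hs y).symm).trans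
        (funRes_schRes inf_le_right (hV y) hxy (s y)).symm))
  refine ⟨t, ?_⟩
  have h1 := funRes_schRes (hVU ⟨_, hU⟩) hU (hV ⟨_, hU⟩) t
  have h2 : schRes (hVU ⟨_, hU⟩) t = s ⟨_, hU⟩ := ht ⟨_, hU⟩
  rw [← h1, h2, hs]

variable (p : ℕ) [Fact p.Prime] (n : ℕ)

/-- Operators on the Witt vectors of the function field which preserve the sections over all open
subsets come from endomorphisms of the sheaf `W_n O`. -/
theorem exists_wittOp_eq (θ : AddMonoid.End (TruncatedWittVector p n X.functionField))
    (h : ∀ (U : X.Opens) (hU : genericPoint X ∈ U) (x : TruncatedWittVector p n Γ(X, U)),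
      ∃ y, TruncatedWittVector.mapHom p n (funRes hU) y =
        θ (TruncatedWittVector.mapHom p n (funRes hU) x)) :
    ∃ Θ : End (wittSheaf p n X), ∀ (U : X.Opens) (hU : genericPoint X ∈ U)
      (x : TruncatedWittVector p n Γ(X, U)),
      TruncatedWittVector.mapHom p n (funRes hU) (wittOp p n Θ U x) =
        θ (TruncatedWittVector.mapHom p n (funRes hU) x) := by
  have key (U : X.Opens) : ∃ P : AddMonoid.End (TruncatedWittVector p n Γ(X, U)),
      ∀ (hU : genericPoint X ∈ U) x, TruncatedWittVector.mapHom p n (funRes hU) (P x) =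
        θ (TruncatedWittVector.mapHom p n (funRes hU) x) := by
    by_cases hU : genericPoint X ∈ U
    · choose f hf using h U hU
      have hinj := TruncatedWittVector.mapHom_injective p n (funRes_injective hU)
      refine ⟨⟨⟨f, hinj ?_⟩, fun x y => hinj ?_⟩, fun _ x => hf x⟩
      · rw [hf, map_zero, map_zero]
      · change TruncatedWittVector.mapHom p n (funRes hU) (f (x + y)) =
          TruncatedWittVector.mapHom p n (funRes hU) (f x + f y)
        rw [map_add (TruncatedWittVector.mapHom p n (funRes hU)), hf, hf, hf,
          map_add (TruncatedWittVector.mapHom p n (funRes hU)), map_add]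
    · exact ⟨0, fun hU' => (hU hU').elim⟩
  choose P hP using key
  refine ⟨⟨{
    app := fun U => AddCommGrpCat.ofHom (P U.unop)
    naturality := fun U V i => ConcreteCategory.hom_ext _ _
      fun x : TruncatedWittVector p n Γ(X, U.unop) => ?_ }⟩, fun U hU x => hP U hU x⟩
  change P V.unop (TruncatedWittVector.mapHom p n (schRes i.unop.le) x) =
    TruncatedWittVector.mapHom p n (schRes i.unop.le) (P U.unop x)
  by_cases hV : genericPoint X ∈ V.unop
  · have hU : genericPoint X ∈ U.unop := i.unop.le hV
    have hres (y) : TruncatedWittVector.mapHom p n (funRes hV)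
        (TruncatedWittVector.mapHom p n (schRes i.unop.le) y) =
          TruncatedWittVector.mapHom p n (funRes hU) y := by
      rw [← TruncatedWittVector.mapHom_comp]
      congr 2
      exact RingHom.ext fun s => funRes_schRes _ hU hV s
    refine TruncatedWittVector.mapHom_injective p n (funRes_injective hV) ?_
    rw [hP, hres, hres, hP]
  · have := subsingleton_sections hV
    exact TruncatedWittVector.ext fun i => Subsingleton.elim _ _

theorem wittOp_mem_groDiffOps {Θ : End (wittSheaf p n X)}
    {θ : AddMonoid.End (TruncatedWittVector p n X.functionField)} (hθ : θ ∈ groDiffOps _)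
    (U : X.Opens) (h : ∀ (hU : genericPoint X ∈ U) (x : TruncatedWittVector p n Γ(X, U)),
      TruncatedWittVector.mapHom p n (funRes hU) (wittOp p n Θ U x) =
        θ (TruncatedWittVector.mapHom p n (funRes hU) x)) :
    wittOp p n Θ U ∈ groDiffOps _ := by
  by_cases hU : genericPoint X ∈ U
  · obtain ⟨m, hm⟩ := hθ
    exact ⟨m, IsDiffOpOfOrder.restrict
      (TruncatedWittVector.mapHom_injective p n (funRes_injective hU)) (h hU) hm⟩
  · have := subsingleton_sections hU
    exact ⟨0, fun b => AddMonoidHom.ext fun x =>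
      TruncatedWittVector.ext fun i => Subsingleton.elim _ _⟩

end IntegralSchemes

section ChartHom
variable {k K : Type*} [Field k] [Field K] [Algebra k K] {d : ℕ} (u : Fin (d + 1) → K)

theorem chartHom_C (l : Fin (d + 1)) (c : k) :
    chartHom k u l (MvPolynomial.C c) = algebraMap k K c := MvPolynomial.aeval_C _ c

theorem chartHom_X (l : Fin (d + 1)) (i : {i : Fin (d + 1) // i ≠ l}) :
    chartHom k u l (MvPolynomial.X i) = u i / u l := MvPolynomial.aeval_X _ i

end ChartHom

section ProjFunctionField

attribute [local instance] MvPolynomial.gradedAlgebra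

variable (k : Type u) [Field k] (d : ℕ)

/-- The function field of `P^d`. -/
def projField : Type u := (projSpace k d).functionField

instance : Field (projField k d) := inferInstanceAs (Field (projSpace k d).functionField)

variable {k d} in
/-- The inclusion of the functions on a nonempty open subset of `P^d` into the function field. -/
def projRes {U : (projSpace k d).Opens} (hU : genericPoint (projSpace k d) ∈ U) :
    Γ(projSpace k d, U) →+* projField k d := funRes hU

instance : Algebra k (projField k d) :=
  ((projRes (U := ⊤) trivial).comp (projConst k d)).toAlgebra

theorem genericPoint_mem_projBasicOpen {f : MvPolynomial (Fin (d + 1)) k} (hf : f ≠ 0) :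
    genericPoint (projSpace k d) ∈ projBasicOpen k d f :=
  genericPoint_mem (x := (projGenericPoint k d : projSpace k d))
    fun h => hf ((Submodule.mem_bot _).1 h)

theorem genericPoint_mem_projBasicOpen_X (l : Fin (d + 1)) :
    genericPoint (projSpace k d) ∈ projBasicOpen k d (MvPolynomial.X l) :=
  genericPoint_mem_projBasicOpen k d (MvPolynomial.X_ne_zero l)

/-- The rational function `z_i / z_0`. -/
def projFun (i : Fin (d + 1)) : projField k d :=
  projRes (genericPoint_mem_projBasicOpen_X k d 0) (projCoord k d 0 i)

theorem projRes_projConst {U : (projSpace k d).Opens} (hU : genericPoint (projSpace k d) ∈ U)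
    (c : k) : projRes hU (schRes le_top (projConst k d c)) = algebraMap k (projField k d) c :=
  funRes_schRes le_top trivial hU _

theorem projRes_projCoord_mul (l i a : Fin (d + 1)) :
    projRes (genericPoint_mem_projBasicOpen_X k d l) (projCoord k d l i) *
      projRes (genericPoint_mem_projBasicOpen_X k d a) (projCoord k d a l) =
        projRes (genericPoint_mem_projBasicOpen_X k d a) (projCoord k d a i) := by
  have hl : projBasicOpen k d (MvPolynomial.X l * MvPolynomial.X a) ≤
      projBasicOpen k d (MvPolynomial.X l) := by
    unfold projBasicOpen
    rw [Proj.basicOpen_mul]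
    exact inf_le_left
  have ha : projBasicOpen k d (MvPolynomial.X l * MvPolynomial.X a) ≤
      projBasicOpen k d (MvPolynomial.X a) := by
    unfold projBasicOpen
    rw [Proj.basicOpen_mul]
    exact inf_le_right
  have hg := genericPoint_mem_projBasicOpen k d
    (mul_ne_zero (MvPolynomial.X_ne_zero (R := k) l) (MvPolynomial.X_ne_zero a))
  have h := congrArg (projRes hg) (schRes_projCoord_mul k d l i a hl ha)
  rw [map_mul] at h
  exact (congrArg₂ (· * ·) (funRes_schRes hl _ hg _) (funRes_schRes ha _ hg _)).symm.trans
    (h.trans (funRes_schRes ha _ hg _))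

open HomogeneousLocalization in
theorem awayMk_self (l : Fin (d + 1)) :
    Away.mk (MvPolynomial.homogeneousSubmodule (Fin (d + 1)) k)
      (X_mem_homogeneousSubmodule k d l) 1 (MvPolynomial.X l)
      ((one_smul ℕ 1).symm ▸ X_mem_homogeneousSubmodule k d l) = 1 := by
  refine val_injective _ ?_
  rw [Away.val_mk, val_one, ← Localization.mk_one, Localization.mk_eq_mk_iff,
    Localization.r_iff_exists]
  exact ⟨1, by simp⟩

theorem projCoord_self (l : Fin (d + 1)) : projCoord k d l l = 1 :=
  (congrArg _ (awayMk_self k d l)).trans (map_one (Proj.awayToSection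
    (MvPolynomial.homogeneousSubmodule (Fin (d + 1)) k) (MvPolynomial.X l)).hom)

theorem projChart_C (l : Fin (d + 1)) (c : k) :
    projChart k d l (MvPolynomial.C c) = schRes le_top (projConst k d c) := by
  rw [projChart, MvPolynomial.coe_eval₂Hom, MvPolynomial.eval₂_C]
  rfl

theorem projChart_X (l : Fin (d + 1)) (i : {i : Fin (d + 1) // i ≠ l}) :
    projChart k d l (MvPolynomial.X i) = projCoord k d l i.1 := by
  rw [projChart, MvPolynomial.coe_eval₂Hom, MvPolynomial.eval₂_X]

theorem projFun_ne_zero (i : Fin (d + 1)) : projFun k d i ≠ 0 := by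
  have h := projRes_projCoord_mul k d 0 i i
  rw [projCoord_self, map_one] at h
  exact left_ne_zero_of_mul_eq_one h

theorem projRes_projCoord (l i : Fin (d + 1)) :
    projRes (genericPoint_mem_projBasicOpen_X k d l) (projCoord k d l i) =
      projFun k d i / projFun k d l :=
  eq_div_of_mul_eq (projFun_ne_zero k d l) (projRes_projCoord_mul k d l i 0)

theorem chartHom_projFun (l : Fin (d + 1)) (f : MvPolynomial {i : Fin (d + 1) // i ≠ l} k) :
    chartHom k (projFun k d) l f =
      projRes (genericPoint_mem_projBasicOpen_X k d l) (projChart k d l f) := by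
  have h : chartHom k (projFun k d) l =
      (projRes (genericPoint_mem_projBasicOpen_X k d l)).comp (projChart k d l) := by
    refine MvPolynomial.ringHom_ext (fun c => ?_) fun i => ?_
    · refine (chartHom_C _ l c).trans ((projRes_projConst k d
        (genericPoint_mem_projBasicOpen_X k d l) c).symm.trans (congrArg _ ?_))
      exact (projChart_C k d l c).symm
    · refine (chartHom_X _ l i).trans ((projRes_projCoord k d l i.1).symm.trans
        (congrArg _ ?_))
      exact (projChart_X k d l i).symm
  rw [h]
  rfl

theorem isAffineOpen_projBasicOpen {f : MvPolynomial (Fin (d + 1)) k} {m : ℕ} (hm : 0 < m)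
    (hf : f ∈ MvPolynomial.homogeneousSubmodule (Fin (d + 1)) k m) :
    IsAffineOpen (projBasicOpen k d f) := Proj.isAffineOpen_basicOpen _ f hf hm

theorem isAffineOpen_projBasicOpen_X (l : Fin (d + 1)) :
    IsAffineOpen (projBasicOpen k d (MvPolynomial.X l)) :=
  isAffineOpen_projBasicOpen k d one_pos (X_mem_homogeneousSubmodule k d l)

/-- The charts of `P^d`. -/
def projCharts : ProjCharts k (projField k d) d where
  u := projFun k d
  u_ne_zero := projFun_ne_zero k d
  injective l := by
    have h : ⇑(chartHom k (projFun k d) l) =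
        projRes (genericPoint_mem_projBasicOpen_X k d l) ∘ projChart k d l :=
      funext (chartHom_projFun k d l)
    rw [h]
    exact (funRes_injective _).comp (projChart_bijective k d l).1
  frac l z := by
    have hfr := functionField_isFractionRing_of_isAffineOpen (X := projSpace k d) _
      (isAffineOpen_projBasicOpen_X k d l)
    obtain ⟨⟨a, b⟩, hab⟩ := IsLocalization.surj
      (nonZeroDivisors Γ(projSpace k d, projBasicOpen k d (MvPolynomial.X l)))
      (S := (projSpace k d).functionField) (z : (projSpace k d).functionField)
    obtain ⟨f, hf⟩ := (projChart_bijective k d l).2 b.1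
    obtain ⟨g, hg⟩ := (projChart_bijective k d l).2 a
    refine ⟨f, ?_, g, ?_⟩
    · rintro rfl
      rw [map_zero] at hf
      exact nonZeroDivisors.ne_zero b.2 hf.symm
    · rw [chartHom_projFun, chartHom_projFun, hf, hg, mul_comm]
      exact hab

theorem projRes_projChart (l : Fin (d + 1)) (f : MvPolynomial {i : Fin (d + 1) // i ≠ l} k) :
    projRes (genericPoint_mem_projBasicOpen_X k d l) (projChart k d l f) =
      (projCharts k d).chart l f := (chartHom_projFun k d l f).symm

instance (p : ℕ) [CharP k p] : CharP (projField k d) p :=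
  charP_of_injective_algebraMap (algebraMap k (projField k d)).injective p

end ProjFunctionField

section LocalFractions
variable {X : Scheme.{u}}

theorem AlgebraicGeometry.IsAffineOpen.exists_pow_mul_eq {W : X.Opens} (hW : IsAffineOpen W)
    (f : Γ(X, W)) {ι : Type*} [Finite ι] (y : ι → Γ(X, X.basicOpen f)) :
    ∃ r : ℕ, ∀ i, ∃ g, schRes (X.basicOpen_le f) f ^ r * y i = schRes (X.basicOpen_le f) g := by
  have h := hW.isLocalization_basicOpen f
  obtain ⟨⟨_, r, rfl⟩, hb⟩ := IsLocalization.exist_integer_multiples_of_finite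
    (Submonoid.powers f) y
  refine ⟨r, fun i => ?_⟩
  obtain ⟨g, hg⟩ := hb i
  refine ⟨g, ?_⟩
  rw [Algebra.smul_def] at hg
  refine Eq.trans ?_ hg.symm
  congr 1
  exact (map_pow (schRes (X.basicOpen_le f)) f r).symm

end LocalFractions

section GlobalTheta

attribute [local instance] MvPolynomial.gradedAlgebra

variable (k : Type u) [Field k] (d : ℕ) (p : ℕ) [Fact p.Prime] (n : ℕ)

theorem exists_mem_projBasicOpen_X (x : projSpace k d) :
    ∃ l : Fin (d + 1), x ∈ projBasicOpen k d (MvPolynomial.X l) := by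
  by_contra! h
  refine x.not_irrelevant_le fun f hf => ?_
  have h0 : (DirectSum.decompose (MvPolynomial.homogeneousSubmodule (Fin (d + 1)) k) f 0 :
      MvPolynomial (Fin (d + 1)) k) = MvPolynomial.homogeneousComponent 0 f :=
    MvPolynomial.decomposition.decompose'_apply f 0
  rw [HomogeneousIdeal.mem_irrelevant_iff, GradedRing.proj_apply, h0,
    MvPolynomial.homogeneousComponent_zero, MvPolynomial.C_eq_zero] at hf
  have h1 : f ∈ Ideal.span (MvPolynomial.X '' Set.univ) := by
    refine MvPolynomial.mem_ideal_span_X_image.2 fun m hm => ?_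
    by_contra! hm'
    obtain rfl : m = 0 := Finsupp.ext fun i => hm' i trivial
    exact MvPolynomial.mem_support_iff.1 hm hf
  refine (Ideal.span_le.2 ?_ : _ ≤ (ProjectiveSpectrum.asHomogeneousIdeal x).toIdeal) h1
  rintro _ ⟨l, -, rfl⟩
  exact not_not.1 (h l)

theorem exists_globalWittDiffOp [CharP k p] {θ : AddMonoid.End (TruncatedWittVector p n (projField k d))}
    (hθ : θ ∈ groDiffOps _)
    (hlin : ∀ c x, θ (TruncatedWittVector.mapHom p n (algebraMap k (projField k d)) c * x) =
      TruncatedWittVector.mapHom p n (algebraMap k (projField k d)) c * θ x)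
    (h : ∀ l, ∃ Q ∈ wittDiffOps p n k {i : Fin (d + 1) // i ≠ l}, ∀ x,
      θ (TruncatedWittVector.mapHom p n ((projCharts k d).chart l) x) =
        TruncatedWittVector.mapHom p n ((projCharts k d).chart l) (Q x)) :
    ∃ Θ ∈ globalWittDiffOps k d p n, ∀ (U : (projSpace k d).Opens)
      (hU : genericPoint (projSpace k d) ∈ U) (x : TruncatedWittVector p n Γ(projSpace k d, U)),
      TruncatedWittVector.mapHom p n (projRes hU) (wittOp p n Θ U x) =
        θ (TruncatedWittVector.mapHom p n (projRes hU) x) := by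
  have hpp : p.Prime := Fact.out
  have hstab (U : (projSpace k d).Opens) (hU : genericPoint (projSpace k d) ∈ U)
      (y : TruncatedWittVector p n Γ(projSpace k d, U)) :
      ∃ z, TruncatedWittVector.mapHom p n (projRes hU) z =
        θ (TruncatedWittVector.mapHom p n (projRes hU) y) := by
    suffices H : ∀ i, ∃ s, projRes hU s =
        (θ (TruncatedWittVector.mapHom p n (projRes hU) y)).coeff i by
      obtain ⟨z, hz⟩ := exists_eq_mapHom p n (projRes hU) _ fun i => (H i).imp fun _ h => h.symm
      exact ⟨z, hz.symm⟩
    intro i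
    refine exists_funRes_eq hU _ fun x hx => ?_
    obtain ⟨l, hl⟩ := exists_mem_projBasicOpen_X k d x
    have hW := isAffineOpen_projBasicOpen_X k d l
    obtain ⟨f, hfU, hxf⟩ := hW.exists_basicOpen_le ⟨x, hx⟩ hl
    have hV := genericPoint_mem hxf
    have hfW := (projSpace k d).basicOpen_le f
    have hWg := genericPoint_mem_projBasicOpen_X k d l
    refine ⟨_, hfU, hxf, hV, ?_⟩
    obtain ⟨o, ho⟩ := hθ
    obtain ⟨M, hM⟩ := ho.exists_apply_pow_mul hpp.ne_zero (truncatedWitt_p_pow_eq_zero p n)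
    obtain ⟨r, hr⟩ := hW.exists_pow_mul_eq f fun i => schRes hfU (y.coeff i)
    obtain ⟨F, hF⟩ := (projChart_bijective k d l).2 (f ^ r)
    have hFK : (projCharts k d).chart l F = projRes hV (schRes hfW f ^ r) := by
      rw [← projRes_projChart, hF, ← map_pow]
      exact (funRes_schRes hfW hWg hV _).symm
    have hfu : IsUnit (projRes hV (schRes hfW f ^ r)) :=
      ((isUnit_schRes hfW le_rfl).pow r).map (projRes hV)
    obtain ⟨x', hx'⟩ := exists_wittTeich_mul_eq_mapHom p n ((projCharts k d).chart l)
      (TruncatedWittVector.mapHom p n (projRes hU) y) F (fun i => by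
        obtain ⟨g, hg⟩ := hr i
        obtain ⟨G, hG⟩ := (projChart_bijective k d l).2 g
        refine ⟨G, ?_⟩
        rw [hFK, ← projRes_projChart, hG, TruncatedWittVector.coeff_mapHom]
        have h1 : projRes hU (y.coeff i) = projRes hV (schRes hfU (y.coeff i)) :=
          (funRes_schRes hfU hU hV _).symm
        rw [h1, ← map_mul, hg]
        exact funRes_schRes hfW hWg hV _) (pow_ne_zero M hpp.ne_zero)
    obtain ⟨Q, -, hQ⟩ := h l
    have h2 := hM (wittTeich p n ((projCharts k d).chart l F))
      (TruncatedWittVector.mapHom p n (projRes hU) y)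
    rw [← map_pow, hx', hQ] at h2
    obtain ⟨v, hv⟩ := (isUnit_schRes hfW le_rfl).pow r
    have h3 : wittTeich p n (projRes hV (↑v⁻¹ : Γ(projSpace k d, _)) ^ p ^ M) *
        wittTeich p n ((projCharts k d).chart l F ^ p ^ M) = 1 := by
      rw [← map_mul, hFK, ← hv, ← mul_pow, ← map_mul, Units.inv_mul, map_one, one_pow, map_one]
    have h4 : θ (TruncatedWittVector.mapHom p n (projRes hU) y) =
        wittTeich p n (projRes hV (↑v⁻¹ : Γ(projSpace k d, _)) ^ p ^ M) *
          TruncatedWittVector.mapHom p n ((projCharts k d).chart l) (Q x') := by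
      rw [h2, ← mul_assoc, h3, one_mul]
    rw [h4, coeff_wittTeich_mul, TruncatedWittVector.coeff_mapHom, ← projRes_projChart]
    refine ⟨((↑v⁻¹ : Γ(projSpace k d, _)) ^ p ^ M) ^ p ^ (i : ℕ) *
      schRes hfW (projChart k d l ((Q x').coeff i)), ?_⟩
    refine (map_mul (projRes hV) _ _).trans ?_
    rw [map_pow, map_pow]
    exact congrArg _ (funRes_schRes hfW hWg hV _)
  obtain ⟨Θ, hΘ⟩ := exists_wittOp_eq p n θ hstab
  refine ⟨Θ, ⟨fun c => ?_, fun U hU => wittOp_mem_groDiffOps p n hθ U fun hU => hΘ U hU,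
    fun l => ?_⟩, hΘ⟩
  · have key (U : (projSpace k d).Opens) : wittOp p n (Θ * projScalar k d p n c) U =
        wittOp p n (projScalar k d p n c * Θ) U := by
      by_cases hU : genericPoint (projSpace k d) ∈ U
      · refine AddMonoidHom.ext fun x => TruncatedWittVector.mapHom_injective p n
          (funRes_injective hU) ?_
        let a := TruncatedWittVector.mapHom p n (schRes (le_top : U ≤ ⊤))
          (TruncatedWittVector.mapHom p n (projConst k d) c)
        have ha : TruncatedWittVector.mapHom p n (projRes hU) a =
            TruncatedWittVector.mapHom p n (algebraMap k (projField k d)) c := by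
          rw [← TruncatedWittVector.mapHom_comp, ← TruncatedWittVector.mapHom_comp]
          congr 2
          exact RingHom.ext fun c => projRes_projConst k d hU c
        change TruncatedWittVector.mapHom p n (projRes hU) (wittOp p n Θ U (a * x)) =
          TruncatedWittVector.mapHom p n (projRes hU) (a * wittOp p n Θ U x)
        rw [map_mul (TruncatedWittVector.mapHom p n (projRes hU))]
        refine (hΘ U hU (a * x)).trans ?_
        refine Eq.trans ?_ (congrArg _ (hΘ U hU x).symm)
        refine (congrArg θ (map_mul (TruncatedWittVector.mapHom p n (projRes hU)) a x)).trans ?_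
        rw [ha]
        exact hlin _ _
      · have := subsingleton_sections hU
        exact AddMonoidHom.ext fun x => TruncatedWittVector.ext fun i => Subsingleton.elim _ _
    refine Sheaf.hom_ext (NatTrans.ext (funext fun U => ?_))
    exact AddCommGrpCat.hom_ext (key U.unop)
  · obtain ⟨Q, hQ, hQ'⟩ := h l
    refine ⟨Q, hQ, fun x => ?_⟩
    have hWg := genericPoint_mem_projBasicOpen_X k d l
    have hc (x) : TruncatedWittVector.mapHom p n (projRes hWg)
        (TruncatedWittVector.mapHom p n (projChart k d l) x) =
          TruncatedWittVector.mapHom p n ((projCharts k d).chart l) x := by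
      rw [← TruncatedWittVector.mapHom_comp]
      congr 2
      exact RingHom.ext fun f => projRes_projChart k d l f
    refine TruncatedWittVector.mapHom_injective p n (funRes_injective hWg) ?_
    refine (hΘ _ hWg _).trans ((congrArg θ (hc x)).trans ((hQ' x).trans (hc _).symm))

end GlobalTheta

section Generation
variable {k K : Type*} [Field k] [Field K] [Algebra k K] {d : ℕ} (D : ProjCharts k K d)
  (p : ℕ) [Fact p.Prime] (n : ℕ)

/-- The exponents of the Laurent monomials of degree `0` without poles along `z_a = 0` for
`a ≤ j`. -/
def laurentExps (d j : ℕ) : Set (Fin (d + 1) → ℤ) :=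
  {m | ∑ i, m i = 0 ∧ ∀ a : Fin (d + 1), (a : ℕ) ≤ j → 0 ≤ m a}

theorem exists_add_zsmul_eq (n : ℕ) {x : ℤ} (h : IsCoprime x p) :
    ∃ e : ℤ, e * x ≡ 1 [ZMOD (p : ℤ) ^ n] := by
  obtain ⟨e, f, hef⟩ := h.pow_right (n := n)
  exact ⟨e, Int.modEq_iff_dvd.2 ⟨f, by linarith⟩⟩

theorem exists_lt_of_sum_eq_zero {m : Fin (d + 1) → ℤ} (hm : ∑ i, m i = 0) {q : ℤ} (hq : 0 ≤ q)
    (a : Fin (d + 1)) (ha : (d + 1) * q < m a) : ∃ b, m b < -q := by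
  by_contra! h
  have h1 : ∑ i ∈ Finset.univ.erase a, -q ≤ ∑ i ∈ Finset.univ.erase a, m i :=
    Finset.sum_le_sum fun i _ => h i
  have h2 := Finset.add_sum_erase Finset.univ m (Finset.mem_univ a)
  rw [hm] at h2
  simp only [Finset.sum_const, Finset.card_erase_of_mem (Finset.mem_univ a), Finset.card_univ,
    Fintype.card_fin, nsmul_eq_mul] at h1
  push_cast at h1
  nlinarith

theorem exists_lt_and_lt {m : Fin (d + 1) → ℤ} (hm : ∑ i, m i = 0) {q : ℤ} (hq : 0 ≤ q)
    (h : ∃ i, (d + 1) * q < |m i|) : ∃ a b, q < m a ∧ m b < -q := by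
  obtain ⟨i, hi⟩ := h
  have hq' : q ≤ (d + 1) * q := by nlinarith [mul_nonneg (Nat.cast_nonneg (α := ℤ) d) hq]
  rcases lt_abs.1 hi with hi | hi
  · obtain ⟨b, hb⟩ := exists_lt_of_sum_eq_zero hm hq i hi
    exact ⟨i, b, hq'.trans_lt hi, hb⟩
  · obtain ⟨b, hb⟩ := exists_lt_of_sum_eq_zero (m := -m) (by simp [hm]) hq i hi
    refine ⟨b, i, ?_, by linarith⟩
    have : -m b < -q := hb
    linarith

theorem prod_zpow {ι : Type*} {a : K} (ha : a ≠ 0) (S : Finset ι) (m : ι → ℤ) :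
    ∏ i ∈ S, a ^ m i = a ^ ∑ i ∈ S, m i := by
  classical
  induction S using Finset.induction_on with
  | empty => simp
  | insert i S hi ih => rw [Finset.prod_insert hi, Finset.sum_insert hi, zpow_add₀ ha, ih]

namespace ProjCharts

theorem umon_zero : D.umon 0 = 1 := Finset.prod_eq_one fun i _ => zpow_zero _

theorem umon_sum {ι : Type*} (S : Finset ι) (m : ι → Fin (d + 1) → ℤ) :
    D.umon (∑ i ∈ S, m i) = ∏ i ∈ S, D.umon (m i) := by
  classical
  induction S using Finset.induction_on with
  | empty => simp [umon_zero]
  | insert i S hi ih => rw [Finset.prod_insert hi, Finset.sum_insert hi, umon_add, ih]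

theorem sum_homExp (l : Fin (d + 1)) (e : {i : Fin (d + 1) // i ≠ l} →₀ ℕ) :
    ∑ i, homExp l e i = 0 := by
  have h1 : homExp l e l = -∑ i, (e i : ℤ) := dif_neg (not_not.2 rfl)
  rw [← sum_ne_add l (homExp l e), h1, add_neg_eq_zero]
  exact Finset.sum_congr rfl fun i _ => dif_pos i.2

theorem umon_single_sub_single (a b : Fin (d + 1)) (t : ℤ) :
    D.umon (Pi.single a t - Pi.single b t) = (D.u a / D.u b) ^ t := by
  have h (a : Fin (d + 1)) (t : ℤ) : D.umon (Pi.single a t) = D.u a ^ t := by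
    rw [umon, Finset.prod_eq_single a, Pi.single_eq_same]
    · intro i _ hi
      rw [Pi.single_eq_of_ne hi, zpow_zero]
    · exact fun h => (h (Finset.mem_univ a)).elim
  have h1 : Pi.single a t - Pi.single b t =
      (Pi.single a t + Pi.single b (-t) : Fin (d + 1) → ℤ) := by
    rw [Pi.single_neg, sub_eq_add_neg]
  rw [h1, umon_add, h, h, div_zpow, zpow_neg, div_eq_mul_inv]

theorem wittMono_mem_of_isTheta [CharP K p] {C : AddSubgroup (TruncatedWittVector p n K)} {j : ℕ}
    (hC : ∀ a b : Fin (d + 1), a ≠ b → ∀ N, n - 1 ≤ N →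
      ∃ θ, D.IsTheta p n a b N θ ∧ ∀ z ∈ C, θ z ∈ C)
    (h0 : ∀ s < n, ∀ c : k, ∀ m ∈ laurentExps d j, (∀ i, |m i| ≤ (d + 1) * p ^ n) →
      wittMono p n s (algebraMap k K c * D.umon m) ∈ C) {s : ℕ} (hs : s < n) (c : k)
    {m : Fin (d + 1) → ℤ} (hm : m ∈ laurentExps d j) :
    wittMono p n s (algebraMap k K c * D.umon m) ∈ C := by
  have hpp : p.Prime := Fact.out
  induction hw : ∑ i, (m i).natAbs using Nat.strong_induction_on generalizing m with
  | _ w ih =>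
  by_cases hsmall : ∀ i, |m i| ≤ (d + 1) * p ^ n
  · exact h0 s hs c m hm hsmall
  push Not at hsmall
  obtain ⟨a, b, ha, hb⟩ := exists_lt_and_lt hm.1 (q := (p : ℤ) ^ n) (by positivity) hsmall
  have hab : a ≠ b := by
    rintro rfl
    have : (0 : ℤ) < (p : ℤ) ^ n := by exact_mod_cast pow_pos hpp.pos n
    linarith
  have hps : (p : ℤ) ^ s ≤ (p : ℤ) ^ n := by
    exact_mod_cast Nat.pow_le_pow_right hpp.pos hs.le
  have hps0 : (0 : ℤ) < (p : ℤ) ^ s := by exact_mod_cast pow_pos hpp.pos s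
  set m' : Fin (d + 1) → ℤ := m - (Pi.single a ((p : ℤ) ^ s) - Pi.single b ((p : ℤ) ^ s)) with hm'
  have hma : m' a = m a - (p : ℤ) ^ s := by simp [hm', hab]
  have hmb : m' b = m b + (p : ℤ) ^ s := by simp [hm', hab.symm]
  have hmi (i) (hia : i ≠ a) (hib : i ≠ b) : m' i = m i := by simp [hm', hia, hib]
  have hmem : m' ∈ laurentExps d j := by
    refine ⟨by simp [hm', hm.1], fun i hi => ?_⟩
    by_cases hia : i = a
    · rw [hia, hma]
      linarith
    by_cases hib : i = b
    · have := hm.2 i hi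
      rw [hib] at this
      linarith
    rw [hmi i hia hib]
    exact hm.2 i hi
  have hlt : ∑ i, (m' i).natAbs < w := by
    rw [← hw]
    refine Finset.sum_lt_sum (fun i _ => ?_) ⟨a, Finset.mem_univ a, ?_⟩
    · by_cases hia : i = a
      · rw [hia, hma]
        omega
      by_cases hib : i = b
      · rw [hib, hmb]
        omega
      rw [hmi i hia hib]
    · rw [hma]
      omega
  have hy0 : 0 < p ^ (n - 1 - s) * (m' b).natAbs :=
    Nat.mul_pos (pow_pos hpp.pos _) (Int.natAbs_pos.2 (by omega))
  set N := max (n - 1) (p ^ (n - 1 - s) * (m' b).natAbs) with hN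
  obtain ⟨θ, hθ, hθC⟩ := hC a b hab N (le_max_left _ _)
  have hcop := choose_neg_isCoprime p hy0 ((le_max_right (n - 1) _).trans
    (Nat.lt_pow_self hpp.one_lt (n := N)).le)
  have hneg : (-(p ^ (n - 1 - s) * (m' b).natAbs : ℕ) : ℤ) = (p : ℤ) ^ (n - 1 - s) * m' b := by
    have : ((m' b).natAbs : ℤ) = - m' b := by omega
    push_cast
    rw [← Int.natCast_natAbs, this]
    ring
  rw [hneg] at hcop
  obtain ⟨e, he⟩ := exists_add_zsmul_eq p n hcop
  have h1 := C.zsmul_mem (hθC _ (ih _ hlt hmem rfl)) e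
  rw [hθ m' hmem.1 s hs c, smul_smul, zsmul_eq_of_modEq p n he, one_smul, wittTeich_mul_wittMono]
    at h1
  have h2 : D.umon m = (D.u a / D.u b) ^ p ^ s * D.umon m' := by
    have := D.umon_single_sub_single a b ((p : ℤ) ^ s)
    rw [← zpow_natCast]
    push_cast
    rw [← this, ← umon_add]
    congr 1
    rw [hm']
    abel
  rw [h2, mul_left_comm]
  exact h1

end ProjCharts

end Generation

section LaurentSections

attribute [local instance] MvPolynomial.gradedAlgebra

variable (k : Type u) [Field k] (d : ℕ)

open HomogeneousLocalization in
theorem notMem_of_isUnit_mapId (l b : Fin (d + 1)) (P : Ideal (MvPolynomial (Fin (d + 1)) k))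
    [P.IsPrime] (hl : Submonoid.powers (MvPolynomial.X l) ≤ P.primeCompl)
    (h : IsUnit (mapId (MvPolynomial.homogeneousSubmodule (Fin (d + 1)) k) hl
      (Away.mk _ (X_mem_homogeneousSubmodule k d l) 1
      (MvPolynomial.X b) ((one_smul ℕ 1).symm ▸ X_mem_homogeneousSubmodule k d b)))) :
    MvPolynomial.X b ∉ P := by
  have h1 := (isUnit_iff_isUnit_val (𝒜 := MvPolynomial.homogeneousSubmodule (Fin (d + 1)) k) P _).2 h
  have h2 : IsUnit (Localization.mk (MvPolynomial.X b : MvPolynomial (Fin (d + 1)) k)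
      (⟨MvPolynomial.X l ^ 1, hl ⟨1, rfl⟩⟩ : P.primeCompl)) := h1
  rw [Localization.mk_eq_mk'] at h2
  exact (IsLocalization.AtPrime.isUnit_mk'_iff (Localization.AtPrime P) P _ _).1 h2

theorem basicOpen_projCoord_le (l b : Fin (d + 1)) :
    (projSpace k d).basicOpen (projCoord k d l b) ≤ projBasicOpen k d (MvPolynomial.X b) := by
  intro x hx
  have hl : x ∈ projBasicOpen k d (MvPolynomial.X l) := (projSpace k d).basicOpen_le _ hx
  have h1 := ((projSpace k d).mem_basicOpen _ x hl).1 hx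
  have h2 := congrArg (fun φ => φ.hom (HomogeneousLocalization.Away.mk
    (MvPolynomial.homogeneousSubmodule (Fin (d + 1)) k) (X_mem_homogeneousSubmodule k d l) 1
      (MvPolynomial.X b) ((one_smul ℕ 1).symm ▸ X_mem_homogeneousSubmodule k d b)))
    (ProjectiveSpectrum.Proj.awayToSection_germ
      (MvPolynomial.homogeneousSubmodule (Fin (d + 1)) k) (MvPolynomial.X l) x hl)
  have := ProjectiveSpectrum.isPrime x
  refine notMem_of_isUnit_mapId k d l b _ (Submonoid.powers_le.mpr hl) ?_
  have h3 : IsUnit ((Proj.stalkIso' (MvPolynomial.homogeneousSubmodule (Fin (d + 1)) k)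
      x).toCommRingCatIso.inv.hom _) := h2 ▸ h1
  exact (isUnit_map_iff (Proj.stalkIso' (MvPolynomial.homogeneousSubmodule (Fin (d + 1)) k)
      x).symm _).1 h3

/-- The open subset `⋂_{b > j} D_+(z_b)` of `P^d`. -/
def projTorus (j : ℕ) : (projSpace k d).Opens :=
  listInf (X := (projSpace k d).toTopCat) (((List.finRange (d + 1)).filter fun b : Fin (d + 1) => j < (b : ℕ)).map
    fun b => projBasicOpen k d (MvPolynomial.X b))

theorem mem_listInf {X : TopCat.{u}} {l : List (Opens X)} {x : X} :
    x ∈ listInf l ↔ ∀ U ∈ l, x ∈ U := by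
  induction l with
  | nil => simp [listInf]
  | cons U l ih =>
    rw [List.forall_mem_cons, ← ih]
    rfl

theorem mem_listSup {X : TopCat.{u}} {l : List (Opens X)} {x : X} :
    x ∈ listSup l ↔ ∃ U ∈ l, x ∈ U := by
  induction l with
  | nil => simp [listSup]
  | cons U l ih =>
    rw [List.exists_mem_cons_iff, ← ih]
    rfl

theorem mem_projTorus {j : ℕ} {x : projSpace k d} :
    x ∈ projTorus k d j ↔
      ∀ b : Fin (d + 1), j < b → x ∈ projBasicOpen k d (MvPolynomial.X b) := by
  refine (mem_listInf (X := (projSpace k d).toTopCat)).trans ?_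
  constructor
  · exact fun h b hb => h _ (List.mem_map.2 ⟨b, by simpa using hb, rfl⟩)
  · rintro h _ hU
    obtain ⟨b, hb, rfl⟩ := List.mem_map.1 hU
    exact h b (by simpa using hb)

theorem genericPoint_mem_projTorus (j : ℕ) :
    genericPoint (projSpace k d) ∈ projTorus k d j :=
  (mem_projTorus k d).2 fun b _ => genericPoint_mem_projBasicOpen_X k d b

theorem projTorus_le {j : ℕ} {b : Fin (d + 1)} (hb : j < b) :
    projTorus k d j ≤ projBasicOpen k d (MvPolynomial.X b) :=
  fun _ hx => (mem_projTorus k d).1 hx b hb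

variable {k d} in
theorem projRes_schRes {U V : (projSpace k d).Opens} (h : V ≤ U)
    (hU : genericPoint (projSpace k d) ∈ U) (hV : genericPoint (projSpace k d) ∈ V)
    (s : Γ(projSpace k d, U)) : projRes hV (schRes h s) = projRes hU s :=
  funRes_schRes h hU hV s

/-- The Laurent monomials are functions on `⋂_{b > j} D_+(z_b)`. -/
theorem exists_projRes_eq_umon {j : ℕ} (hj : j < d) (c : k) {m : Fin (d + 1) → ℤ}
    (hm : m ∈ laurentExps d j) :
    ∃ y, projRes (genericPoint_mem_projTorus k d j) y =
      algebraMap k (projField k d) c * (projCharts k d).umon m := by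
  have hg := genericPoint_mem_projTorus k d j
  let R := (projRes hg).range
  have hfrac (i b : Fin (d + 1)) (hb : j < b) : projFun k d i / projFun k d b ∈ R :=
    ⟨schRes (projTorus_le k d hb) (projCoord k d b i),
      (funRes_schRes (projTorus_le k d hb) (genericPoint_mem_projBasicOpen_X k d b) hg _).trans
        (projRes_projCoord k d b i)⟩
  suffices h : (projCharts k d).umon m ∈ R by
    obtain ⟨y, hy⟩ := h
    exact ⟨schRes le_top (projConst k d c) * y, by rw [map_mul, hy, projRes_projConst]⟩
  let l : Fin (d + 1) := Fin.last d
  have hl : j < l := by simpa [l] using hj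
  have h1 : (projCharts k d).umon m = ∏ i, (projFun k d i / projFun k d l) ^ m i := by
    have h2 : ∏ i, (projFun k d l) ^ m i = 1 := by
      rw [prod_zpow (projFun_ne_zero k d l), hm.1, zpow_zero]
    simp only [div_zpow, Finset.prod_div_distrib, h2, div_one]
    rfl
  rw [h1]
  refine prod_mem fun i _ => ?_
  rcases le_or_gt (i : ℕ) j with hi | hi
  · obtain ⟨t, ht⟩ := Int.eq_ofNat_of_zero_le (hm.2 i hi)
    rw [ht, zpow_natCast]
    exact pow_mem (hfrac i l hl) t
  · obtain ⟨t, ht | ht⟩ := Int.eq_nat_or_neg (m i)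
    · rw [ht, zpow_natCast]
      exact pow_mem (hfrac i l hl) t
    · rw [ht, zpow_neg, zpow_natCast, ← inv_pow, inv_div]
      exact pow_mem (hfrac l i hi) t

/-- The functions on `⋂_{b > j} D_+(z_b)` are sums of Laurent monomials. -/
theorem closure_umon_eq_top {j : ℕ} (hj : j < d) :
    AddSubgroup.closure {y : Γ(projSpace k d, projTorus k d j) | ∃ (c : k), ∃ m ∈ laurentExps d j,
      projRes (genericPoint_mem_projTorus k d j) y =
        algebraMap k (projField k d) c * (projCharts k d).umon m} = ⊤ := by
  rw [eq_top_iff]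
  intro y _
  have hg := genericPoint_mem_projTorus k d j
  let l : Fin (d + 1) := Fin.last d
  have hl : j < l := by simpa [l] using hj
  have hW := isAffineOpen_projBasicOpen_X k d l
  have hWg := genericPoint_mem_projBasicOpen_X k d l
  let T : Finset (Fin (d + 1)) := Finset.univ.filter fun b => j < (b : ℕ)
  let f := ∏ b ∈ T, projCoord k d l b
  have hfU : (projSpace k d).basicOpen f ≤ projTorus k d j := fun x hx =>
    (mem_projTorus k d).2 fun b hb => basicOpen_projCoord_le k d l b (by
      obtain ⟨g, hg⟩ := Finset.dvd_prod_of_mem (projCoord k d l)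
        (Finset.mem_filter.2 ⟨Finset.mem_univ b, hb⟩ : b ∈ T)
      have hx' : x ∈ (projSpace k d).basicOpen f := hx
      rw [show f = _ from hg, Scheme.basicOpen_mul] at hx'
      exact hx'.1)
  have hfW := (projSpace k d).basicOpen_le f
  let h : Fin (d + 1) → ℤ := ∑ b ∈ T, (Pi.single b 1 - Pi.single l 1)
  have hfK : projRes hWg f = (projCharts k d).umon h := by
    rw [map_prod, ProjCharts.umon_sum]
    refine Finset.prod_congr rfl fun b _ => ?_
    rw [ProjCharts.umon_single_sub_single, zpow_one, projRes_projCoord]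
    rfl
  have hsum : ∑ i, h i = 0 := by
    simp only [h, Finset.sum_apply]
    rw [Finset.sum_comm]
    refine Finset.sum_eq_zero fun b _ => ?_
    simp [Finset.sum_sub_distrib]
  have hle (a : Fin (d + 1)) (ha : (a : ℕ) ≤ j) : h a = 0 := by
    simp only [h, Finset.sum_apply]
    refine Finset.sum_eq_zero fun b hb => ?_
    have hb' : j < (b : ℕ) := (Finset.mem_filter.1 hb).2
    have h1 : a ≠ b := by
      rintro rfl
      omega
    have h2 : a ≠ l := by
      rintro rfl
      omega
    simp [h1, h2]
  have hfV : genericPoint (projSpace k d) ∈ (projSpace k d).basicOpen f := by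
    refine ((projSpace k d).mem_basicOpen f _ hWg).2 (IsUnit.mk0 (projRes hWg f) ?_)
    rw [hfK]
    exact (projCharts k d).umon_ne_zero _
  obtain ⟨r, hr⟩ := hW.exists_pow_mul_eq f fun _ : Unit => schRes hfU y
  obtain ⟨g, hy⟩ := hr ()
  obtain ⟨G, rfl⟩ := (projChart_bijective k d l).2 g
  have hy' : (projCharts k d).umon (r • h) * projRes hg y = (projCharts k d).chart l G := by
    have h1 := congrArg (projRes hfV) hy
    rw [map_mul, map_pow, projRes_schRes hfW hWg, projRes_schRes hfU hg,
      projRes_schRes hfW hWg] at h1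
    rw [ProjCharts.umon_nsmul, ← hfK, ← projRes_projChart]
    exact h1
  have hexp (e) : ProjCharts.homExp l e - r • h ∈ laurentExps d j := by
    refine ⟨?_, fun a ha => ?_⟩
    · have h1 : ∑ i, ProjCharts.homExp l e i = 0 := ProjCharts.sum_homExp l e
      simp only [Pi.sub_apply, Pi.smul_apply, Finset.sum_sub_distrib, ← Finset.smul_sum, h1, hsum,
        smul_zero, sub_zero]
    · have h1 : a ≠ l := by
        rintro rfl
        omega
      have h2 : ProjCharts.homExp l e a = e ⟨a, h1⟩ := dif_pos h1
      rw [Pi.sub_apply, Pi.smul_apply, hle a ha, smul_zero, sub_zero, h2]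
      exact Int.natCast_nonneg _
  choose z hz using fun e => exists_projRes_eq_umon k d hj (G.coeff e) (hexp e)
  have hyz : y = ∑ e ∈ G.support, z e := by
    refine funRes_injective hg ?_
    change projRes hg y = projRes hg _
    refine mul_left_cancel₀ ((projCharts k d).umon_ne_zero (r • h)) ?_
    rw [hy', map_sum, Finset.mul_sum]
    conv_lhs => rw [← G.support_sum_monomial_coeff]
    rw [map_sum]
    refine Finset.sum_congr rfl fun e _ => ?_
    rw [hz, ProjCharts.chart_monomial, mul_left_comm, ← ProjCharts.umon_add, add_sub_cancel]
  rw [hyz]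
  exact sum_mem fun e _ => AddSubgroup.subset_closure ⟨_, _, hexp e, hz e⟩

end LaurentSections

section SectionClass
variable {X : TopCat.{u}}

open Abelian in
theorem exists_reducedLocalCohomology_hom (B : Opens X → Prop)
    (hinf : ∀ {U V}, B U → B V → B (U ⊓ V)) (l : List (Opens X)) (hl : ∀ U ∈ l, B U) (i r : ℕ)
    (hi : i = r + 1) (hr : l.length = r + 1) (Z : Closeds X) (hZ : Z.compl = listSup l)
    (F : TopCat.Sheaf AddCommGrpCat.{u} X) (hF : ∀ U, B U → IsAcyclicOn F U) :
    ∃ κ : F.obj.obj (op (listInf l)) →+ reducedLocalCohomology Z F i,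
      (∀ (θ : End F) y, κ (θ.hom.app _ y) = θ • κ y) ∧ Function.Surjective κ := by
  subst hi
  obtain ⟨c, hc0, hc⟩ := exists_reducedLocalCohomology_class B hinf l hl r hr Z hZ
  let e := zSheafHomEquiv (listInf l) F
  have hadd (y y') : e.symm (y + y') = e.symm y + e.symm y' := by
    refine e.injective ?_
    rw [Equiv.apply_symm_apply]
    exact (((zSheafHomEquiv_add _ F _ _).trans (congrArg₂ (· + ·) (e.apply_symm_apply y)
      (e.apply_symm_apply y')))).symm
  have hcomp (θ : End F) (y) : e.symm (θ.hom.app _ y) = e.symm y ≫ θ := by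
    refine e.injective ?_
    rw [Equiv.apply_symm_apply]
    exact ((zSheafHomEquiv_comp _ (e.symm y) θ).trans
      (congrArg _ (e.apply_symm_apply y))).symm
  have hker (f : (zSheaf X).obj (listInf l) ⟶ F) :
      forgetSupports Z F (r + 1) (c.comp (Ext.mk₀ f) (add_zero _)) = 0 := by
    change (Ext.mk₀ (zSheafClosedπ Z)).comp (c.comp (Ext.mk₀ f) (add_zero _)) (zero_add _) = 0
    rw [← Ext.comp_assoc_of_third_deg_zero, hc0, Ext.zero_comp]
  refine ⟨AddMonoidHom.mk' (fun y => ⟨c.comp (Ext.mk₀ (e.symm y)) (add_zero _), hker _⟩)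
    fun y y' => Subtype.ext ?_, fun θ y => Subtype.ext ?_, fun x => ?_⟩
  · change c.comp (Ext.mk₀ (e.symm (y + y'))) (add_zero _) =
      c.comp (Ext.mk₀ (e.symm y)) (add_zero _) + c.comp (Ext.mk₀ (e.symm y')) (add_zero _)
    rw [hadd, Ext.mk₀_add, Ext.comp_add]
  · change c.comp (Ext.mk₀ (e.symm (θ.hom.app _ y))) (add_zero _) =
      (c.comp (Ext.mk₀ (e.symm y)) (add_zero _)).comp (Ext.mk₀ θ) (add_zero _)
    rw [hcomp, ← Ext.mk₀_comp_mk₀, Ext.comp_assoc_of_third_deg_zero]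
  · obtain ⟨f, hf⟩ := hc F hF x.1 x.2
    refine ⟨e f, Subtype.ext ?_⟩
    change c.comp (Ext.mk₀ (e.symm (e f))) (add_zero _) = _
    rw [Equiv.symm_apply_apply, hf]

end SectionClass

section ProjCohomology

attribute [local instance] MvPolynomial.gradedAlgebra

variable (k : Type u) [Field k] (d : ℕ)

theorem length_filter_lt {j : ℕ} (hj : j ≤ d) :
    ((List.finRange (d + 1)).filter fun b : Fin (d + 1) => j < (b : ℕ)).length = d - j := by
  have h := Fin.card_Ioi (⟨j, Nat.lt_succ_of_le hj⟩ : Fin (d + 1))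
  rw [← Finset.filter_lt_eq_Ioi] at h
  exact h

theorem linSubspace_compl (j : ℕ) : (linSubspace k d j).compl =
    listSup (X := (projSpace k d).toTopCat)
      (((List.finRange (d + 1)).filter fun b : Fin (d + 1) => j < (b : ℕ)).map
        fun b => projBasicOpen k d (MvPolynomial.X b)) := by
  refine Opens.ext (Set.ext fun x => ?_)
  refine mem_linSubspace_compl.trans
    (Iff.trans ?_ (mem_listSup (X := (projSpace k d).toTopCat)).symm)
  constructor
  · rintro ⟨b, hb, hx⟩
    exact ⟨_, List.mem_map.2 ⟨b, by simpa using hb, rfl⟩, hx⟩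
  · rintro ⟨_, hU, hx⟩
    obtain ⟨b, hb, rfl⟩ := List.mem_map.1 hU
    exact ⟨b, by simpa using hb, hx⟩

instance : (projSpace k d).IsSeparated :=
  inferInstanceAs (Proj (MvPolynomial.homogeneousSubmodule (Fin (d + 1)) k)).IsSeparated

variable (p : ℕ) [Fact p.Prime] (n : ℕ)

theorem exists_wittLocalCohomology_hom {j : ℕ} (hj : j < d) :
    ∃ κ : TruncatedWittVector p n Γ(projSpace k d, projTorus k d j) →+
        WittLocalCohomology k d p n j,
      (∀ (θ : End (wittSheaf p n (projSpace k d))) y, κ (wittOp p n θ _ y) = θ • κ y) ∧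
      Function.Surjective κ := by
  have hlen := length_filter_lt d hj.le
  obtain ⟨r, hr⟩ := Nat.exists_eq_succ_of_ne_zero (Nat.sub_ne_zero_of_lt hj)
  exact exists_reducedLocalCohomology_hom (X := (projSpace k d).toTopCat)
    (fun U => IsAffineOpen (X := projSpace k d) U) (fun hU hV => hU.inf hV) _ (by
      intro U hU
      obtain ⟨b, hb, rfl⟩ := List.mem_map.1 hU
      exact isAffineOpen_projBasicOpen_X k d b) (d - j) r hr
    ((List.length_map _).trans (hlen.trans hr)) (linSubspace k d j)
    (linSubspace_compl k d j) (wittSheaf p n (projSpace k d))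
    fun U hU => isAcyclicOn_wittSheaf p n hU

theorem exists_finite_generating_sections [Finite k] [CharP k p] [NeZero n] {j : ℕ} (hj : j < d) :
    ∃ S : Set (TruncatedWittVector p n Γ(projSpace k d, projTorus k d j)), S.Finite ∧
      ∀ C : AddSubgroup (TruncatedWittVector p n Γ(projSpace k d, projTorus k d j)),
        (∀ Θ ∈ globalWittDiffOps k d p n, ∀ y ∈ C, wittOp p n Θ _ y ∈ C) → S ⊆ C → C = ⊤ := by
  have hg := genericPoint_mem_projTorus k d j
  let φ := TruncatedWittVector.mapHom p n (projRes hg)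
  have hφ : Function.Injective φ :=
    TruncatedWittVector.mapHom_injective p n (funRes_injective hg)
  let E : Set (Fin (d + 1) → ℤ) := {m | ∀ i, |m i| ≤ (d + 1) * p ^ n}
  have hE : E.Finite := (Set.finite_Icc (fun _ => -((d + 1) * p ^ n : ℤ))
    (fun _ => ((d + 1) * p ^ n : ℤ))).subset fun m hm =>
      ⟨fun i => (abs_le.1 (hm i)).1, fun i => (abs_le.1 (hm i)).2⟩
  let G : Set (TruncatedWittVector p n (projField k d)) :=
    (fun x : ℕ × k × (Fin (d + 1) → ℤ) => wittMono p n x.1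
      (algebraMap k (projField k d) x.2.1 * (projCharts k d).umon x.2.2)) ''
        (Set.Iio n ×ˢ Set.univ ×ˢ E)
  have hG : G.Finite := ((Set.finite_Iio n).prod (Set.finite_univ.prod hE)).image _
  refine ⟨φ ⁻¹' G, hG.preimage hφ.injOn, fun C hC hS => ?_⟩
  refine wittMono_induction p n (closure_umon_eq_top k d hj) ?_
  rintro s hs t ⟨c, m, hm, ht⟩
  have key : wittMono p n s (algebraMap k (projField k d) c * (projCharts k d).umon m) ∈
      C.map φ.toAddMonoidHom := by
    refine (projCharts k d).wittMono_mem_of_isTheta p n (fun a b hab N hN => ?_)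
      (fun s hs c m hm hb => ?_) hs c hm
    · obtain ⟨θ, hθ, hθ', hθ''⟩ := (projCharts k d).exists_theta p n hab hN
      obtain ⟨Θ, hΘ, hΘ'⟩ := exists_globalWittDiffOp k d p n hθ
        (apply_mapHom_mul_of_mem_groDiffOps p n hθ) hθ''
      refine ⟨θ, hθ', ?_⟩
      rintro _ ⟨y, hy, rfl⟩
      exact ⟨wittOp p n Θ _ y, hC Θ hΘ y hy, hΘ' _ hg y⟩
    · obtain ⟨y, hy⟩ := exists_projRes_eq_umon k d hj c hm
      have h1 : φ (wittMono p n s y) =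
          wittMono p n s (algebraMap k (projField k d) c * (projCharts k d).umon m) := by
        rw [← hy]
        exact mapHom_wittMono p n _ s y
      exact ⟨wittMono p n s y, hS (by
        change φ _ ∈ G
        rw [h1]
        exact ⟨(s, c, m), ⟨hs, trivial, hb⟩, rfl⟩), h1⟩
  obtain ⟨y, hy, hyt⟩ := key
  rw [← ht, ← mapHom_wittMono] at hyt
  rwa [← hφ hyt]

theorem exists_finite_span_wittLocalCohomology [Finite k] [CharP k p] [NeZero n] {j : ℕ}
    (hj : j < d) : ∃ S : Set (WittLocalCohomology k d p n j), S.Finite ∧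
      Submodule.span (globalWittDiffOps k d p n) S = ⊤ := by
  obtain ⟨κ, hκ, hsurj⟩ := exists_wittLocalCohomology_hom k d p n hj
  obtain ⟨S, hS, h⟩ := exists_finite_generating_sections k d p n hj
  refine ⟨κ '' S, hS.image _, ?_⟩
  have h1 := h ((Submodule.span (globalWittDiffOps k d p n) (κ '' S)).toAddSubgroup.comap κ)
    (fun Θ hΘ y hy => by
      change κ (wittOp p n Θ _ y) ∈ Submodule.span (globalWittDiffOps k d p n) (κ '' S)
      rw [hκ]
      exact Submodule.smul_mem _ (⟨Θ, hΘ⟩ : globalWittDiffOps k d p n) hy)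
    fun y hy => Submodule.subset_span ⟨y, hy, rfl⟩
  rw [eq_top_iff]
  intro x _
  obtain ⟨y, rfl⟩ := hsurj x
  exact (h1 ▸ AddSubgroup.mem_top y : y ∈ AddSubgroup.comap κ _)

end ProjCohomology

section ExtFunctoriality
open Abelian
universe w₁ w₂ w₃ v₁ v₂ v₃ u₁ u₂ u₃
variable {A : Type u₁} [Category.{v₁} A] [Abelian A] [EnoughInjectives A] [HasExt.{w₁} A]
  {B : Type u₂} [Category.{v₂} B] [Abelian B] [HasExt.{w₂} B]
  {C : Type u₃} [Category.{v₃} C] [Abelian C] [HasExt.{w₃} C]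

omit [EnoughInjectives A] in
theorem mapExactFunctor_mapExactFunctor_extClass (F : A ⥤ B) (G : B ⥤ C) [F.Additive] [G.Additive]
    [PreservesFiniteLimits F] [PreservesFiniteColimits F]
    [PreservesFiniteLimits G] [PreservesFiniteColimits G]
    [(F ⋙ G).Additive] [PreservesFiniteLimits (F ⋙ G)] [PreservesFiniteColimits (F ⋙ G)]
    {S : ShortComplex A} (hS : S.ShortExact) :
    (hS.extClass.mapExactFunctor F).mapExactFunctor G = hS.extClass.mapExactFunctor (F ⋙ G) :=
  (congrArg (Ext.mapExactFunctor G) (Ext.mapExactFunctor_extClass F hS)).trans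
    ((Ext.mapExactFunctor_extClass G (hS.map_of_exact F)).trans
      (Ext.mapExactFunctor_extClass (F ⋙ G) hS).symm)

theorem mapExactFunctor_mapExactFunctor (F : A ⥤ B) (G : B ⥤ C) [F.Additive] [G.Additive]
    [PreservesFiniteLimits F] [PreservesFiniteColimits F]
    [PreservesFiniteLimits G] [PreservesFiniteColimits G]
    [(F ⋙ G).Additive] [PreservesFiniteLimits (F ⋙ G)] [PreservesFiniteColimits (F ⋙ G)]
    {X Y : A} {i : ℕ} (x : Ext X Y i) :
    (x.mapExactFunctor F).mapExactFunctor G = x.mapExactFunctor (F ⋙ G) := by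
  induction i generalizing Y with
  | zero =>
    obtain ⟨f, rfl⟩ := Ext.homEquiv₀.symm.surjective x
    change ((Ext.mk₀ f).mapExactFunctor F).mapExactFunctor G = (Ext.mk₀ f).mapExactFunctor (F ⋙ G)
    rw [Ext.mapExactFunctor_mk₀, Ext.mapExactFunctor_mk₀, Ext.mapExactFunctor_mk₀]
    rfl
  | succ i ih =>
    let S := ShortComplex.mk (Injective.ι Y) (cokernel.π (Injective.ι Y)) (cokernel.condition _)
    have hS : S.ShortExact := { exact := ShortComplex.exact_cokernel _ }
    obtain ⟨y, rfl⟩ := Ext.covariant_sequence_exact₁ X hS x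
      (Ext.eq_zero_of_injective (I := Injective.under Y) _) rfl
    have h1 := mapExactFunctor_mapExactFunctor_extClass F G hS
    rw [Ext.mapExactFunctor_comp, Ext.mapExactFunctor_comp, Ext.mapExactFunctor_comp, ih]
    exact congrArg (fun z => Ext.comp _ z _) h1

theorem comp_mapExactFunctor_comp_mapExactFunctor_comp (F : A ⥤ B) (G : B ⥤ C) [F.Additive]
    [G.Additive] [PreservesFiniteLimits F] [PreservesFiniteColimits F]
    [PreservesFiniteLimits G] [PreservesFiniteColimits G]
    [(F ⋙ G).Additive] [PreservesFiniteLimits (F ⋙ G)] [PreservesFiniteColimits (F ⋙ G)]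
    {X Y : A} {X' Y' : B} {X'' Y'' : C} {i : ℕ} (x : Ext X Y i) (a : X' ⟶ F.obj X)
    (a' : F.obj Y ⟶ Y') (b : X'' ⟶ G.obj X') (b' : G.obj Y' ⟶ Y'') :
    ((Ext.mk₀ b).comp ((((Ext.mk₀ a).comp (x.mapExactFunctor F) (zero_add i)).comp (Ext.mk₀ a')
      (add_zero i)).mapExactFunctor G) (zero_add i)).comp (Ext.mk₀ b') (add_zero i) =
    ((Ext.mk₀ (b ≫ G.map a :)).comp (x.mapExactFunctor (F ⋙ G)) (zero_add i)).comp
      (Ext.mk₀ (G.map a' ≫ b')) (add_zero i) := by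
  rw [Ext.mapExactFunctor_comp, Ext.mapExactFunctor_comp, Ext.mapExactFunctor_mk₀,
    Ext.mapExactFunctor_mk₀, mapExactFunctor_mapExactFunctor, ← Ext.mk₀_comp_mk₀,
    ← Ext.mk₀_comp_mk₀]
  generalize x.mapExactFunctor (F ⋙ G) = y
  change Ext (G.obj (F.obj X)) (G.obj (F.obj Y)) i at y
  simp only [Ext.comp_assoc_of_third_deg_zero, Ext.mk₀_comp_mk₀_assoc, Ext.mk₀_comp_mk₀]

end ExtFunctoriality

section PushforwardFunctoriality

open Abelian

variable {X Y T : TopCat.{u}} (φ : X ⟶ Y) (ψ : Y ⟶ T) {Z : Closeds X} {W : Closeds Y}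
  {V : Closeds T} (h : (Opens.map φ).obj W.compl ≤ Z.compl)
  (h' : (Opens.map ψ).obj V.compl ≤ W.compl)
  (h'' : (Opens.map (φ ≫ ψ)).obj V.compl ≤ Z.compl)

theorem zSheafClosedHomEquiv_comp {F G : TopCat.Sheaf AddCommGrpCat.{u} X}
    (f : zSheafClosed Z ⟶ F) (g : F ⟶ G) :
    (zSheafClosedHomEquiv Z G (f ≫ g)).1 = g.hom.app (op ⊤) (zSheafClosedHomEquiv Z F f).1 := by
  change zSheafHomEquiv ⊤ G (zSheafClosedπ Z ≫ f ≫ g) = _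
  rw [← Category.assoc]
  exact zSheafHomEquiv_comp ⊤ _ g

theorem zSheafClosedToPushforward_comp :
    zSheafClosedToPushforward (φ ≫ ψ) h'' =
      (zSheafClosedToPushforward ψ h' ≫ (TopCat.Sheaf.pushforward AddCommGrpCat.{u} ψ).map
        (zSheafClosedToPushforward φ h) :) := by
  refine (zSheafClosedHomEquiv V _).injective (Subtype.ext ?_)
  refine (congrArg Subtype.val ((zSheafClosedHomEquiv V _).apply_symm_apply _)).trans ?_
  refine Eq.trans ?_ (zSheafClosedHomEquiv_comp _ _).symm
  have h1 := congrArg Subtype.val ((zSheafClosedHomEquiv V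
    ((TopCat.Sheaf.pushforward AddCommGrpCat.{u} ψ).obj (zSheafClosed W))).apply_symm_apply
      ⟨(zSheafClosedHomEquiv W _ (𝟙 _)).1,
    sectionsWithSupport_pushforward ψ h' (zSheafClosedHomEquiv W _ (𝟙 _)).2⟩)
  have h2 := congrArg Subtype.val ((zSheafClosedHomEquiv W
    ((TopCat.Sheaf.pushforward AddCommGrpCat.{u} φ).obj (zSheafClosed Z))).apply_symm_apply
      ⟨(zSheafClosedHomEquiv Z _ (𝟙 _)).1,
    sectionsWithSupport_pushforward φ h (zSheafClosedHomEquiv Z _ (𝟙 _)).2⟩)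
  have h3 := zSheafClosedHomEquiv_comp (𝟙 (zSheafClosed W)) (zSheafClosedToPushforward φ h)
  rw [Category.id_comp] at h3
  refine Eq.trans ?_ (congrArg ((zSheafClosedToPushforward φ h).hom.app (op ⊤)) h1.symm)
  exact h2.symm.trans h3

variable [IsIso φ] [IsIso ψ] {F : TopCat.Sheaf AddCommGrpCat.{u} X}
  {G : TopCat.Sheaf AddCommGrpCat.{u} Y} {H : TopCat.Sheaf AddCommGrpCat.{u} T}
  (α : (TopCat.Sheaf.pushforward AddCommGrpCat.{u} φ).obj F ⟶ G)
  (β : (TopCat.Sheaf.pushforward AddCommGrpCat.{u} ψ).obj G ⟶ H)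

set_option maxRecDepth 8000 in
theorem localCohomologyMap_localCohomologyMap {i : ℕ} (x : LocalCohomology Z F i) :
    localCohomologyMap ψ h' β i (localCohomologyMap φ h α i x) =
      localCohomologyMap (φ ≫ ψ) h''
        ((TopCat.Sheaf.pushforward AddCommGrpCat.{u} ψ).map α ≫ β) i x := by
  have hζ := zSheafClosedToPushforward_comp φ ψ h h' h''
  have key := comp_mapExactFunctor_comp_mapExactFunctor_comp
    (TopCat.Sheaf.pushforward AddCommGrpCat.{u} φ) (TopCat.Sheaf.pushforward AddCommGrpCat.{u} ψ)
    (X := zSheafClosed Z) x (zSheafClosedToPushforward φ h) α (zSheafClosedToPushforward ψ h') β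
  refine Eq.trans ?_ (key.trans ?_)
  · rfl
  · generalize (zSheafClosedToPushforward ψ h' ≫ (TopCat.Sheaf.pushforward AddCommGrpCat.{u} ψ).map
      (zSheafClosedToPushforward φ h) :) = z at hζ
    subst hζ
    rfl

end PushforwardFunctoriality

section LocalCohomologyMap

open Abelian

variable {X Y T : TopCat.{u}} {Z : Closeds X} {W : Closeds Y} {V : Closeds T}
  {F : TopCat.Sheaf AddCommGrpCat.{u} X}
  {G : TopCat.Sheaf AddCommGrpCat.{u} Y} {H : TopCat.Sheaf AddCommGrpCat.{u} T}

theorem localCohomologyMap_localCohomologyMap_of_eq (φ : X ⟶ Y) (ψ : Y ⟶ T) (χ : X ⟶ T)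
    [IsIso φ] [IsIso ψ] [IsIso χ] (hχ : χ = φ ≫ ψ)
    (h : (Opens.map φ).obj W.compl ≤ Z.compl) (h' : (Opens.map ψ).obj V.compl ≤ W.compl)
    (h'' : (Opens.map χ).obj V.compl ≤ Z.compl)
    (α : (TopCat.Sheaf.pushforward AddCommGrpCat.{u} φ).obj F ⟶ G)
    (β : (TopCat.Sheaf.pushforward AddCommGrpCat.{u} ψ).obj G ⟶ H)
    (γ : (TopCat.Sheaf.pushforward AddCommGrpCat.{u} χ).obj F ⟶ H)
    (hγ : ∀ (U : Opens T) (s : F.obj.obj (op ((Opens.map χ).obj U))),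
      γ.hom.app (op U) s = β.hom.app (op U) (α.hom.app (op ((Opens.map ψ).obj U))
        (F.obj.map (eqToHom (congrArg (fun f => op ((Opens.map f).obj U)) hχ)) s)))
    {i : ℕ} (x : LocalCohomology Z F i) :
    localCohomologyMap ψ h' β i (localCohomologyMap φ h α i x) =
      localCohomologyMap χ h'' γ i x := by
  subst hχ
  have e : γ = ((TopCat.Sheaf.pushforward AddCommGrpCat.{u} ψ).map α ≫ β :) := by
    refine Sheaf.hom_ext (NatTrans.ext (funext fun U => ConcreteCategory.hom_ext _ _ fun s => ?_))
    refine (hγ U.unop s).trans ?_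
    rw [eqToHom_refl, F.obj.map_id]
    rfl
  rw [e]
  exact localCohomologyMap_localCohomologyMap φ ψ h h' h'' α β x

theorem reducedLocalCohomologyMap_reducedLocalCohomologyMap (φ : X ⟶ Y) (ψ : Y ⟶ T) (χ : X ⟶ T)
    [IsIso φ] [IsIso ψ] [IsIso χ] (hχ : χ = φ ≫ ψ)
    (h : (Opens.map φ).obj W.compl ≤ Z.compl) (h' : (Opens.map ψ).obj V.compl ≤ W.compl)
    (h'' : (Opens.map χ).obj V.compl ≤ Z.compl)
    (α : (TopCat.Sheaf.pushforward AddCommGrpCat.{u} φ).obj F ⟶ G)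
    (β : (TopCat.Sheaf.pushforward AddCommGrpCat.{u} ψ).obj G ⟶ H)
    (γ : (TopCat.Sheaf.pushforward AddCommGrpCat.{u} χ).obj F ⟶ H)
    (hγ : ∀ (U : Opens T) (s : F.obj.obj (op ((Opens.map χ).obj U))),
      γ.hom.app (op U) s = β.hom.app (op U) (α.hom.app (op ((Opens.map ψ).obj U))
        (F.obj.map (eqToHom (congrArg (fun f => op ((Opens.map f).obj U)) hχ)) s)))
    {i : ℕ} (x : reducedLocalCohomology Z F i) :
    reducedLocalCohomologyMap ψ h' β i (reducedLocalCohomologyMap φ h α i x) =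
      reducedLocalCohomologyMap χ h'' γ i x :=
  Subtype.ext (localCohomologyMap_localCohomologyMap_of_eq φ ψ χ hχ h h' h'' α β γ hγ x.1)

theorem localCohomologyMap_smul (φ : X ⟶ Y) [IsIso φ] (h : (Opens.map φ).obj W.compl ≤ Z.compl)
    (α : (TopCat.Sheaf.pushforward AddCommGrpCat.{u} φ).obj F ⟶ G) (θ : End F) (θ' : End G)
    (hθ : (TopCat.Sheaf.pushforward AddCommGrpCat.{u} φ).map θ ≫ α = α ≫ θ') {i : ℕ}
    (x : LocalCohomology Z F i) :
    localCohomologyMap φ h α i (θ • x) = θ' • localCohomologyMap φ h α i x := by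
  let P := TopCat.Sheaf.pushforward AddCommGrpCat.{u} φ
  have h1 := Ext.mapExactFunctor_comp P (X := zSheafClosed Z) x (Ext.mk₀ θ) (add_zero i)
  rw [Ext.mapExactFunctor_mk₀] at h1
  have h2 : localCohomologyMap φ h α i (θ • x) =
      ((Ext.mk₀ (zSheafClosedToPushforward φ h)).comp (Ext.mapExactFunctor P (Ext.comp
        (X := zSheafClosed Z) x (Ext.mk₀ θ) (add_zero i))) (zero_add i)).comp
          (Ext.mk₀ α) (add_zero i) := rfl
  have h3 : θ' • localCohomologyMap φ h α i x =
      (((Ext.mk₀ (zSheafClosedToPushforward φ h)).comp (Ext.mapExactFunctor P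
        (X := zSheafClosed Z) x) (zero_add i)).comp
          (Ext.mk₀ α) (add_zero i)).comp (Ext.mk₀ θ') (add_zero i) := rfl
  rw [h2, h3, h1]
  simp only [Ext.comp_assoc_of_third_deg_zero, Ext.mk₀_comp_mk₀]
  exact congrArg (fun z => Ext.comp _ (Ext.comp _ (Ext.mk₀ z) (add_zero i)) (zero_add i)) hθ

theorem reducedLocalCohomologyMap_smul (φ : X ⟶ Y) [IsIso φ]
    (h : (Opens.map φ).obj W.compl ≤ Z.compl)
    (α : (TopCat.Sheaf.pushforward AddCommGrpCat.{u} φ).obj F ⟶ G) (θ : End F) (θ' : End G)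
    (hθ : (TopCat.Sheaf.pushforward AddCommGrpCat.{u} φ).map θ ≫ α = α ≫ θ') {i : ℕ}
    (x : reducedLocalCohomology Z F i) :
    reducedLocalCohomologyMap φ h α i (θ • x) = θ' • reducedLocalCohomologyMap φ h α i x :=
  Subtype.ext (localCohomologyMap_smul φ h α θ θ' hθ x.1)

end LocalCohomologyMap

section WittPullback
variable {X : Scheme.{u}} {e e' e'' : X ≅ X} (he : e'' = e ≪≫ e')

include he in
theorem inv_base_eq_of_eq_trans : e''.inv.base = e'.inv.base ≫ e.inv.base := by
  subst he
  exact Scheme.Hom.comp_base _ _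

variable (p : ℕ) [Fact p.Prime] (n : ℕ)

include he in
theorem wittPullback_of_eq_trans (U : Opens X) (s : (wittSheaf p n X).obj.obj
      (op ((Opens.map e''.inv.base).obj U))) :
    (wittPullback p n e'').hom.app (op U) s =
      (wittPullback p n e).hom.app (op U)
        ((wittPullback p n e').hom.app (op ((Opens.map e.inv.base).obj U))
          ((wittSheaf p n X).obj.map (eqToHom (congrArg
            (fun f => op ((Opens.map f).obj U)) (inv_base_eq_of_eq_trans he))) s)) := by
  subst he
  have h (e : X ≅ X) (W : X.Opens) : W ≤ e.hom ⁻¹ᵁ e.inv ⁻¹ᵁ W := by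
    rw [← Scheme.Hom.comp_preimage, e.hom_inv_id, Scheme.Hom.id_preimage]
  have h1 : e'.hom.appLE (e'.inv ⁻¹ᵁ e.inv ⁻¹ᵁ U) (e.inv ⁻¹ᵁ U) (h _ _) ≫
      e.hom.appLE (e.inv ⁻¹ᵁ U) U (h _ _) =
        (e ≪≫ e').hom.appLE ((e ≪≫ e').inv ⁻¹ᵁ U) U (h _ _) :=
    Scheme.Hom.appLE_comp_appLE _ _ _ _ _ _ _
  have h2 := congrArg (fun f => (ConcreteCategory.hom f) s)
    ((wittSheaf p n X).obj.map_id (op ((Opens.map (e ≪≫ e').inv.base).obj U)))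
  have h3 := congrArg (fun f => TruncatedWittVector.mapHom p n f.hom s) h1.symm
  refine (h3.trans ?_).trans (congrArg (fun z => (wittPullback p n e).hom.app (op U)
    ((wittPullback p n e').hom.app (op ((Opens.map e.inv.base).obj U)) z)) h2.symm)
  exact TruncatedWittVector.mapHom_comp p n
    (e.hom.appLE (e.inv ⁻¹ᵁ U) U (h _ _)).hom
    (e'.hom.appLE (e'.inv ⁻¹ᵁ e.inv ⁻¹ᵁ U) (e.inv ⁻¹ᵁ U) (h _ _)).hom s

theorem wittPullback_wittScalar (e : X ≅ X) (a : TruncatedWittVector p n Γ(X, ⊤))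
    (ha : ∀ (U V : X.Opens) (h : U ≤ e.hom ⁻¹ᵁ V), TruncatedWittVector.mapHom p n
      (e.hom.appLE V U h).hom (TruncatedWittVector.mapHom p n (schRes le_top) a) =
        TruncatedWittVector.mapHom p n (schRes le_top) a) :
    (TopCat.Sheaf.pushforward AddCommGrpCat.{u} e.inv.base).map (wittScalar p n X a) ≫
      wittPullback p n e = wittPullback p n e ≫ wittScalar p n X a := by
  refine Sheaf.hom_ext (NatTrans.ext (funext fun U => ConcreteCategory.hom_ext _ _
    fun s : TruncatedWittVector p n Γ(X, e.inv ⁻¹ᵁ U.unop) => ?_))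
  change TruncatedWittVector.mapHom p n (e.hom.appLE _ _ _).hom
    (TruncatedWittVector.mapHom p n (schRes le_top) a * s) =
      TruncatedWittVector.mapHom p n (schRes le_top) a *
        TruncatedWittVector.mapHom p n (e.hom.appLE _ _ _).hom s
  rw [map_mul, ha]

end WittPullback

section ParabolicAction

attribute [local instance] MvPolynomial.gradedAlgebra

variable {k : Type u} [Field k] {d : ℕ}

local notation "𝒜" => MvPolynomial.homogeneousSubmodule (Fin (d + 1)) k

theorem projAut_mul_hom (g h : Matrix.GeneralLinearGroup (Fin (d + 1)) k) :
    (projAut (g * h)).hom = (projAut g).hom ≫ (projAut h).hom := by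
  have e := polyAct_mul g h
  change Proj.map (polyAct (g * h)) _ =
    Proj.map (polyAct g) (irrelevant_le_polyAct g) ≫ Proj.map (polyAct h) (irrelevant_le_polyAct h)
  rw [← Proj.map_comp]
  simp only [e]

theorem projAut_mul (g h : Matrix.GeneralLinearGroup (Fin (d + 1)) k) :
    projAut (g * h) = projAut g ≪≫ projAut h := Iso.ext (projAut_mul_hom g h)

theorem polyAct_ne_zero (g : Matrix.GeneralLinearGroup (Fin (d + 1)) k)
    {f : MvPolynomial (Fin (d + 1)) k} (hf : f ≠ 0) : polyAct g f ≠ 0 := by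
  intro h
  have h1 := DFunLike.congr_fun (polyAct_mul g⁻¹ g) f
  rw [inv_mul_cancel, polyAct_one] at h1
  have h2 : f = polyAct g⁻¹ (polyAct g f) := h1
  rw [h, map_zero] at h2
  exact hf h2

open HomogeneousLocalization in
theorem awayMap_fromZero (g : Matrix.GeneralLinearGroup (Fin (d + 1)) k)
    (f : MvPolynomial (Fin (d + 1)) k) (c : k) :
    (HomogeneousLocalization.Away.map (polyAct g) f : Away 𝒜 f →+* Away 𝒜 (polyAct g f))
      (fromZeroRingHom 𝒜 _ (algebraMap k (𝒜 0) c)) =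
        fromZeroRingHom 𝒜 _ (algebraMap k (𝒜 0) c) := by
  refine val_injective _ ?_
  change Localization.mk (polyAct g (MvPolynomial.C c)) ⟨polyAct g 1, _⟩ =
    Localization.mk (MvPolynomial.C c) ⟨1, _⟩
  simp only [polyAct_C, map_one]

theorem appLE_projConst (g : Matrix.GeneralLinearGroup (Fin (d + 1)) k)
    {U V : (projSpace k d).Opens} (hUV : U ≤ (projAut g).hom ⁻¹ᵁ V) (c : k) :
    ((projAut g).hom.appLE V U hUV).hom (schRes le_top (projConst k d c)) =
      schRes le_top (projConst k d c) := by
  have htop : (⊤ : (projSpace k d).Opens) ≤ (projAut g).hom ⁻¹ᵁ ⊤ := le_top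
  suffices h : ((projAut g).hom.appLE ⊤ ⊤ htop).hom (projConst k d c) = projConst k d c by
    have h1 := congrArg (fun φ => φ.hom (projConst k d c))
      ((projAut g).hom.map_appLE hUV (homOfLE (le_top : V ≤ ⊤)).op)
    have h2 := congrArg (fun φ => φ.hom (projConst k d c))
      ((projAut g).hom.appLE_map htop (homOfLE (le_top : U ≤ ⊤)).op)
    exact h1.trans (h2.symm.trans (congrArg (schRes le_top) h))
  have hX := X_mem_homogeneousSubmodule k d 0
  have hgX : polyAct g (MvPolynomial.X 0) ∈ 𝒜 1 := (polyAct g).map_mem hX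
  have hg := genericPoint_mem_projBasicOpen k d
    (polyAct_ne_zero g (MvPolynomial.X_ne_zero (R := k) (0 : Fin (d + 1))))
  have hD : projBasicOpen k d (polyAct g (MvPolynomial.X 0)) ≤
      (projAut g).hom ⁻¹ᵁ projBasicOpen k d (MvPolynomial.X 0) := le_rfl
  have hinj : Function.Injective (schRes (X := projSpace k d)
      (le_top : projBasicOpen k d (polyAct g (MvPolynomial.X 0)) ≤ ⊤)) := by
    intro s t hst
    refine funRes_injective (X := projSpace k d) (U := ⊤) trivial ?_
    rw [← funRes_schRes le_top trivial hg, hst, funRes_schRes le_top trivial hg]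
  refine hinj ?_
  have h1 := congrArg (fun φ => φ.hom (projConst k d c))
    ((projAut g).hom.map_appLE hD (homOfLE (le_top : projBasicOpen k d (MvPolynomial.X 0) ≤ ⊤)).op)
  have h2 := congrArg (fun φ => φ.hom (projConst k d c))
    ((projAut g).hom.appLE_map htop
      (homOfLE (le_top : projBasicOpen k d (polyAct g (MvPolynomial.X 0)) ≤ ⊤)).op)
  have h3 := schRes_projConst k d _ hX one_pos c
  have h4 := schRes_projConst k d _ hgX one_pos c
  have h5 := congrArg (fun φ => φ.hom
    (HomogeneousLocalization.fromZeroRingHom 𝒜 _ (algebraMap k (𝒜 0) c)))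
    (Proj.awayToSection_comp_appLE (polyAct g) (irrelevant_le_polyAct g) hX)
  have h6 := congrArg (Proj.awayToSection 𝒜 (polyAct g (MvPolynomial.X 0))).hom
    (awayMap_fromZero g (MvPolynomial.X 0) c)
  refine h2.trans (h1.symm.trans ?_)
  refine Eq.trans (congrArg ((projAut g).hom.appLE _ _ hD).hom h3) ?_
  exact h5.trans (h6.trans h4.symm)

variable (p : ℕ) [Fact p.Prime] (n j : ℕ)

theorem parabolicAct_parabolicAct (g h : parabolic k d j) (x : WittLocalCohomology k d p n j) :
    parabolicAct k d p n j g (parabolicAct k d p n j h x) = parabolicAct k d p n j (g * h) x := by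
  have e := projAut_mul g.1 h.1
  rw [← Subgroup.coe_mul] at e
  exact reducedLocalCohomologyMap_reducedLocalCohomologyMap (projAut h.1).inv.base
    (projAut g.1).inv.base (projAut (g * h).1).inv.base (inv_base_eq_of_eq_trans e)
    (projAut_preimage_le h.2) (projAut_preimage_le g.2) (projAut_preimage_le (g * h).2)
    (wittPullback p n (projAut h.1)) (wittPullback p n (projAut g.1))
    (wittPullback p n (projAut (g * h).1)) (wittPullback_of_eq_trans e p n) x

theorem mapHom_appLE_projConst (g : Matrix.GeneralLinearGroup (Fin (d + 1)) k)
    (c : TruncatedWittVector p n k) (U V : (projSpace k d).Opens)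
    (h : U ≤ (projAut g).hom ⁻¹ᵁ V) :
    TruncatedWittVector.mapHom p n ((projAut g).hom.appLE V U h).hom
      (TruncatedWittVector.mapHom p n (schRes le_top)
        (TruncatedWittVector.mapHom p n (projConst k d) c)) =
      TruncatedWittVector.mapHom p n (schRes le_top)
        (TruncatedWittVector.mapHom p n (projConst k d) c) :=
  TruncatedWittVector.ext fun i => by
    simp only [TruncatedWittVector.coeff_mapHom]
    exact appLE_projConst g h _

theorem parabolicAct_smul (g : parabolic k d j) (c : TruncatedWittVector p n k)
    (x : WittLocalCohomology k d p n j) :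
    parabolicAct k d p n j g (c • x) = c • parabolicAct k d p n j g x :=
  reducedLocalCohomologyMap_smul (projAut g.1).inv.base (projAut_preimage_le g.2)
    (wittPullback p n (projAut g.1)) (projScalar k d p n c) (projScalar k d p n c)
    (wittPullback_wittScalar p n (projAut g.1) _ (mapHom_appLE_projConst p n g.1 c)) x

end ParabolicAction

section SpanAction

variable {R D H : Type*} [CommRing R] [Ring D] [Algebra R D] [AddCommGroup H] [Module R H]
  [Module D H] [IsScalarTower R D H]

theorem exists_tensorProduct_smul_linearMap (N : Submodule R H) :
    ∃ ρ : D ⊗[R] N →ₗ[D] H, ∀ (P : D) (x : N), ρ (P ⊗ₜ x) = P • (x : H) :=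
  haveI := IsScalarTower.to_smulCommClass (R := R) (A := D) (M := H)
  ⟨TensorProduct.AlgebraTensorModule.lift
    { toFun := fun P => P • N.subtype
      map_add' := fun P Q => add_smul P Q _
      map_smul' := fun P Q => mul_smul P Q _ }, fun _ _ => rfl⟩

/-- If finitely many elements generate `H` over `D` and a finite group acts on `H` by `R`-linear
maps, then `H` is generated over `D` by a finitely generated stable `R`-submodule. -/
theorem exists_stable_fg_surjective {G : Type*} [Group G] [Finite G] (act : G → H →+ H)
    (act_act : ∀ g h x, act g (act h x) = act (g * h) x)
    (act_smul : ∀ g (c : R) x, act g (c • x) = c • act g x)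
    {S : Set H} (hS : S.Finite) (hspan : Submodule.span D S = ⊤) :
    ∃ N : Submodule R H, N.FG ∧ (∀ g, ∀ x ∈ N, act g x ∈ N) ∧
      ∃ ρ : D ⊗[R] N →ₗ[D] H, (∀ (P : D) (x : N), ρ (P ⊗ₜ x) = P • (x : H)) ∧
        Function.Surjective ρ := by
  have hfin : (S ∪ ⋃ g, act g '' S).Finite :=
    hS.union (Set.finite_iUnion fun g => hS.image _)
  refine ⟨Submodule.span R (S ∪ ⋃ g, act g '' S), Submodule.fg_span hfin, fun g x hx => ?_, ?_⟩
  · induction hx using Submodule.span_induction with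
    | mem x hx =>
      refine Submodule.subset_span (Or.inr (Set.mem_iUnion.2 ?_))
      rcases hx with hx | hx
      · exact ⟨g, x, hx, rfl⟩
      · obtain ⟨h, y, hy, rfl⟩ := Set.mem_iUnion.1 hx
        exact ⟨g * h, y, hy, (act_act g h y).symm⟩
    | zero => rw [map_zero]; exact zero_mem _
    | add x y _ _ hx hy => rw [map_add]; exact add_mem hx hy
    | smul c x _ hx => rw [act_smul]; exact Submodule.smul_mem _ c hx
  · obtain ⟨ρ, hρ⟩ := exists_tensorProduct_smul_linearMap (D := D)
      (Submodule.span R (S ∪ ⋃ g, act g '' S))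
    refine ⟨ρ, hρ, LinearMap.range_eq_top.1 (top_le_iff.1 ?_)⟩
    rw [← hspan, Submodule.span_le]
    intro x hx
    exact ⟨1 ⊗ₜ ⟨x, Submodule.subset_span (Or.inl hx)⟩, (hρ _ _).trans (one_smul D x)⟩

end SpanAction

theorem wittLocalCohomology_self_eq_zero (k : Type u) [Field k] (d p : ℕ) [Fact p.Prime] (n : ℕ)
    (x : WittLocalCohomology k d p n d) : x = 0 := by
  have h (i : ℕ) (hi : i = 0) (y : reducedLocalCohomology (linSubspace k d d)
      (wittSheaf p n (projSpace k d)) i) : y = 0 := by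
    subst hi
    exact reducedLocalCohomology_zero _ _ y
  exact h (d - d) (Nat.sub_self d) x

theorem exists_finite_span_wittLocalCohomology_of_le (k : Type u) [Field k] [Finite k] (d p n j : ℕ)
    [Fact p.Prime] [CharP k p] (hn : 1 ≤ n) (hj : j ≤ d) :
    ∃ S : Set (WittLocalCohomology k d p n j), S.Finite ∧
      Submodule.span (globalWittDiffOps k d p n) S = ⊤ := by
  have : NeZero n := ⟨by omega⟩
  rcases hj.lt_or_eq with hj | rfl
  · exact exists_finite_span_wittLocalCohomology k d p n hj
  · exact ⟨∅, Set.finite_empty, eq_top_iff.2 fun x _ => by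
      rw [wittLocalCohomology_self_eq_zero k _ p n x]
      exact zero_mem _⟩

end

theorem mainTheorem1 (k : Type u) [Field k] [Finite k] (p : ℕ) [Fact p.Prime] [CharP k p]
    (hp : p ≠ 2) (d n j : ℕ) (hn : 1 ≤ n) (hj : j ≤ d) :
    ∃ N : Submodule (TruncatedWittVector p n k) (WittLocalCohomology k d p n j),
      N.FG ∧ (∀ g : parabolic k d j, ∀ x ∈ N, parabolicAct k d p n j g x ∈ N) ∧
      ∃ ρ : globalWittDiffOps k d p n ⊗[TruncatedWittVector p n k] N →ₗ[globalWittDiffOps k d p n]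
          WittLocalCohomology k d p n j,
        (∀ (P : globalWittDiffOps k d p n) (x : N),
          ρ (P ⊗ₜ x) = P • (x : WittLocalCohomology k d p n j)) ∧
        Function.Surjective ρ := by
  obtain ⟨S, hS, hspan⟩ := exists_finite_span_wittLocalCohomology_of_le k d p n j hn hj
  have : Finite (Matrix.GeneralLinearGroup (Fin (d + 1)) k) :=
    Finite.of_injective _ Units.val_injective
  exact exists_stable_fg_surjective (parabolicAct k d p n j)
    (fun g h x => parabolicAct_parabolicAct p n j g h x)
    (fun g c x => parabolicAct_smul p n j g c x) hS hspan
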